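/- Let $G=(V,E)$ be the complete undirected graph on a finite vertex set $V$, with edge lengths $c_e\ge 0$ ($e\in E$) satisfying the triangle inequality, a root $r\in V$, and penalties $\pi_v\ge 0$ ($v\in V$) with $\pi_r=0$. For $S\subseteq V$ let $\delta(S)=\{e\in E: |e\cap S|=|e\setminus S|=1\}$ and $\delta(v)=\delta(\{v\})$. Let $(x,y)\in\mathbb{R}^E\times\mathbb{R}^V$ be a feasible solution of the linear programming relaxation of prize-collecting TSP, i.e., $$x(\delta(v))=2y_v\ (v\in V\setminus\{r\}),\quad x(\delta(r))\le 2,\quad x(\delta(S))\ge 2y_v\ (S\subseteq V\setminus\{r\},\ v\in S),\quad y_r=1,\quad x\ge 0,\quad y\in[0,1]^V .$$ Let $V_1=\{v\in V: y_v=1\}$, and assume that there is an edge $e_0\in E$ with both endpoints in $V_1$ and $x_{e_0}\ge 1$. Let $\mathcal T$ be a finite set of trees that are subgraphs of $G$, and let $\mu\in[0,1]^{\mathcal T}$ be weights such that 1. $x=\sum_{T\in\mathcal T}\mu_T\chi^{E[T]}+\chi^{e_0}$; 2. $\sum_{T\in\mathcal T: v\in V[T]}\mu_T=y_v$ for every $v\in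 V\setminus V_1$; 3. $|V[T]\cap V_1|=2$ for every $T\in\mathcal T$; 4. in the multigraph $G_1$ on $V_1$ with edge set $E_1$ consisting of $e_0$ and, for every $T\in\mathcal T$, an edge $e_T$ joining the two vertices of $V[T]\cap V_1$, the point $z\in\mathbb{R}^{E_1}$ with $z_{e_0}=1$ and $z_{e_T}=\mu_T$ lies in the Held-Karp polytope of $G_1$, i.e., $z\ge 0$, $z(\delta(v))=2$ for all $v\in V_1$, and $z(\delta(S))\ge 2$ for all $\emptyset\ne S\subsetneq V_1$. For $T\in\mathcal T$ let $\mathrm{bb}(T)$ (the backbone) be the set of edges of the path in $T$ that connects the two vertices of $V[T]\cap V_1$, and let $\mathrm{lb}(T)=E[T]\setminus \mathrm{bb}(T)$ (the limbs). Then there is a multigraph $H$ on a subset $V[H]$ of $V$ (with edges from $E$, repetitions allowed) such that $H$ is connected, $V_1\subseteq V[H]$, every vertex of $V\setminus V_1$ has even degree in $H$, and $$c(E[H])+\pi(V\setminus V[H])\le\sum_{T\in\mathcal T}\mu_T\Bigl(c(\mathrm{bb}(T))+\tfrac32\, c(\mathrm{lb}(T))\Bigr)+\sum_{v\in V\setminus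 V_1}\pi_v\exp\Bigl(-\frac{3y_v}{4}\Bigr).$$ Moreover, there is a deterministic algorithm that, given rational data $(V,r,c,\pi,x,y,e_0,\mathcal T,\mu)$ as above, computes such a multigraph $H$ (as a list of its vertices and a list of its edges) in time polynomial in the encoding length of the data. -/

import Mathlib

namespace PCTSP

/-! ### A deterministic machine model with bit cost

Programs act on binary trees whose leaves are integers. Every elementary operation costs
one plus the number of bits of its argument and of its result, so that the model and the
(multitape) Turing machine simulate each other with polynomial overhead. -/

/-- Data: integers and ordered pairs. -/
inductive Val : Type
  | num (z : ℤ) : Val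
  | pair (a b : Val) : Val

namespace Val

/-- The number of bits needed to write a value, integers being written in binary. -/
def size : Val → ℕ
  | num z => z.natAbs.size + 1
  | pair a b => a.size + b.size + 1

/-- First component. -/
def fst : Val → Val
  | num _ => num 0
  | pair a _ => a

/-- Second component. -/
def snd : Val → Val
  | num _ => num 0
  | pair _ b => b

/-- The integer at a leaf (`0` for a pair). -/
def toInt : Val → ℤ
  | num z => z
  | pair _ _ => 0

/-- `1` for a pair and `0` for an integer. -/
def isPair : Val → Val
  | num _ => num 0
  | pair _ _ => num 1

/-- A list, with `0` as the empty list and pairs as its cells. -/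
def ofList : List Val → Val
  | [] => num 0
  | a :: l => pair a (ofList l)

/-- A vector, as the list of its entries. -/
def ofVec {n : ℕ} (f : Fin n → Val) : Val := ofList (List.ofFn f)

/-- A matrix, as the list of its rows. -/
def ofMat {m n : ℕ} (f : Fin m → Fin n → Val) : Val := ofVec fun i => ofVec (f i)

/-- A rational number, as the pair of its numerator and its denominator (in lowest terms). -/
def ofRat (q : ℚ) : Val := pair (num q.num) (num q.den)

/-- An element of `{0, …, n - 1}`. -/
def ofFin {n : ℕ} (i : Fin n) : Val := num ((i : ℕ) : ℤ)

end Val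

/-- The elementary operations. The binary ones act on a pair of integers; `div` is division with
remainder. -/
inductive Op : Type
  | id : Op
  | const (z : ℤ) : Op
  | fst : Op
  | snd : Op
  | isPair : Op
  | add : Op
  | sub : Op
  | mul : Op
  | div : Op
  | le : Op

/-- The result of an elementary operation. -/
def Op.eval : Op → Val → Val
  | .id, v => v
  | .const z, _ => .num z
  | .fst, v => v.fst
  | .snd, v => v.snd
  | .isPair, v => v.isPair
  | .add, v => .num (v.fst.toInt + v.snd.toInt)
  | .sub, v => .num (v.fst.toInt - v.snd.toInt)
  | .mul, v => .num (v.fst.toInt * v.snd.toInt)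
  | .div, v => .num (v.fst.toInt / v.snd.toInt)
  | .le, v => .num (if v.fst.toInt ≤ v.snd.toInt then 1 else 0)

/-- Programs. -/
inductive Prog : Type
  /-- an elementary operation -/
  | op (o : Op) : Prog
  /-- first `p`, then `q` on the result of `p` -/
  | seq (p q : Prog) : Prog
  /-- `p` and `q` on the same input, returning the pair of their results -/
  | fork (p q : Prog) : Prog
  /-- `p` if the test `b` does not return `0`, and `q` otherwise -/
  | ite (b p q : Prog) : Prog
  /-- apply `p` repeatedly as long as the test `b` does not return `0` -/
  | loop (b p : Prog) : Prog

/-- `Prog.Eval p v w t`: on input `v` the program `p` halts with output `w` after a computation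
of cost `t`. -/
inductive Prog.Eval : Prog → Val → Val → ℕ → Prop
  | op (o : Op) (v : Val) : Eval (.op o) v (o.eval v) (1 + v.size + (o.eval v).size)
  | seq {p q : Prog} {v w u : Val} {s t : ℕ} (hp : Eval p v w s) (hq : Eval q w u t) :
      Eval (.seq p q) v u (s + t + 1)
  | fork {p q : Prog} {v a b : Val} {s t : ℕ} (hp : Eval p v a s) (hq : Eval q v b t) :
      Eval (.fork p q) v (.pair a b) (s + t + 1)
  | ite_true {b p q : Prog} {v u w : Val} {s t : ℕ} (hb : Eval b v u s) (hu : u ≠ .num 0)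
      (hp : Eval p v w t) : Eval (.ite b p q) v w (s + t + 1)
  | ite_false {b p q : Prog} {v w : Val} {s t : ℕ} (hb : Eval b v (.num 0) s)
      (hq : Eval q v w t) : Eval (.ite b p q) v w (s + t + 1)
  | loop_stop {b p : Prog} {v : Val} {s : ℕ} (hb : Eval b v (.num 0) s) :
      Eval (.loop b p) v v (s + 1)
  | loop_step {b p : Prog} {v u w z : Val} {s t l : ℕ} (hb : Eval b v u s) (hu : u ≠ .num 0)
      (hp : Eval p v w t) (hl : Eval (.loop b p) w z l) : Eval (.loop b p) v z (s + t + l + 1)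

/-- Programs are deterministic: the input determines the output and the cost. -/
theorem Prog.Eval.deterministic {p : Prog} {v w w' : Val} {t t' : ℕ}
    (h : p.Eval v w t) (h' : p.Eval v w' t') : w = w' ∧ t = t' := by
  induction h generalizing w' t' with
  | op o v => cases h'; exact ⟨rfl, rfl⟩
  | seq _ _ ih1 ih2 =>
    cases h' with
    | seq a b => obtain ⟨rfl, rfl⟩ := ih1 a; obtain ⟨rfl, rfl⟩ := ih2 b; exact ⟨rfl, rfl⟩
  | fork _ _ ih1 ih2 =>
    cases h' with
    | fork a b => obtain ⟨rfl, rfl⟩ := ih1 a; obtain ⟨rfl, rfl⟩ := ih2 b; exact ⟨rfl, rfl⟩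
  | ite_true _ hu _ ih1 ih2 =>
    cases h' with
    | ite_true a _ b => obtain ⟨rfl, rfl⟩ := ih1 a; obtain ⟨rfl, rfl⟩ := ih2 b; exact ⟨rfl, rfl⟩
    | ite_false a b => exact absurd (ih1 a).1 hu
  | ite_false _ _ ih1 ih2 =>
    cases h' with
    | ite_true a hu b => exact absurd (ih1 a).1.symm hu
    | ite_false a b => obtain ⟨-, rfl⟩ := ih1 a; obtain ⟨rfl, rfl⟩ := ih2 b; exact ⟨rfl, rfl⟩
  | loop_stop _ ih =>
    cases h' with
    | loop_stop a => obtain ⟨-, rfl⟩ := ih a; exact ⟨rfl, rfl⟩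
    | loop_step a hu b l => exact absurd (ih a).1.symm hu
  | loop_step _ hu _ _ ih1 ih2 ih3 =>
    cases h' with
    | loop_stop a => exact absurd (ih1 a).1 hu
    | loop_step a _ b l =>
      obtain ⟨rfl, rfl⟩ := ih1 a
      obtain ⟨rfl, rfl⟩ := ih2 b
      obtain ⟨rfl, rfl⟩ := ih3 l
      exact ⟨rfl, rfl⟩

/-! ### Prize-collecting TSP

An edge function of the complete graph on `V` is a function on `Sym2 V`; its values on the
diagonal are never used. -/

/-- `f(F) = ∑_{a ∈ F} f(a)`, used for finite index types only. -/
noncomputable def total {α : Type*} (f : α → ℝ) (F : Set α) : ℝ := ∑ᶠ a ∈ F, f a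

/-- The vertex pair `e` belongs to the cut `δ(S)`. -/
def Crosses {V : Type*} (e S : Set V) : Prop := (e ∩ S).ncard = 1 ∧ (e \ S).ncard = 1

/-- The cut `δ(S)` in the complete graph on `V`. -/
def cut {V : Type*} (S : Set V) : Set (Sym2 V) := {e | Crosses (e : Set V) S}

/-- An instance: nonnegative edge lengths with the triangle inequality, and nonnegative penalties,
with the convention that the root has penalty zero. -/
structure IsInstance {V : Type*} (r : V) (c : Sym2 V → ℝ) (penalty : V → ℝ) : Prop where
  length_nonneg : ∀ e, ¬ e.IsDiag → 0 ≤ c e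
  triangle : ∀ u v w, u ≠ v → v ≠ w → u ≠ w → c s(u, w) ≤ c s(u, v) + c s(v, w)
  penalty_nonneg : ∀ v, 0 ≤ penalty v
  penalty_root : penalty r = 0

/-- Feasible solutions of the linear programming relaxation. -/
structure IsFeasible {V : Type*} (r : V) (x : Sym2 V → ℝ) (y : V → ℝ) : Prop where
  degree : ∀ v, v ≠ r → total x (cut {v}) = 2 * y v
  degree_root : total x (cut {r}) ≤ 2
  connectivity : ∀ S : Set V, r ∉ S → ∀ v ∈ S, 2 * y v ≤ total x (cut S)
  y_root : y r = 1
  x_nonneg : ∀ e, ¬ e.IsDiag → 0 ≤ x e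
  y_mem : ∀ v, y v ∈ Set.Icc (0 : ℝ) 1

/-- The set `V₁` of fully connected vertices. -/
def core {V : Type*} (y : V → ℝ) : Set V := {v | y v = 1}

/-- `e₀` is an edge with both endpoints in `V₁` and with `x(e₀) ≥ 1`. -/
structure IsCoreEdge {V : Type*} (x : Sym2 V → ℝ) (y : V → ℝ) (e₀ : Sym2 V) : Prop where
  not_isDiag : ¬ e₀.IsDiag
  mem_core : ∀ v ∈ e₀, v ∈ core y
  one_le : 1 ≤ x e₀

/-- Membership of `z` in the Held-Karp polytope of the multigraph on the vertex set `U` with the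
edges `e k` (each of them a set of two vertices of `U`). -/
structure InHeldKarp {V κ : Type*} (U : Set V) (e : κ → Set V) (z : κ → ℝ) : Prop where
  nonneg : ∀ k, 0 ≤ z k
  degree : ∀ v ∈ U, total z {k | Crosses (e k) {v}} = 2
  connectivity : ∀ S, S ⊂ U → S.Nonempty → 2 ≤ total z {k | Crosses (e k) S}

/-- A set of trees `T i` in the complete graph on `V` with weights `weight i`, decomposing the
solution `(x, y)` with special edge `e₀`. In the multigraph of the last condition, the edge with
index `none` is `e₀` and the edge with index `some i` joins the two anchors of `T i`. -/
structure IsDecomposition {V ι : Type*} (x : Sym2 V → ℝ) (y : V → ℝ) (e₀ : Sym2 V)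
    (T : ι → (⊤ : SimpleGraph V).Subgraph) (weight : ι → ℝ) : Prop where
  injective : Function.Injective T
  isTree : ∀ i, (T i).coe.IsTree
  weight_mem : ∀ i, weight i ∈ Set.Icc (0 : ℝ) 1
  edges : ∀ e, ¬ e.IsDiag →
    x e = total weight {i | e ∈ (T i).edgeSet} + Set.indicator {e₀} 1 e
  vertices : ∀ v, v ∉ core y → total weight {i | v ∈ (T i).verts} = y v
  anchors : ∀ i, ((T i).verts ∩ core y).ncard = 2
  heldKarp : InHeldKarp (core y)
    (fun k : Option ι => k.elim (e₀ : Set V) fun i => (T i).verts ∩ core y)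
    (fun k : Option ι => k.elim 1 weight)

/-- The backbone of a tree `T` with respect to `U`: the edges on the path in `T` that connects the
two vertices of `T` in `U`. -/
def backbone {V : Type*} (U : Set V) (T : (⊤ : SimpleGraph V).Subgraph) : Set (Sym2 V) :=
  {e | ∃ a ∈ T.verts ∩ U, ∃ b ∈ T.verts ∩ U, a ≠ b ∧
    ∃ p : T.spanningCoe.Walk a b, p.IsPath ∧ e ∈ p.edges}

/-- The limbs of `T`: the edges of `T` outside of the backbone. -/
def limbs {V : Type*} (U : Set V) (T : (⊤ : SimpleGraph V).Subgraph) : Set (Sym2 V) :=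
  T.edgeSet \ backbone U T

/-- A multigraph on a subset of `V`, whose edges are edges of the complete graph on `V`. -/
structure Multigraph (V : Type*) where
  verts : Finset V
  edges : Multiset (Sym2 V)
  not_isDiag : ∀ e ∈ edges, ¬ e.IsDiag
  mem_verts : ∀ e ∈ edges, ∀ v ∈ e, v ∈ verts

namespace Multigraph

variable {V : Type*}

/-- The underlying simple graph. -/
def toSubgraph (H : Multigraph V) : (⊤ : SimpleGraph V).Subgraph where
  verts := H.verts
  Adj a b := s(a, b) ∈ H.edges
  adj_sub {a b} h := by
    simpa using H.not_isDiag _ h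
  edge_vert {a b} h := H.mem_verts _ h a (Sym2.mem_mk_left a b)
  symm := ⟨fun a b h => by rwa [Sym2.eq_swap]⟩

open Classical in
/-- The degree of a vertex (zero for a vertex outside of the multigraph). -/
noncomputable def degree (H : Multigraph V) (v : V) : ℕ :=
  H.edges.countP fun e => v ∈ e

/-- The length `c(E[H])`, counted with multiplicities. -/
def length (H : Multigraph V) (c : Sym2 V → ℝ) : ℝ := (H.edges.map c).sum

end Multigraph

/-- The data at hand: an instance (root, lengths, penalties), a pair `(x, y)`, an edge `e₀`, and a
family of subgraphs with weights. Numbers are taken from `K`. -/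
structure Input (V ι K : Type*) where
  root : V
  length : Sym2 V → K
  penalty : V → K
  x : Sym2 V → K
  y : V → K
  e₀ : Sym2 V
  tree : ι → (⊤ : SimpleGraph V).Subgraph
  weight : ι → K

namespace Input

/-- Rational data, read as real data. -/
def toReal {V ι : Type*} (I : Input V ι ℚ) : Input V ι ℝ where
  root := I.root
  length e := (I.length e : ℝ)
  penalty v := (I.penalty v : ℝ)
  x e := (I.x e : ℝ)
  y v := (I.y v : ℝ)
  e₀ := I.e₀
  tree := I.tree
  weight i := (I.weight i : ℝ)

/-- The assumptions on the data. -/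
structure Valid {V ι : Type*} (I : Input V ι ℝ) : Prop where
  isInstance : IsInstance I.root I.length I.penalty
  isFeasible : IsFeasible I.root I.x I.y
  isCoreEdge : IsCoreEdge I.x I.y I.e₀
  isDecomposition : IsDecomposition I.x I.y I.e₀ I.tree I.weight

/-- The required properties of the multigraph `H`. -/
structure Good {V ι : Type*} (I : Input V ι ℝ) (H : Multigraph V) : Prop where
  connected : H.toSubgraph.Connected
  spans : ∀ v ∈ core I.y, v ∈ H.verts
  even_degree : ∀ v, v ∉ core I.y → Even (H.degree v)
  cost_le : H.length I.length + total I.penalty {v | v ∉ H.verts} ≤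
    ∑ᶠ i, I.weight i * (total I.length (backbone (core I.y) (I.tree i)) +
      3 / 2 * total I.length (limbs (core I.y) (I.tree i))) +
    total (fun v => I.penalty v * Real.exp (-(3 * I.y v / 4))) {v | v ∉ core I.y}

/-- The matrix of an edge function, with zeros on the diagonal. -/
def edgeMatrix {n : ℕ} (f : Sym2 (Fin n) → ℚ) : Val :=
  .ofMat fun u v => .ofRat (if u = v then 0 else f s(u, v))

open Classical in
/-- The adjacency matrix of a subgraph. -/
noncomputable def adjMatrix {n : ℕ} (T : (⊤ : SimpleGraph (Fin n)).Subgraph) : Val :=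
  .ofMat fun u v => .num (if T.Adj u v then 1 else 0)

/-- The encoding of rational data on the vertices `0, …, n - 1` with trees `0, …, k - 1`: the list
of `n`, `k`, the root, the lengths, the penalties, `x`, `y`, the two endpoints of `e₀`, the trees
and their weights. -/
noncomputable def encode {n k : ℕ} (I : Input (Fin n) (Fin k) ℚ) : Val :=
  .ofList [.num n, .num k, .ofFin I.root, edgeMatrix I.length, .ofVec fun v => .ofRat (I.penalty v),
    edgeMatrix I.x, .ofVec fun v => .ofRat (I.y v), .pair (.ofFin I.e₀.inf) (.ofFin I.e₀.sup),
    .ofVec fun i => adjMatrix (I.tree i), .ofVec fun i => .ofRat (I.weight i)]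

end Input

/-- The value `v` describes the multigraph `H`, by a list of its vertices and a list of its edges
(each edge as often as it occurs, as a pair of endpoints). -/
def Multigraph.IsEncodedBy {n : ℕ} (H : Multigraph (Fin n)) (v : Val) : Prop :=
  ∃ (vs : List (Fin n)) (es : List (Fin n × Fin n)),
    (vs : Multiset (Fin n)) = H.verts.val ∧
    (es.map fun e => s(e.1, e.2) : Multiset (Sym2 (Fin n))) = H.edges ∧
    v = .pair (.ofList (vs.map .ofFin)) (.ofList (es.map fun e => .pair (.ofFin e.1) (.ofFin e.2)))

end PCTSP

namespace PCTSP

/-! ### Polynomial time functions -/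

/-! Replace every tree `T` by two parallel copies of its anchor edge: a "full" copy of weight 3/4
μ_T, which stands for `T` with doubled limbs, and a "half" copy of weight 1/4 μ_T, which stands for
the backbone alone. Since 3/4 (bb + 2 lb) + 1/4 bb = bb + 3/2 lb, the weighted cost of the copies is
the first term of the bound. The degree equations turn the cut constraints of the Held-Karp polytope
into z(E[S]) ≤ |S| - 1, with z(E[V₁]) = |V₁|; removing `e₀` leaves a point of the spanning tree
polytope on V₁ (`copyWeight_mem`).

Any spanning tree of copies yields a suitable multigraph. It is connected because the backbones
realise the tree edges on V₁ and selected full trees are attached to their anchors. Degrees outside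
V₁ are even because backbones are paths between vertices of V₁ and limbs are doubled. The cost is
bounded by the objective Σ d_e x_e + Σ π_v ∏ (1 - x_e), where the product runs over the full copies
of trees containing v (`good_selection`). At the fractional point the product is at most exp(-3 y_v
/ 4), because 1 - t ≤ exp(-t) (`objective_copyWeight_le`).

It remains to round without increasing the objective, which pipage rounding achieves
deterministically. Along an exchange direction χ_i - χ_j the objective is a concave quadratic, so
one of the two directions never increases it, and one moves until the pair is blocked by a zero
coordinate or a tight set. Blocked pairs stay blocked (`Blocked.shift`), and by uncrossing of tight
sets a point all of whose pairs are blocked is integral (`InTreePolytope.integral`). For real data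
the maximum move comes from compactness (`exists_blocked_shift`).

For the algorithm all data are scaled to integers and the maximum move is found by binary search
with a membership test (`moveProg_elems`). The test rests on an orientation criterion: a nonnegative
point with the right total lies in the D-fold spanning tree polytope if and only if, for each root,
the value of each edge can be split between its endpoints such that the root receives nothing and
every other vertex at most D. Such a splitting is found approximately by simultaneous local load
balancing, whose quadratic potential decreases geometrically. After scaling by a large factor the
remaining error is smaller than one unit (`balance_test_iff`).

Polynomial running time is obtained from a calculus of closure properties of `PT`. Programs are
written as ordinary functions on lists and integers, and only loops need explicit bounds on
intermediate sizes. -/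

theorem polynomial_eval_mono (q : Polynomial ℕ) {a b : ℕ} (h : a ≤ b) : q.eval a ≤ q.eval b := by
  induction q using Polynomial.induction_on' with
  | add p q hp hq => simpa using add_le_add hp hq
  | monomial n c => simpa using Nat.mul_le_mul_left c (Nat.pow_le_pow_left h n)

theorem Val.one_le_size (v : Val) : 1 ≤ v.size := by
  cases v <;> simp [Val.size]

/-- Elementary operations are charged for reading and writing, so a time bound is also a size bound.
Hence composition needs no separate control of output sizes. -/
theorem Prog.Eval.size_le {p : Prog} {v w : Val} {t : ℕ} (h : p.Eval v w t) :
    v.size ≤ t ∧ w.size ≤ t := by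
  induction h with
  | op o v => omega
  | seq _ _ h1 h2 => omega
  | fork _ _ h1 h2 => simp only [Val.size]; omega
  | ite_true _ _ _ h1 h2 => omega
  | ite_false _ _ h1 h2 => omega
  | loop_stop _ h => omega
  | loop_step _ _ _ _ h1 h2 h3 => omega

theorem size_natAbs_add_le (a b : ℤ) :
    (a + b).natAbs.size ≤ a.natAbs.size + b.natAbs.size + 1 := by
  rw [Nat.size_le]
  have h1 := Nat.lt_size_self a.natAbs
  have h2 := Nat.lt_size_self b.natAbs
  have h3 := Int.natAbs_add_le a b
  have h4 : 2 ^ a.natAbs.size ≤ 2 ^ (a.natAbs.size + b.natAbs.size) :=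
    Nat.pow_le_pow_right (by norm_num) (by omega)
  have h5 : 2 ^ b.natAbs.size ≤ 2 ^ (a.natAbs.size + b.natAbs.size) :=
    Nat.pow_le_pow_right (by norm_num) (by omega)
  rw [pow_succ]
  omega

theorem size_natAbs_sub_le (a b : ℤ) :
    (a - b).natAbs.size ≤ a.natAbs.size + b.natAbs.size + 1 := by
  simpa [sub_eq_add_neg] using size_natAbs_add_le a (-b)

theorem size_natAbs_mul_le (a b : ℤ) :
    (a * b).natAbs.size ≤ a.natAbs.size + b.natAbs.size := by
  rw [Nat.size_le, Int.natAbs_mul, pow_add]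
  exact Nat.mul_lt_mul'' (Nat.lt_size_self _) (Nat.lt_size_self _)

theorem size_natAbs_div_le (a b : ℤ) : (a / b).natAbs.size ≤ a.natAbs.size :=
  Nat.size_le_size (Int.natAbs_ediv_le_natAbs a b)

theorem Val.size_fst_le (v : Val) : v.fst.size ≤ v.size := by
  cases v
  · simp [Val.size, Val.fst]
  · simp only [Val.size, Val.fst]; omega

theorem Val.size_snd_le (v : Val) : v.snd.size ≤ v.size := by
  cases v
  · simp [Val.size, Val.snd]
  · simp only [Val.size, Val.snd]; omega

theorem Val.size_toInt_le (v : Val) : v.toInt.natAbs.size + 1 ≤ v.size := by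
  cases v <;> simp [Val.size, Val.toInt]

theorem Val.size_toInt_add_le (v : Val) :
    v.fst.toInt.natAbs.size + v.snd.toInt.natAbs.size + 1 ≤ v.size + 1 := by
  cases v with
  | num z => simp [Val.size, Val.toInt, Val.fst, Val.snd]
  | pair a b =>
    have := a.size_toInt_le
    have := b.size_toInt_le
    simp only [Val.size, Val.fst, Val.snd]
    omega

/-- A bound for the increase in size by an elementary operation. -/
def Op.overhead : Op → ℕ
  | .const z => z.natAbs.size + 1
  | _ => 2

/-- The increase is additive even for multiplication: the operands form a pair, whose size already
contains both bit lengths. -/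
theorem Op.size_eval_le (o : Op) (v : Val) : (o.eval v).size ≤ v.size + o.overhead := by
  have h := v.size_toInt_add_le
  cases o with
  | id => simp [Op.eval]
  | const z => simp [Op.eval, Op.overhead, Val.size]
  | fst => exact v.size_fst_le.trans (by omega)
  | snd => exact v.size_snd_le.trans (by omega)
  | isPair => cases v <;> simp [Op.eval, Val.isPair, Val.size, Op.overhead]
  | add =>
    have := size_natAbs_add_le v.fst.toInt v.snd.toInt
    simp only [Op.eval, Op.overhead, Val.size]; omega
  | sub =>
    have := size_natAbs_sub_le v.fst.toInt v.snd.toInt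
    simp only [Op.eval, Op.overhead, Val.size]; omega
  | mul =>
    have := size_natAbs_mul_le v.fst.toInt v.snd.toInt
    simp only [Op.eval, Op.overhead, Val.size]; omega
  | div =>
    have := size_natAbs_div_le v.fst.toInt v.snd.toInt
    simp only [Op.eval, Op.overhead, Val.size]; omega
  | le =>
    simp only [Op.eval, Op.overhead]
    split <;> simp [Val.size]

/-- Types whose elements are encoded as values. -/
class Enc (α : Type) where
  /-- the encoding -/
  enc : α → Val

open Enc

instance : Enc ℤ := ⟨.num⟩
instance : Enc Bool := ⟨fun b => .num (if b then 1 else 0)⟩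
instance {α β : Type} [Enc α] [Enc β] : Enc (α × β) := ⟨fun p => .pair (enc p.1) (enc p.2)⟩
instance {α : Type} [Enc α] : Enc (List α) := ⟨fun l => .ofList (l.map enc)⟩

/-- The size of the encoding. -/
def esize {α : Type} [Enc α] (a : α) : ℕ := (enc a).size

set_option linter.unusedSectionVars false

/-! ### Sizes of encodings, and closure properties of polynomial time functions. -/

section

variable {α β γ δ σ : Type} [Enc α] [Enc β] [Enc γ] [Enc δ] [Enc σ]

theorem esize_pair (a : α) (b : β) : esize (a, b) = esize a + esize b + 1 := rfl
theorem esize_prod (p : α × β) : esize p = esize p.1 + esize p.2 + 1 := rfl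
theorem esize_nil : esize ([] : List α) = 1 := by simp [esize, enc, Val.ofList, Val.size]
theorem esize_cons (a : α) (l : List α) : esize (a :: l) = esize a + esize l + 1 := rfl
theorem esize_int (z : ℤ) : esize z = z.natAbs.size + 1 := rfl
theorem one_le_esize (a : α) : 1 ≤ esize a := Val.one_le_size _
theorem esize_append (l l' : List α) : esize (l ++ l') + 1 = esize l + esize l' := by
  induction l with
  | nil => rw [esize_nil, List.nil_append]; omega
  | cons a l ih => rw [List.cons_append, esize_cons, esize_cons]; omega

theorem esize_reverse (l : List α) : esize l.reverse = esize l := by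
  induction l with
  | nil => rfl
  | cons a l ih =>
    have h := esize_append l.reverse [a]
    rw [esize_cons, esize_nil] at h
    rw [List.reverse_cons, esize_cons]
    omega

theorem length_lt_esize (l : List α) : l.length < esize l := by
  induction l with
  | nil => rw [esize_nil]; simp
  | cons a l ih => rw [esize_cons, List.length_cons]; omega

theorem esize_le_of_mem {a : α} {l : List α} (h : a ∈ l) : esize a ≤ esize l := by
  induction l with
  | nil => simp at h
  | cons b l ih =>
    rw [esize_cons]
    rcases List.mem_cons.1 h with rfl | h
    · omega
    · have := ih h; omega

theorem esize_list_le {l : List α} {B : ℕ} (h : ∀ a ∈ l, esize a ≤ B) :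
    esize l ≤ l.length * (B + 1) + 1 := by
  induction l with
  | nil => rw [esize_nil]; simp
  | cons a l ih =>
    have h1 := h a (by simp)
    have h2 := ih fun b hb => h b (by simp [hb])
    rw [esize_cons, List.length_cons, add_mul]
    omega

theorem esize_foldl_append_le (l₁ l₂ : List α) : esize l₁ ≤ esize (l₁ ++ l₂) := by
  have := esize_append l₁ l₂
  have := one_le_esize l₂
  omega

/-- Functions computed by a program in polynomial time. -/
@[fun_prop]
def PT (f : α → β) : Prop :=
  ∃ (p : Prog) (q : Polynomial ℕ), ∀ a, ∃ t, p.Eval (enc a) (enc (f a)) t ∧ t ≤ q.eval (esize a)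

namespace PT

theorem size_bound {f : α → β} (h : PT f) :
    ∃ q : Polynomial ℕ, ∀ a, esize (f a) ≤ q.eval (esize a) := by
  obtain ⟨p, q, h⟩ := h
  refine ⟨q, fun a => ?_⟩
  obtain ⟨t, h1, h2⟩ := h a
  exact h1.size_le.2.trans h2

theorem of_op {f : α → β} (o : Op) (h : ∀ a, o.eval (enc a) = enc (f a)) : PT f := by
  refine ⟨.op o, 1 + 2 * .X + .C o.overhead, fun a => ?_⟩
  refine ⟨_, h a ▸ Prog.Eval.op o (enc a), ?_⟩
  have := o.size_eval_le (enc a)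
  rw [h] at this
  simp only [Polynomial.eval_add, Polynomial.eval_one, Polynomial.eval_mul, Polynomial.eval_ofNat,
    Polynomial.eval_X, Polynomial.eval_C, esize]
  omega

-- The inner running time bounds the size of the intermediate result, hence the composed polynomial.
-- The closure properties are tagged for `fun_prop`, which then proves `PT` for composite functions
-- after unfolding.
@[fun_prop]
theorem comp {g : β → γ} {f : α → β} (hg : PT g) (hf : PT f) : PT fun x => g (f x) := by
  obtain ⟨p, q, hf⟩ := hf
  obtain ⟨p', q', hg⟩ := hg
  refine ⟨.seq p p', q + q'.comp q + 1, fun a => ?_⟩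
  obtain ⟨t, h1, h2⟩ := hf a
  obtain ⟨t', h1', h2'⟩ := hg (f a)
  refine ⟨_, .seq h1 h1', ?_⟩
  have := polynomial_eval_mono q' (h1.size_le.2.trans h2)
  simp only [Polynomial.eval_add, Polynomial.eval_one, Polynomial.eval_comp]
  simp only [esize] at *
  omega

@[fun_prop]
theorem pair {f : γ → α} {g : γ → β} (hf : PT f) (hg : PT g) : PT fun x => (f x, g x) := by
  obtain ⟨p, q, hf⟩ := hf
  obtain ⟨p', q', hg⟩ := hg
  refine ⟨.fork p p', q + q' + 1, fun a => ?_⟩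
  obtain ⟨t, h1, h2⟩ := hf a
  obtain ⟨t', h1', h2'⟩ := hg a
  refine ⟨_, .fork h1 h1', ?_⟩
  simp only [Polynomial.eval_add, Polynomial.eval_one]
  omega

@[fun_prop]
theorem id' : PT fun x : α => x := of_op .id fun _ => rfl

theorem const_int {f : γ → α} (z : ℤ) (h : ∀ x, .num z = enc (f x)) : PT f :=
  of_op (.const z) h

@[fun_prop]
theorem fst {f : γ → α × β} (hf : PT f) : PT fun x => (f x).1 :=
  comp (of_op (f := fun p : α × β => p.1) .fst fun _ => rfl) hf

@[fun_prop]
theorem snd {f : γ → α × β} (hf : PT f) : PT fun x => (f x).2 :=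
  comp (of_op (f := fun p : α × β => p.2) .snd fun _ => rfl) hf

theorem nil : PT fun _ : γ => ([] : List α) := const_int 0 fun _ => rfl

-- A cons cell and a pair have the same encoding, so the program for pairs serves unchanged.
@[fun_prop]
theorem cons {f : γ → α} {g : γ → List α} (hf : PT f) (hg : PT g) : PT fun x => f x :: g x := by
  obtain ⟨p, q, h⟩ := hf.pair hg
  exact ⟨p, q, h⟩

theorem int (z : ℤ) : PT fun _ : γ => z := const_int z fun _ => rfl
theorem bool (b : Bool) : PT fun _ : γ => b := const_int (if b then 1 else 0) fun _ => rfl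

@[fun_prop]
theorem const (c : α) : PT fun _ : γ => c := by
  have h : ∀ v : Val, ∃ (p : Prog) (q : Polynomial ℕ), ∀ a : γ, ∃ t,
      p.Eval (enc a) v t ∧ t ≤ q.eval (esize a) := by
    intro v
    induction v with
    | num z => exact int (γ := γ) z
    | pair a b iha ihb =>
      obtain ⟨p, q, hf⟩ := iha
      obtain ⟨p', q', hg⟩ := ihb
      refine ⟨.fork p p', q + q' + 1, fun a => ?_⟩
      obtain ⟨t, h1, h2⟩ := hf a
      obtain ⟨t', h1', h2'⟩ := hg a
      refine ⟨_, .fork h1 h1', ?_⟩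
      simp only [Polynomial.eval_add, Polynomial.eval_one]
      omega
  exact h _

@[fun_prop]
theorem add {f g : γ → ℤ} (hf : PT f) (hg : PT g) : PT fun x => f x + g x :=
  comp (of_op (f := fun p : ℤ × ℤ => p.1 + p.2) .add fun _ => rfl) (hf.pair hg)

@[fun_prop]
theorem sub {f g : γ → ℤ} (hf : PT f) (hg : PT g) : PT fun x => f x - g x :=
  comp (of_op (f := fun p : ℤ × ℤ => p.1 - p.2) .sub fun _ => rfl) (hf.pair hg)

@[fun_prop]
theorem mul {f g : γ → ℤ} (hf : PT f) (hg : PT g) : PT fun x => f x * g x :=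
  comp (of_op (f := fun p : ℤ × ℤ => p.1 * p.2) .mul fun _ => rfl) (hf.pair hg)

@[fun_prop]
theorem div {f g : γ → ℤ} (hf : PT f) (hg : PT g) : PT fun x => f x / g x :=
  comp (of_op (f := fun p : ℤ × ℤ => p.1 / p.2) .div fun _ => rfl) (hf.pair hg)

@[fun_prop]
theorem decide_le {f g : γ → ℤ} (hf : PT f) (hg : PT g) : PT fun x => decide (f x ≤ g x) :=
  comp (of_op (f := fun p : ℤ × ℤ => decide (p.1 ≤ p.2)) .le fun p => by
    by_cases h : p.1 ≤ p.2 <;> simp [Op.eval, Enc.enc, Val.fst, Val.snd, Val.toInt, h])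
    (hf.pair hg)

theorem cond {b : γ → Bool} {f g : γ → α} (hb : PT b) (hf : PT f) (hg : PT g) :
    PT fun x => bif b x then f x else g x := by
  obtain ⟨p, q, hb⟩ := hb
  obtain ⟨p₁, q₁, hf⟩ := hf
  obtain ⟨p₂, q₂, hg⟩ := hg
  refine ⟨.ite p p₁ p₂, q + q₁ + q₂ + 1, fun a => ?_⟩
  obtain ⟨t, h1, h2⟩ := hb a
  obtain ⟨t₁, h3, h4⟩ := hf a
  obtain ⟨t₂, h5, h6⟩ := hg a
  simp only [Polynomial.eval_add, Polynomial.eval_one]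
  cases hb' : b a with
  | true => exact ⟨_, .ite_true h1 (by simp [hb', Enc.enc]) h3, by omega⟩
  | false => exact ⟨_, .ite_false (by simpa [hb', Enc.enc] using h1) h5, by omega⟩

@[fun_prop]
theorem ite {P : γ → Prop} [∀ x, Decidable (P x)] {f g : γ → α} (hb : PT fun x => decide (P x))
    (hf : PT f) (hg : PT g) : PT fun x => if P x then f x else g x := by
  simpa [Bool.cond_eq_ite] using cond hb hf hg

@[fun_prop]
theorem decide_not {P : γ → Prop} [∀ x, Decidable (P x)] (h : PT fun x => decide (P x)) :
    PT fun x => decide (¬ P x) := by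
  simpa [Bool.cond_eq_ite] using cond h (bool false) (bool true)

@[fun_prop]
theorem decide_and {P Q : γ → Prop} [∀ x, Decidable (P x)] [∀ x, Decidable (Q x)]
    (h : PT fun x => decide (P x)) (h' : PT fun x => decide (Q x)) :
    PT fun x => decide (P x ∧ Q x) := by
  have := cond h h' (bool false)
  refine (funext fun x => ?_ : _ = fun x => decide (P x ∧ Q x)) ▸ this
  by_cases hx : P x <;> simp [hx]

@[fun_prop]
theorem decide_or {P Q : γ → Prop} [∀ x, Decidable (P x)] [∀ x, Decidable (Q x)]
    (h : PT fun x => decide (P x)) (h' : PT fun x => decide (Q x)) :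
    PT fun x => decide (P x ∨ Q x) := by
  have := cond h (bool true) h'
  refine (funext fun x => ?_ : _ = fun x => decide (P x ∨ Q x)) ▸ this
  by_cases hx : P x <;> simp [hx]

@[fun_prop]
theorem decide_eq {f g : γ → ℤ} (hf : PT f) (hg : PT g) : PT fun x => decide (f x = g x) := by
  have := decide_and (decide_le hf hg) (decide_le hg hf)
  refine (funext fun x => ?_ : _ = fun x => decide (f x = g x)) ▸ this
  simp [le_antisymm_iff]

@[fun_prop]
theorem min {f g : γ → ℤ} (hf : PT f) (hg : PT g) : PT fun x => min (f x) (g x) := by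
  simp only [min_def]
  fun_prop

@[fun_prop]
theorem max {f g : γ → ℤ} (hf : PT f) (hg : PT g) : PT fun x => max (f x) (g x) := by
  simp only [max_def]
  fun_prop

@[fun_prop]
theorem neg {f : γ → ℤ} (hf : PT f) : PT fun x => -f x := by
  simp only [← zero_sub (f _)]
  fun_prop

end PT

/-- A loop whose tests and bodies have cost at most `T`. -/
theorem eval_loop {b p : Prog} (s : ℕ → Val) (T n : ℕ)
    (hb : ∀ i < n, ∃ u t, b.Eval (s i) u t ∧ u ≠ .num 0 ∧ t ≤ T)
    (hp : ∀ i < n, ∃ t, p.Eval (s i) (s (i + 1)) t ∧ t ≤ T)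
    (hs : ∃ t, b.Eval (s n) (.num 0) t ∧ t ≤ T) :
    ∃ t, (Prog.loop b p).Eval (s 0) (s n) t ∧ t ≤ (2 * T + 1) * (n + 1) := by
  induction n generalizing s with
  | zero =>
    obtain ⟨t, h, ht⟩ := hs
    exact ⟨_, Prog.Eval.loop_stop h, by omega⟩
  | succ n ih =>
    obtain ⟨t, h, ht⟩ := ih (fun i => s (i + 1)) (fun i hi => hb (i + 1) (by omega))
      (fun i hi => hp (i + 1) (by omega)) hs
    obtain ⟨u, t₁, h1, hu, h1'⟩ := hb 0 (by omega)
    obtain ⟨t₂, h2, h2'⟩ := hp 0 (by omega)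
    refine ⟨_, .loop_step h1 hu h2 h, ?_⟩
    rw [mul_add (2 * T + 1) (n + 1) 1]
    omega

/-! ### Loops, folds, and list operations in polynomial time. -/

namespace PT

/-- Iteration until a test fails, provided that the number of iterations and the size of the
intermediate results are polynomially bounded. -/
theorem while_loop {init : γ → α} {b : α → Bool} {f : α → α} (hi : PT init) (hb : PT b) (hf : PT f)
    (n : γ → ℕ) (Q B : Polynomial ℕ) (hn : ∀ x, n x ≤ Q.eval (esize x))
    (hB : ∀ x, ∀ i ≤ n x, esize (f^[i] (init x)) ≤ B.eval (esize x))
    (ht : ∀ x, ∀ i < n x, b (f^[i] (init x)) = true) (hs : ∀ x, b (f^[n x] (init x)) = false) :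
    PT fun x => f^[n x] (init x) := by
  obtain ⟨pi, qi, hi⟩ := hi
  obtain ⟨pb, qb, hb⟩ := hb
  obtain ⟨pf, qf, hf⟩ := hf
  refine ⟨.seq pi (.loop pb pf), qi + (2 * (qb.comp B + qf.comp B) + 1) * (Q + 1) + 1,
    fun x => ?_⟩
  obtain ⟨t₀, h₀, h₀'⟩ := hi x
  obtain ⟨t, h, h'⟩ : ∃ t, (Prog.loop pb pf).Eval (enc (init x)) (enc (f^[n x] (init x))) t ∧
      t ≤ (2 * (qb.eval (B.eval (esize x)) + qf.eval (B.eval (esize x))) + 1) * (n x + 1) := by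
    refine eval_loop (fun i => enc (f^[i] (init x))) _ _ ?_ ?_ ?_
    · intro i hi
      obtain ⟨t, h, h'⟩ := hb (f^[i] (init x))
      have := polynomial_eval_mono qb (hB x i hi.le)
      exact ⟨_, t, h, by simp [ht x i hi, Enc.enc], by omega⟩
    · intro i hi
      obtain ⟨t, h, h'⟩ := hf (f^[i] (init x))
      have := polynomial_eval_mono qf (hB x i hi.le)
      exact ⟨t, by simpa only [Function.iterate_succ_apply'] using h, by omega⟩
    · obtain ⟨t, h, h'⟩ := hb (f^[n x] (init x))
      have := polynomial_eval_mono qb (hB x (n x) le_rfl)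
      exact ⟨t, by simpa [hs x, Enc.enc] using h, by omega⟩
  refine ⟨_, .seq h₀ h, ?_⟩
  simp only [Polynomial.eval_add, Polynomial.eval_one, Polynomial.eval_mul, Polynomial.eval_ofNat,
    Polynomial.eval_comp]
  have := Nat.mul_le_mul_left (2 * (qb.eval (B.eval (esize x)) + qf.eval (B.eval (esize x))) + 1)
    (Nat.add_le_add_right (hn x) 1)
  omega

/-- `isPair` separates cons cells from the empty list, and the encoding of `a :: l` is that of the
pair `(a, l)`, so `h` can be applied without any conversion. -/
theorem list_cases {f : γ → List α} {g : γ → β} {h : γ × (α × List α) → β} (hf : PT f) (hg : PT g)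
    (hh : PT h) : PT fun x => match f x with
      | [] => g x
      | a :: l => h (x, (a, l)) := by
  obtain ⟨pf, qf, hf⟩ := hf
  obtain ⟨pg, qg, hg⟩ := hg
  obtain ⟨ph, qh, hh⟩ := hh
  refine ⟨.ite (.seq pf (.op .isPair)) (.seq (.fork (.op .id) pf) ph) pg,
    2 * qf + qg + qh.comp (.X + qf + 1) + 20 + 2 * .X + qf, fun x => ?_⟩
  obtain ⟨tf, hf, hf'⟩ := hf x
  obtain ⟨tg, hg, hg'⟩ := hg x
  simp only [Polynomial.eval_add, Polynomial.eval_one, Polynomial.eval_mul, Polynomial.eval_ofNat,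
    Polynomial.eval_comp, Polynomial.eval_X]
  have hsz := hf.size_le.2
  cases hl : f x with
  | nil =>
    rw [hl] at hf hsz
    refine ⟨_, .ite_false (.seq hf (.op .isPair _)) hg, ?_⟩
    simp only [Enc.enc, List.map_nil, Val.ofList, Op.eval, Val.isPair, Val.size]
    simp
    omega
  | cons a l =>
    rw [hl] at hf hsz
    obtain ⟨th, hh, hh'⟩ := hh (x, (a, l))
    refine ⟨_, .ite_true (.seq hf (.op .isPair _)) (by simp [Enc.enc, Val.ofList, Op.eval,
      Val.isPair]) (.seq (.fork (.op .id _) hf) hh), ?_⟩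
    have h1 : (Op.isPair.eval (enc (a :: l))).size = 2 := by
      simp [Enc.enc, Val.ofList, Op.eval, Val.isPair, Val.size]
    have h2 : (Op.id.eval (enc x)).size = esize x := rfl
    have h3 : esize (x, (a, l)) ≤ esize x + qf.eval (esize x) + 1 := by
      have : esize (x, (a, l)) = esize x + (enc (a :: l)).size + 1 := rfl
      omega
    have h4 := polynomial_eval_mono qh h3
    have h5 : (enc x).size = esize x := rfl
    rw [h1, h2, h5]
    omega

/-- The loop state consists of the parameter, the accumulator and the remaining list. The bound `B`
on all partial results is essential: iterating a polynomial time step can increase the size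
exponentially. -/
theorem foldl {l : γ → List α} {init : γ → σ} {step : γ → σ → α → σ} (hl : PT l) (hi : PT init)
    (hs : PT fun p : γ × σ × α => step p.1 p.2.1 p.2.2) (B : Polynomial ℕ)
    (hB : ∀ x l₁ l₂, l x = l₁ ++ l₂ →
      esize (l₁.foldl (step x) (init x)) ≤ B.eval (esize x)) :
    PT fun x => (l x).foldl (step x) (init x) := by
  let F : γ × σ × List α → γ × σ × List α := fun p => match p.2.2 with
    | [] => p
    | a :: l => (p.1, step p.1 p.2.1 a, l)
  have hF : PT F := by
    refine list_cases (snd (snd id')) id' (h := fun q : (γ × σ × List α) × (α × List α) =>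
      (q.1.1, step q.1.1 q.1.2.1 q.2.1, q.2.2)) ?_
    exact pair (fst (fst id')) (pair (comp hs (pair (fst (fst id')) (pair (fst (snd (fst id')))
      (fst (snd id'))))) (snd (snd id')))
  let b : γ × σ × List α → Bool := fun p => match p.2.2 with
    | [] => false
    | _ :: _ => true
  have hb : PT b := list_cases (snd (snd id')) (bool false) (bool true)
  have hF' : ∀ x (l₁ l₂ : List α) (s : σ),
      F^[l₁.length] (x, s, l₁ ++ l₂) = (x, l₁.foldl (step x) s, l₂) := by
    intro x l₁
    induction l₁ with
    | nil => intro l₂ s; rfl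
    | cons a l₁ ih =>
      intro l₂ s
      rw [List.length_cons, Function.iterate_succ_apply]
      exact ih l₂ _
  have hF'' : ∀ x, ∀ i ≤ (l x).length, F^[i] (x, init x, l x) =
      (x, ((l x).take i).foldl (step x) (init x), (l x).drop i) := by
    intro x i hi
    have := hF' x ((l x).take i) ((l x).drop i) (init x)
    rwa [List.take_append_drop, List.length_take_of_le hi] at this
  obtain ⟨q, hq⟩ := hl.size_bound
  have := while_loop (pair id' (pair hi hl)) hb hF (fun x => (l x).length) q (B + q + .X + 2)
    (fun x => (length_lt_esize _).le.trans (hq x)) ?_ ?_ ?_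
  · refine (funext fun x => ?_ : _ = fun x => (l x).foldl (step x) (init x)) ▸ fst (snd this)
    rw [hF'' x _ le_rfl]
    simp
  · intro x i hi
    rw [hF'' x i hi, esize_pair, esize_pair]
    have h1 := hB x _ _ (List.take_append_drop i (l x)).symm
    have h2 := hq x
    have h3 := esize_append ((l x).take i) ((l x).drop i)
    have h4 := one_le_esize ((l x).take i)
    rw [List.take_append_drop] at h3
    simp only [Polynomial.eval_add, Polynomial.eval_X, Polynomial.eval_ofNat]
    omega
  · intro x i hi
    rw [hF'' x i hi.le]
    simp only [b]
    rw [List.drop_eq_getElem_cons hi]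
  · intro x
    rw [hF'' x _ le_rfl]
    simp only [b, List.drop_length]

@[fun_prop]
theorem reverse {l : γ → List α} (hl : PT l) : PT fun x => (l x).reverse := by
  obtain ⟨q, hq⟩ := hl.size_bound
  have := foldl (step := fun _ s a => a :: s) hl nil (cons (snd (snd id')) (fst (snd id'))) q ?_
  · simpa using this
  · intro x l₁ l₂ h
    have := hq x
    rw [h] at this
    have := esize_foldl_append_le l₁ l₂
    simp only [List.foldl_flip_cons_eq_append', List.append_nil, esize_reverse]
    omega

@[fun_prop]
theorem map {l : γ → List α} {f : γ → α → β} (hl : PT l) (hf : PT fun p : γ × α => f p.1 p.2) :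
    PT fun x => (l x).map (f x) := by
  obtain ⟨q, hq⟩ := hl.size_bound
  obtain ⟨q', hq'⟩ := hf.size_bound
  have := foldl (step := fun x s a => f x a :: s) hl nil
    (cons (comp hf (pair (fst id') (snd (snd id')))) (fst (snd id')))
    (q * (q'.comp (.X + q + 1) + 1) + 1) ?_
  · have := reverse this
    have h : ∀ x, ((l x).foldl (fun s a => f x a :: s) []).reverse = (l x).map (f x) := by
      intro x
      rw [← List.foldl_map (f := f x) (g := fun s a => a :: s)]
      simp
    simpa only [h] using this
  · intro x l₁ l₂ h
    have h1 := hq x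
    have h3 := esize_foldl_append_le l₁ l₂
    rw [← h] at h3
    rw [← List.foldl_map (f := f x) (g := fun s a => a :: s)]
    simp only [List.foldl_flip_cons_eq_append', List.append_nil, esize_reverse]
    have h4 : ∀ b ∈ l₁.map (f x), esize b ≤ q'.eval (esize x + q.eval (esize x) + 1) := by
      intro b hb
      obtain ⟨a, ha, rfl⟩ := List.mem_map.1 hb
      refine (hq' (x, a)).trans (polynomial_eval_mono _ ?_)
      have := esize_le_of_mem ha
      rw [esize_pair]
      omega
    refine (esize_list_le h4).trans ?_
    simp only [Polynomial.eval_add, Polynomial.eval_X, Polynomial.eval_one, Polynomial.eval_mul,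
      Polynomial.eval_comp, List.length_map]
    have := length_lt_esize l₁
    exact Nat.add_le_add_right (Nat.mul_le_mul_right _ (by omega)) 1

@[fun_prop]
theorem append {f g : γ → List α} (hf : PT f) (hg : PT g) : PT fun x => f x ++ g x := by
  obtain ⟨q, hq⟩ := hf.size_bound
  obtain ⟨q', hq'⟩ := hg.size_bound
  have := foldl (step := fun _ s a => a :: s) (reverse hf) hg
    (cons (snd (snd id')) (fst (snd id'))) (q + q') ?_
  · simpa using this
  · intro x l₁ l₂ h
    have h1 := hq x
    have h2 := hq' x
    rw [← esize_reverse, h] at h1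
    have h3 := esize_foldl_append_le l₁ l₂
    have h4 := esize_append l₁.reverse (g x)
    simp only [List.foldl_flip_cons_eq_append', Polynomial.eval_add]
    rw [esize_reverse] at h4
    omega

@[fun_prop]
theorem flatten {f : γ → List (List α)} (hf : PT f) : PT fun x => (f x).flatten := by
  obtain ⟨q, hq⟩ := hf.size_bound
  have := foldl (step := fun _ s a => a ++ s) (reverse hf) nil
    (append (snd (snd id')) (fst (snd id'))) q ?_
  · refine (funext fun x => ?_ : _ = fun x => (f x).flatten) ▸ this
    simp only [List.foldl_reverse]
    induction f x with
    | nil => rfl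
    | cons a l ih => rw [List.foldr_cons, ih, List.flatten_cons]
  · intro x l₁ l₂ h
    have h1 := hq x
    rw [← esize_reverse, h] at h1
    have h3 := esize_foldl_append_le l₁ l₂
    refine le_trans ?_ (h3.trans h1)
    clear h h1 h3 hq
    induction l₁ using List.reverseRecOn with
    | nil => simp [esize_nil]
    | append_singleton l a ih =>
      rw [List.foldl_append, List.foldl_cons, List.foldl_nil]
      have h4 := esize_append a (l.foldl (fun s a => a ++ s) [])
      have h5 := esize_append l [a]
      rw [esize_cons, esize_nil] at h5
      omega

@[fun_prop]
theorem flatMap {l : γ → List α} {f : γ → α → List β} (hl : PT l)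
    (hf : PT fun p : γ × α => f p.1 p.2) : PT fun x => (l x).flatMap (f x) := by
  simpa only [List.flatMap_def] using flatten (map hl hf)

@[fun_prop]
theorem filter {l : γ → List α} {P : γ → α → Prop} [∀ x a, Decidable (P x a)] (hl : PT l)
    (hP : PT fun p : γ × α => decide (P p.1 p.2)) : PT fun x => (l x).filter fun a => P x a := by
  have := flatMap (f := fun x a => if P x a then [a] else []) hl
    (ite hP (cons (snd id') nil) nil)
  refine (funext fun x => ?_ : _ = fun x => (l x).filter fun a => P x a) ▸ this
  induction l x with
  | nil => rfl
  | cons a l ih =>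
    rw [List.flatMap_cons, ih]
    by_cases h : P x a <;> simp [h]

@[fun_prop]
theorem decide_exists {l : γ → List α} {P : γ → α → Prop} [∀ x a, Decidable (P x a)] (hl : PT l)
    (hP : PT fun p : γ × α => decide (P p.1 p.2)) : PT fun x => decide (∃ a ∈ l x, P x a) := by
  have := list_cases (filter hl hP) (bool (γ := γ) false)
    (bool (γ := γ × (α × List α)) true)
  refine (funext fun x => ?_ : _ = fun x => decide (∃ a ∈ l x, P x a)) ▸ this
  cases h : (l x).filter fun a => P x a with
  | nil =>
    simp only [List.filter_eq_nil_iff, decide_eq_true_eq] at h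
    simpa using h
  | cons a t =>
    have : a ∈ (l x).filter fun a => P x a := by simp [h]
    simp only [List.mem_filter, decide_eq_true_eq] at this
    simpa using ⟨a, this⟩

@[fun_prop]
theorem decide_forall {l : γ → List α} {P : γ → α → Prop} [∀ x a, Decidable (P x a)] (hl : PT l)
    (hP : PT fun p : γ × α => decide (P p.1 p.2)) : PT fun x => decide (∀ a ∈ l x, P x a) := by
  have := decide_not (decide_exists (P := fun x a => ¬ P x a) hl (decide_not hP))
  refine (funext fun x => ?_ : _ = fun x => decide (∀ a ∈ l x, P x a)) ▸ this
  simp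

@[fun_prop]
theorem decide_mem {l : γ → List ℤ} {f : γ → ℤ} (hl : PT l) (hf : PT f) :
    PT fun x => decide (f x ∈ l x) := by
  have : PT fun x => decide (∃ a ∈ l x, a = f x) := by fun_prop
  simpa using this

-- Adding a term lengthens a partial sum by at most the bit length of the term plus one, which is
-- paid for by the list cell of the term.
@[fun_prop]
theorem sum {l : γ → List ℤ} (hl : PT l) : PT fun x => (l x).sum := by
  obtain ⟨q, hq⟩ := hl.size_bound
  have := foldl (step := fun _ s a => s + a) hl (int 0) (add (fst (snd id')) (snd (snd id')))
    (q + 1) ?_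
  · simpa only [List.sum_eq_foldl] using this
  · intro x l₁ l₂ h
    have h1 := hq x
    rw [h] at h1
    have h3 := esize_foldl_append_le l₁ l₂
    refine le_trans ?_ (h3.trans (h1.trans (by simp)))
    clear h h1 h3 hq
    induction l₁ using List.reverseRecOn with
    | nil => simp [esize_nil, esize_int]
    | append_singleton l a ih =>
      rw [List.foldl_append, List.foldl_cons, List.foldl_nil]
      have h4 := size_natAbs_add_le (l.foldl (fun s a => s + a) 0) a
      have h5 := esize_append l [a]
      rw [esize_cons, esize_nil] at h5
      rw [esize_int] at *
      omega

@[fun_prop]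
theorem prod {l : γ → List ℤ} (hl : PT l) : PT fun x => (l x).prod := by
  obtain ⟨q, hq⟩ := hl.size_bound
  have := foldl (step := fun _ s a => s * a) hl (int 1) (mul (fst (snd id')) (snd (snd id')))
    (q + 1) ?_
  · simpa only [List.prod_eq_foldl] using this
  · intro x l₁ l₂ h
    have h1 := hq x
    rw [h] at h1
    have h3 := esize_foldl_append_le l₁ l₂
    rw [Polynomial.eval_add, Polynomial.eval_one]
    refine le_trans ?_ (Nat.add_le_add_right (h3.trans h1) 1)
    clear h h1 h3 hq
    induction l₁ using List.reverseRecOn with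
    | nil => simp [esize_nil, esize_int]
    | append_singleton l a ih =>
      rw [List.foldl_append, List.foldl_cons, List.foldl_nil]
      have h4 := size_natAbs_mul_le (l.foldl (fun s a => s * a) 1) a
      have h5 := esize_append l [a]
      rw [esize_cons, esize_nil] at h5
      rw [esize_int] at *
      omega

@[fun_prop]
theorem length {l : γ → List α} (hl : PT l) : PT fun x => ((l x).length : ℤ) := by
  have := sum (map (f := fun _ _ => (1 : ℤ)) hl (int 1))
  simpa using this

end PT

/-! ### List utilities -/

/-- The entry at position `i`. -/
def nth [Inhabited α] (l : List α) (i : ℤ) : α :=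
  (l.foldl (fun s a => (s.1 + 1, if s.1 = i then a else s.2)) ((0 : ℤ), default)).2

theorem foldl_nth (l : List α) (i c : ℤ) (d : α) :
    l.foldl (fun s a => (s.1 + 1, if s.1 = i then a else s.2)) (c, d) =
      (c + l.length, if c ≤ i then l.getD (i - c).toNat d else d) := by
  induction l generalizing c d with
  | nil => simp
  | cons a l ih =>
    rw [List.foldl_cons, ih, List.length_cons]
    refine Prod.ext (by push_cast; ring) ?_
    dsimp only
    rcases lt_trichotomy c i with h | rfl | h
    · obtain ⟨k, hk⟩ : ∃ k, (i - c).toNat = k + 1 := ⟨(i - c).toNat - 1, by omega⟩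
      rw [if_pos (by omega), if_pos h.le, if_neg h.ne, hk, List.getD_cons_succ]
      congr 1
      omega
    · simp
    · rw [if_neg (by omega), if_neg (by omega), if_neg (by omega)]

theorem nth_natCast [Inhabited α] (l : List α) (i : ℕ) : nth l i = l.getD i default := by
  simp [nth, foldl_nth]

theorem esize_natCast_le (n : ℕ) : esize (n : ℤ) ≤ n + 1 := by
  rw [esize_int, Int.natAbs_natCast]
  have := Nat.size_le.2 (Nat.lt_two_pow_self (n := n))
  omega

@[fun_prop]
theorem PT.nth [Inhabited α] {l : γ → List α} {i : γ → ℤ} (hl : PT l) (hi : PT i) :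
    PT fun x => nth (l x) (i x) := by
  obtain ⟨q, hq⟩ := hl.size_bound
  unfold PCTSP.nth
  refine snd (foldl (step := fun x (s : ℤ × α) a => (s.1 + 1, if s.1 = i x then a else s.2)) hl
    (init := fun _ => ((0 : ℤ), default)) (const _) (by fun_prop) (2 * q + 2 +
      .C (esize (default : α))) ?_)
  intro x l₁ l₂ h
  have h1 := hq x
  rw [h] at h1
  have h2 := esize_foldl_append_le l₁ l₂
  rw [foldl_nth, esize_pair]
  have h3 := esize_natCast_le l₁.length
  have h4 := length_lt_esize l₁
  have h5 : ∀ k, esize (l₁.getD k default) ≤ esize l₁ + esize (default : α) := by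
    intro k
    rcases lt_or_ge k l₁.length with hk | hk
    · rw [List.getD_eq_getElem _ _ hk]
      have := esize_le_of_mem (List.getElem_mem hk)
      omega
    · rw [List.getD_eq_default _ _ hk]
      omega
  have h6 := h5 (i x - 0).toNat
  rw [zero_add]
  simp only [Polynomial.eval_add, Polynomial.eval_mul, Polynomial.eval_ofNat, Polynomial.eval_C]
  split <;> omega

/-- The positions of a list. -/
def positions (l : List α) : List ℤ := (List.range l.length).map (Nat.cast : ℕ → ℤ)

theorem foldl_positions (l : List α) :
    l.foldl (fun s _ => (s.1 + 1, s.1 :: s.2)) ((0 : ℤ), ([] : List ℤ)) =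
      ((l.length : ℤ), (positions l).reverse) := by
  induction l using List.reverseRecOn with
  | nil => rfl
  | append_singleton l a ih =>
    rw [List.foldl_append, ih]
    simp [positions, List.range_succ]

@[fun_prop]
theorem PT.positions {l : γ → List α} (hl : PT l) : PT fun x => positions (l x) := by
  obtain ⟨q, hq⟩ := hl.size_bound
  have := reverse (snd (foldl (step := fun x (s : ℤ × List ℤ) (a : α) => (s.1 + 1, s.1 :: s.2)) hl
    (init := fun _ => ((0 : ℤ), [])) (const _) (by fun_prop) (q + 2 + q * (q + 2)) ?_))
  · simpa [foldl_positions] using this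
  · intro x l₁ l₂ h
    have h1 := hq x
    rw [h] at h1
    have h2 := esize_foldl_append_le l₁ l₂
    have h3 := esize_natCast_le l₁.length
    have h4 := length_lt_esize l₁
    rw [foldl_positions, esize_pair, esize_reverse]
    have h5 : esize (PCTSP.positions l₁) ≤ l₁.length * (l₁.length + 1 + 1) + 1 := by
      refine (esize_list_le (B := l₁.length + 1) fun z hz => ?_).trans
        (by simp [PCTSP.positions])
      simp only [PCTSP.positions, List.mem_map, List.mem_range] at hz
      obtain ⟨i, hi, rfl⟩ := hz
      have := esize_natCast_le i
      omega
    have h6 : l₁.length * (l₁.length + 1 + 1) ≤ q.eval (esize x) * (q.eval (esize x) + 2) :=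
      Nat.mul_le_mul (by omega) (by omega)
    simp only [Polynomial.eval_add, Polynomial.eval_mul, Polynomial.eval_ofNat]
    omega

/-- The powers of two up to `z`, in decreasing order. -/
def powers (z : ℤ) : List ℤ := ((List.range z.toNat.size).map fun i => (2 : ℤ) ^ i).reverse

-- Halving `z` while doubling the current power ends after as many rounds as `z` has bits. The
-- powers are the step sizes of the binary search in `moveProg`.
@[fun_prop]
theorem PT.powers {z : γ → ℤ} (hz : PT z) : PT fun x => powers (z x) := by
  let F : ℤ × ℤ × List ℤ → ℤ × ℤ × List ℤ := fun s => (s.1 / 2, 2 * s.2.1, s.2.1 :: s.2.2)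
  have hF : ∀ (z : ℤ) (i : ℕ), i ≤ z.toNat.size → F^[i] (z, 1, []) = (z / 2 ^ i, 2 ^ i,
      ((List.range i).map fun j => (2 : ℤ) ^ j).reverse) := by
    intro z i hi
    induction i with
    | zero => simp
    | succ i ih =>
      rw [Function.iterate_succ_apply', ih (by omega)]
      simp only [F, List.range_succ, List.map_append, List.reverse_append]
      rw [Int.ediv_ediv_of_nonneg (by positivity), pow_succ, mul_comm (2 : ℤ)]
      rfl
  have hsz : ∀ (z : ℤ) (i : ℕ), (1 ≤ z / 2 ^ i ↔ i < z.toNat.size) := by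
    intro z i
    rw [Int.le_ediv_iff_mul_le (by positivity), one_mul, Nat.lt_size]
    have : (0 : ℤ) < 2 ^ i := by positivity
    zify
    omega
  obtain ⟨q, hq⟩ := hz.size_bound
  have := while_loop (γ := γ) (init := fun x => (z x, 1, [])) (b := fun s => decide (1 ≤ s.1)) (f := F)
    (by fun_prop) (by fun_prop) (by fun_prop) (fun x => (z x).toNat.size) q
    (q + (q + 2) + q * (q + 3) + 5) ?_ ?_ ?_ ?_
  · refine (funext fun x => ?_ : _ = fun x => PCTSP.powers (z x)) ▸ snd (snd this)
    rw [hF _ _ le_rfl]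
    rfl
  all_goals
    intro x
    have h1 := hq x
    have h2 : (z x).toNat.size ≤ (z x).natAbs.size := Nat.size_le_size (by omega)
    rw [esize_int] at h1
  · omega
  · intro i hi
    rw [hF _ i hi, esize_pair, esize_pair, esize_reverse]
    have h3 : ∀ j ≤ i, esize ((2 : ℤ) ^ j) ≤ i + 2 := by
      intro j hj
      rw [esize_int, Int.natAbs_pow]
      change (2 ^ j).size + 1 ≤ _
      rw [Nat.size_pow]
      omega
    have h4 := h3 i le_rfl
    have h5 : esize (z x / 2 ^ i) ≤ (z x).natAbs.size + 1 := by
      rw [esize_int]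
      have := size_natAbs_div_le (z x) (2 ^ i)
      omega
    have h6 : esize ((List.range i).map fun j => (2 : ℤ) ^ j) ≤ i * (i + 2 + 1) + 1 := by
      refine (esize_list_le (B := i + 2) fun w hw => ?_).trans (by simp)
      simp only [List.mem_map, List.mem_range] at hw
      obtain ⟨j, hj, rfl⟩ := hw
      exact h3 j hj.le
    have h7 : i * (i + 2 + 1) ≤ q.eval (esize x) * (q.eval (esize x) + 3) :=
      Nat.mul_le_mul (by omega) (by omega)
    simp only [Polynomial.eval_add, Polynomial.eval_mul, Polynomial.eval_ofNat]
    omega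
  · intro i hi
    rw [hF _ i hi.le]
    simpa using (hsz _ i).2 hi
  · rw [hF _ _ le_rfl]
    simpa using fun h => lt_irrefl _ ((hsz (z x) _).1 h)

end

/-! ### Pipage rounding in the spanning tree polytope -/

section Pipage

open Finset

variable {K V E Y : Type*} [CommRing K] [LinearOrder K] [IsStrictOrderedRing K] [DecidableEq V]
  [Fintype E] [DecidableEq E] [Fintype Y]

/-- The total value of the edges with both endpoints in `S`. -/
def mass (a b : E → V) (x : E → K) (S : Finset V) : K := ∑ e with a e ∈ S ∧ b e ∈ S, x e

/-- Membership in the `D`-fold dilation of the spanning tree polytope of the multigraph on `C`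
with the edges `{a e, b e}`. -/
structure InTreePolytope (C : Finset V) (a b : E → V) (D : K) (x : E → K) : Prop where
  nonneg : ∀ e, 0 ≤ x e
  total : ∑ e, x e = D * ((#C : K) - 1)
  mass_le : ∀ S ⊆ C, S.Nonempty → mass a b x S ≤ D * ((#S : K) - 1)

/-- Move `t` units from `j` to `i`. -/
def shift (x : E → K) (i j : E) (t : K) (e : E) : K :=
  x e + t * ((if e = i then 1 else 0) - (if e = j then 1 else 0))

/-- The constraint of the vertex set `S` is tight. -/
def IsTight (C : Finset V) (a b : E → V) (D : K) (x : E → K) (S : Finset V) : Prop :=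
  S ⊆ C ∧ S.Nonempty ∧ mass a b x S = D * ((#S : K) - 1)

/-- No units can be exchanged between `i` and `j` in both directions. -/
def Blocked (C : Finset V) (a b : E → V) (D : K) (x : E → K) (i j : E) : Prop :=
  x i = 0 ∨ x j = 0 ∨ ∃ S, IsTight C a b D x S ∧ ¬ ((a i ∈ S ∧ b i ∈ S) ↔ (a j ∈ S ∧ b j ∈ S))

/-- The concave objective function. -/
def objective (d : E → K) (p : Y → K) (cov : E → Y → Bool) (D : K) (x : E → K) : K :=
  ∑ e, d e * x e + ∑ v, p v * ∏ e, (if cov e v then D - x e else D)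

variable {C : Finset V} {a b : E → V} {D : K} {x : E → K} {i j : E}

theorem shift_zero (x : E → K) (i j : E) : shift x i j 0 = x := by
  ext e; simp [shift]

theorem shift_shift (x : E → K) (i j : E) (s t : K) :
    shift (shift x i j s) i j t = shift x i j (s + t) := by
  ext e; simp only [shift]; ring

theorem shift_swap (x : E → K) (i j : E) (t : K) : shift x j i t = shift x i j (-t) := by
  ext e; simp only [shift]; ring

theorem shift_left (x : E → K) (hij : i ≠ j) (t : K) : shift x i j t i = x i + t := by
  simp [shift, hij]

theorem shift_right (x : E → K) (hij : i ≠ j) (t : K) : shift x i j t j = x j - t := by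
  simp [shift, hij.symm, sub_eq_add_neg]

theorem shift_of_ne (x : E → K) {e : E} (hi : e ≠ i) (hj : e ≠ j) (t : K) :
    shift x i j t e = x e := by
  simp [shift, hi, hj]

theorem sum_shift (x : E → K) (i j : E) (t : K) : ∑ e, shift x i j t e = ∑ e, x e := by
  simp [shift, Finset.sum_add_distrib, ← Finset.mul_sum]

theorem mass_shift (x : E → K) (i j : E) (t : K) (S : Finset V) :
    mass a b (shift x i j t) S = mass a b x S +
      t * ((if a i ∈ S ∧ b i ∈ S then 1 else 0) - (if a j ∈ S ∧ b j ∈ S then 1 else 0)) := by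
  simp only [mass, shift, Finset.sum_add_distrib, ← Finset.mul_sum, Finset.sum_sub_distrib,
    Finset.sum_ite_eq', Finset.mem_filter, Finset.mem_univ, true_and]

theorem Blocked.symm (h : Blocked C a b D x i j) : Blocked C a b D x j i := by
  rcases h with h | h | ⟨S, h, h'⟩
  · exact .inr (.inl h)
  · exact .inl h
  · exact .inr (.inr ⟨S, h, fun h'' => h' h''.symm⟩)

/-- A move along an unblocked pair leaves zero coordinates alone, since `x i` and `x j` are nonzero.
It also preserves the mass of each tight set, which induces both of `i`, `j` or neither. Hence
blocked pairs accumulate and each pair has to be treated only once. -/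
theorem Blocked.shift {i' j' : E} (hij : ¬ Blocked C a b D x i j) (h : Blocked C a b D x i' j')
    (t : K) : Blocked C a b D (shift x i j t) i' j' := by
  simp only [Blocked, not_or, not_exists, not_and, not_not] at hij
  obtain ⟨hi, hj, hS⟩ := hij
  rcases h with h | h | ⟨S, h, h'⟩
  · refine .inl ?_
    rw [shift_of_ne, h] <;> rintro rfl <;> contradiction
  · refine .inr (.inl ?_)
    rw [shift_of_ne, h] <;> rintro rfl <;> contradiction
  · refine .inr (.inr ⟨S, ⟨h.1, h.2.1, ?_⟩, h'⟩)
    rw [mass_shift, h.2.2]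
    simp [hS S h]

/-- Supermodularity, edge by edge: an edge induced by one of the sets is induced by the union, and
one induced by both also by the intersection. -/
theorem mass_add_mass_le (h0 : ∀ e, 0 ≤ x e) (S T : Finset V) :
    mass a b x S + mass a b x T ≤ mass a b x (S ∩ T) + mass a b x (S ∪ T) := by
  simp only [mass, Finset.sum_filter, ← Finset.sum_add_distrib]
  refine Finset.sum_le_sum fun e _ => ?_
  have := h0 e
  by_cases h1 : a e ∈ S <;> by_cases h2 : b e ∈ S <;> by_cases h3 : a e ∈ T <;>
    by_cases h4 : b e ∈ T <;> simp [h1, h2, h3, h4, this]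

/-- Uncrossing: the right-hand sides are modular on intersecting sets and the mass is supermodular,
so the constraints of intersection and union must both hold with equality. -/
theorem InTreePolytope.isTight_inter (h : InTreePolytope C a b D x) {S T : Finset V}
    (hS : IsTight C a b D x S) (hT : IsTight C a b D x T) (hST : (S ∩ T).Nonempty) :
    IsTight C a b D x (S ∩ T) := by
  have hsub : S ∩ T ⊆ C := Finset.inter_subset_left.trans hS.1
  refine ⟨hsub, hST, le_antisymm (h.mass_le _ hsub hST) ?_⟩
  have h1 := mass_add_mass_le (a := a) (b := b) h.nonneg S T
  have h2 := h.mass_le (S ∪ T) (Finset.union_subset hS.1 hT.1)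
    (hS.2.1.mono Finset.subset_union_left)
  have h3 : (#(S ∪ T) : K) + #(S ∩ T) = #S + #T := by
    exact_mod_cast Finset.card_union_add_card_inter S T
  rw [hS.2.2, hT.2.2] at h1
  have h4 : D * ((#(S ∪ T) : K) - 1) + D * ((#(S ∩ T) : K) - 1) =
      D * ((#S : K) - 1) + D * ((#T : K) - 1) := by
    rw [← mul_add, ← mul_add]
    congr 1
    linear_combination h3
  linarith

theorem InTreePolytope.le (h : InTreePolytope C a b D x) (ha : ∀ e, a e ∈ C) (hb : ∀ e, b e ∈ C)
    (hab : ∀ e, a e ≠ b e) (e : E) : x e ≤ D := by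
  have h1 := h.mass_le {a e, b e} (by simp [Finset.insert_subset_iff, ha, hb]) (by simp)
  rw [Finset.card_pair (hab e)] at h1
  have h2 : x e ≤ mass a b x {a e, b e} := by
    refine Finset.single_le_sum (fun e _ => h.nonneg e) ?_
    simp
  push_cast at h1
  linarith

theorem InTreePolytope.isTight_self (h : InTreePolytope C a b D x) (ha : ∀ e, a e ∈ C)
    (hb : ∀ e, b e ∈ C) (hC : C.Nonempty) : IsTight C a b D x C := by
  refine ⟨subset_rfl, hC, ?_⟩
  rw [← h.total, mass, Finset.filter_true_of_mem fun e _ => ⟨ha e, hb e⟩]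

/-- If all pairs are blocked, then the point is integral. -/
theorem InTreePolytope.integral (h : InTreePolytope C a b D x) (ha : ∀ e, a e ∈ C)
    (hb : ∀ e, b e ∈ C) (hab : ∀ e, a e ≠ b e)
    (hbl : ∀ i j, i ≠ j → Blocked C a b D x i j) (e : E) : x e = 0 ∨ x e = D := by
  classical
  by_contra hne
  -- The tight sets inducing a fractional edge; a smallest one will be uncrossed to a smaller one.
  let F : Finset (Finset V) := C.powerset.filter fun S => IsTight C a b D x S ∧
    ∃ e, (a e ∈ S ∧ b e ∈ S) ∧ ¬ (x e = 0 ∨ x e = D)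
  have hF : F.Nonempty := ⟨C, by
    simp only [F, Finset.mem_filter, Finset.mem_powerset]
    exact ⟨subset_rfl, h.isTight_self ha hb ⟨_, ha e⟩, e, ⟨ha e, hb e⟩, hne⟩⟩
  obtain ⟨S, hSF, hmin⟩ := Finset.exists_min_image F Finset.card hF
  simp only [F, Finset.mem_filter, Finset.mem_powerset] at hSF hmin
  obtain ⟨hSC, hS, i, hi, hix⟩ := hSF
  -- A second fractional edge exists: otherwise all other induced edges have value 0 or `D`, and
  -- tightness makes `x i` an integer multiple of `D` strictly between 0 and `D`.
  have hj : ∃ j, j ≠ i ∧ (a j ∈ S ∧ b j ∈ S) ∧ ¬ (x j = 0 ∨ x j = D) := by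
    by_contra hcon
    push Not at hcon
    have h1 := hS.2.2
    have hi' : i ∈ (Finset.univ : Finset E).filter fun e => a e ∈ S ∧ b e ∈ S := by simpa using hi
    rw [mass, ← Finset.add_sum_erase _ _ hi'] at h1
    have h2 : ∑ e ∈ ((Finset.univ : Finset E).filter fun e => a e ∈ S ∧ b e ∈ S).erase i, x e =
        D * (((((Finset.univ : Finset E).filter fun e => a e ∈ S ∧ b e ∈ S).erase i).filter
          fun e => x e ≠ 0).card : K) := by
      rw [← Finset.sum_filter_ne_zero, Finset.sum_congr rfl (g := fun _ => D)]
      · rw [Finset.sum_const, nsmul_eq_mul, mul_comm]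
      · intro e he
        simp only [Finset.mem_filter, Finset.mem_erase, Finset.mem_univ, true_and] at he
        exact (hcon e he.1.1 he.1.2).resolve_left he.2
    rw [h2] at h1
    set c := ((((Finset.univ : Finset E).filter fun e => a e ∈ S ∧ b e ∈ S).erase i).filter
          fun e => x e ≠ 0).card
    have h3 : x i = D * (((#S : ℤ) - 1 - c : ℤ) : K) := by
      push_cast
      linear_combination h1
    have h4 : 0 < x i := lt_of_le_of_ne (h.nonneg i) fun h0 => hix (.inl h0.symm)
    have h5 : x i < D := lt_of_le_of_ne (h.le ha hb hab i) fun h0 => hix (.inr h0)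
    have hD : 0 < D := h4.trans h5
    rw [h3] at h4 h5
    have h6 := pos_of_mul_pos_right h4 hD.le
    have h7 : (((#S : ℤ) - 1 - c : ℤ) : K) < 1 := by
      by_contra hc
      have := le_mul_of_one_le_right hD.le (not_lt.1 hc)
      linarith
    have h6' : (0 : ℤ) < (#S : ℤ) - 1 - c := by exact_mod_cast h6
    have h7' : (#S : ℤ) - 1 - c < 1 := by exact_mod_cast h7
    omega
  obtain ⟨j, hji, hjS, hjx⟩ := hj
  have hblock := hbl i j hji.symm
  push Not at hix hjx
  obtain ⟨T, hT, hTij⟩ := (hblock.resolve_left hix.1).resolve_left hjx.1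
  -- The tight set `T` induces exactly one of the two fractional edges, so `S ∩ T` is a tight set
  -- that still induces a fractional edge. By minimality it equals `S`, although `T` does not induce
  -- the other edge.
  have key : ∀ k l : E, (a k ∈ S ∧ b k ∈ S) → (a l ∈ S ∧ b l ∈ S) → (a k ∈ T ∧ b k ∈ T) →
      ¬ (a l ∈ T ∧ b l ∈ T) → ¬ (x k = 0 ∨ x k = D) → False := by
    intro k l hk hl hkT hlT hx
    have hne : (S ∩ T).Nonempty := ⟨a k, by simp [hk, hkT]⟩
    have ht := h.isTight_inter hS hT hne
    have h1 := hmin (S ∩ T) ⟨ht.1, ht, k, by simp [hk, hkT], hx⟩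
    have h2 : S ∩ T = S := Finset.eq_of_subset_of_card_le Finset.inter_subset_left h1
    rw [Finset.inter_eq_left] at h2
    exact hlT ⟨h2 hl.1, h2 hl.2⟩
  by_cases hiT : a i ∈ T ∧ b i ∈ T
  · exact key i j hi hjS hiT (fun hjT => hTij (iff_of_true hiT hjT)) (by tauto)
  · refine key j i hjS hi ?_ hiT (by tauto)
    by_contra hjT
    exact hTij (iff_of_false hiT hjT)

/-- The support of a point of the spanning tree polytope is connected. -/
theorem InTreePolytope.exists_crossing (h : InTreePolytope C a b D x) (hD : 0 < D)
    (ha : ∀ e, a e ∈ C) (hb : ∀ e, b e ∈ C) {S : Finset V} (hSC : S ⊆ C) (hS : S.Nonempty)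
    (hne : S ≠ C) : ∃ e, x e ≠ 0 ∧ ¬ (a e ∈ S ↔ b e ∈ S) := by
  by_contra hcon
  push Not at hcon
  have hT : (C \ S).Nonempty := by
    rw [Finset.sdiff_nonempty]
    exact fun h' => hne (hSC.antisymm h')
  -- Without a crossing edge the total is at most `D * (#C - 2)`, by the constraints of `S` and of
  -- its complement, which is too small.
  have h1 := h.mass_le S hSC hS
  have h2 := h.mass_le (C \ S) Finset.sdiff_subset hT
  have h3 : mass a b x S + mass a b x (C \ S) = ∑ e, x e := by
    simp only [mass, Finset.sum_filter, ← Finset.sum_add_distrib]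
    refine Finset.sum_congr rfl fun e _ => ?_
    by_cases h0 : x e = 0
    · simp [h0]
    · have := hcon e h0
      by_cases h4 : a e ∈ S <;> simp_all
  have h4 : (#(C \ S) : K) + #S = #C := by
    exact_mod_cast Finset.card_sdiff_add_card_eq_card hSC
  rw [h.total, ← h4] at h3
  have : D * ((#S : K) - 1) + D * ((#(C \ S) : K) - 1) + D = D * ((#(C \ S) : K) + #S - 1) := by
    ring
  linarith

/-- Along an exchange direction, the objective function is a concave quadratic polynomial. -/
theorem objective_shift (d : E → K) {p : Y → K} (hp : ∀ v, 0 ≤ p v) (cov : E → Y → Bool)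
    (hD : 0 ≤ D) (hx : ∀ e, x e ≤ D) (hij : i ≠ j) :
    ∃ β γ : K, γ ≤ 0 ∧ ∀ t, objective d p cov D (shift x i j t) =
      objective d p cov D x + β * t + γ * t ^ 2 := by
  have h1 : ∀ v, ∃ β γ : K, γ ≤ 0 ∧ ∀ t,
      p v * ∏ e, (if cov e v then D - shift x i j t e else D) =
        p v * ∏ e, (if cov e v then D - x e else D) + β * t + γ * t ^ 2 := by
    intro v
    set R := ∏ e ∈ (univ.erase i).erase j, (if cov e v then D - x e else D) with hR
    have hR0 : 0 ≤ R := by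
      refine Finset.prod_nonneg fun e _ => ?_
      split
      · exact sub_nonneg.2 (hx e)
      · exact hD
    have hsplit : ∀ f : E → K, ∏ e, f e = f i * (f j * ∏ e ∈ (univ.erase i).erase j, f e) := by
      intro f
      rw [Finset.mul_prod_erase _ _ (by simp [hij.symm]), Finset.mul_prod_erase _ _ (by simp)]
    have hRt : ∀ t, ∏ e ∈ (univ.erase i).erase j, (if cov e v then D - shift x i j t e else D)
        = R := by
      intro t
      refine Finset.prod_congr rfl fun e he => ?_
      simp only [Finset.mem_erase] at he
      rw [shift_of_ne x he.2.1 he.1]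
    let u : K := if cov i v then 1 else 0
    let w : K := if cov j v then 1 else 0
    have hu : 0 ≤ u := by simp only [u]; split <;> simp
    have hw : 0 ≤ w := by simp only [w]; split <;> simp
    -- Only two factors depend on `t`. The coefficients are those of `(A - u * t) * (B + w * t) *
    -- R`, where `A`, `B` are the factors of `i`, `j` at `t = 0`; the quadratic one is nonpositive
    -- because `i` and `j` move in opposite directions.
    refine ⟨p v * ((if cov i v then D - x i else D) * w - u * (if cov j v then D - x j else D)) * R,
      -(p v * (u * w * R)), ?_, fun t => ?_⟩
    · have := mul_nonneg (hp v) (mul_nonneg (mul_nonneg hu hw) hR0)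
      linarith
    · rw [hsplit, hsplit (fun e => if cov e v then D - x e else D), hRt, shift_left x hij,
        shift_right x hij, ← hR]
      simp only [u, w]
      cases cov i v <;> cases cov j v <;> simp <;> ring
  choose β γ hγ h1 using h1
  refine ⟨d i - d j + ∑ v, β v, ∑ v, γ v, Finset.sum_nonpos fun v _ => hγ v, fun t => ?_⟩
  simp only [objective, h1, Finset.sum_add_distrib, ← Finset.sum_mul]
  have h2 : ∑ e, d e * shift x i j t e = ∑ e, d e * x e + t * (d i - d j) := by
    simp only [shift, mul_add, Finset.sum_add_distrib, mul_sub, Finset.sum_sub_distrib]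
    simp
    ring
  rw [h2]
  ring

/-- If one of two opposite moves is not worse than the other one, then no move in this direction
increases the objective function. -/
theorem objective_shift_le (d : E → K) {p : Y → K} (hp : ∀ v, 0 ≤ p v) (cov : E → Y → Bool)
    (hD : 0 ≤ D) (hx : ∀ e, x e ≤ D) (hij : i ≠ j)
    (h : objective d p cov D (shift x i j 1) ≤ objective d p cov D (shift x i j (-1))) {t : K}
    (ht : 0 ≤ t) : objective d p cov D (shift x i j t) ≤ objective d p cov D x := by
  obtain ⟨β, γ, hγ, h'⟩ := objective_shift d hp cov hD hx hij
  rw [h', h'] at h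
  -- The quadratic terms at 1 and -1 cancel, so the comparison reveals the sign of the slope. The
  -- two points need not be feasible for this.
  have hβ : β ≤ 0 := by linarith
  rw [h']
  have := mul_nonpos_of_nonpos_of_nonneg hβ ht
  have := mul_nonpos_of_nonpos_of_nonneg hγ (sq_nonneg t)
  linarith

/-- Two opposite unit moves show that a pair is not blocked. -/
theorem not_blocked (hij : i ≠ j) (h : InTreePolytope C a b D (shift x i j 1))
    (h' : InTreePolytope C a b D (shift x i j (-1))) : ¬ Blocked C a b D x i j := by
  rintro (h0 | h0 | ⟨S, hS, hS'⟩)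
  · have := h'.nonneg i
    rw [shift_left x hij, h0] at this
    linarith
  · have := h.nonneg j
    rw [shift_right x hij, h0] at this
    linarith
  · have h1 := h.mass_le S hS.1 hS.2.1
    have h2 := h'.mass_le S hS.1 hS.2.1
    rw [mass_shift, hS.2.2] at h1 h2
    by_cases h3 : a i ∈ S ∧ b i ∈ S <;> by_cases h4 : a j ∈ S ∧ b j ∈ S
    · exact hS' (iff_of_true h3 h4)
    · rw [if_pos h3, if_neg h4] at h1 h2; linarith
    · rw [if_neg h3, if_pos h4] at h1 h2; linarith
    · exact hS' (iff_of_false h3 h4)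

end Pipage

/-! ### Unit moves for integral data. -/

section PipageInt

open Finset

variable {V E : Type*} [DecidableEq V] [Fintype E] [DecidableEq E]
  {C : Finset V} {a b : E → V} {D : ℤ} {x : E → ℤ} {i j : E}

/-- For integral data a constraint that is not tight has slack at least one, and a unit move changes
each side by at most one. Therefore an infeasible unit move is due to a zero coordinate or a tight
set. -/
theorem blocked_of_shift_one (hij : i ≠ j) (h : InTreePolytope C a b D x)
    (h' : ¬ InTreePolytope C a b D (shift x i j 1)) : Blocked C a b D x i j := by
  by_contra hbl
  simp only [Blocked, not_or, not_exists, not_and, not_not] at hbl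
  obtain ⟨-, hj, hS⟩ := hbl
  refine h' ⟨fun e => ?_, by rw [sum_shift, h.total], fun S hSC hS0 => ?_⟩
  · have h0 := h.nonneg e
    by_cases he : e = j
    · subst he
      rw [shift_right x hij]
      omega
    · simp only [shift, he, if_false]
      split <;> omega
  · rw [mass_shift]
    have h1 := h.mass_le S hSC hS0
    by_cases ht : mass a b x S = D * ((#S : ℤ) - 1)
    · have := hS S ⟨hSC, hS0, ht⟩
      simp [this, ht]
    · have : mass a b x S < D * ((#S : ℤ) - 1) := lt_of_le_of_ne h1 ht
      split <;> split <;> omega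

theorem blocked_of_shift (hij : i ≠ j) (h : InTreePolytope C a b D x) {s : ℤ}
    (hs : s = 1 ∨ s = -1) (h' : ¬ InTreePolytope C a b D (shift x i j s)) :
    Blocked C a b D x i j := by
  rcases hs with rfl | rfl
  · exact blocked_of_shift_one hij h h'
  · rw [← shift_swap] at h'
    exact (blocked_of_shift_one hij.symm h h').symm

end PipageInt

/-! ### Existence of the rounding for real data. -/

section PipageReal

open Finset

variable {V E Y : Type*} [DecidableEq V] [Fintype V] [Fintype E] [DecidableEq E] [Fintype Y]
  {C : Finset V} {a b : E → V} {D : ℝ} {x : E → ℝ} {i j : E}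

/-- Tight constraints are unaffected by the move, and the finitely many others survive a small move
by continuity. -/
theorem exists_pos_shift (hij : i ≠ j) (h : InTreePolytope C a b D x)
    (hbl : ¬ Blocked C a b D x i j) : ∃ t > 0, InTreePolytope C a b D (shift x i j t) := by
  simp only [Blocked, not_or, not_exists, not_and, not_not] at hbl
  obtain ⟨-, hj, hS⟩ := hbl
  have hxj : 0 < x j := lt_of_le_of_ne (h.nonneg j) (Ne.symm hj)
  have h1 : ∀ᶠ t in nhdsWithin (0 : ℝ) (Set.Ioi 0), t < x j :=
    nhdsWithin_le_nhds (eventually_lt_nhds hxj)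
  have h2 : ∀ S : Finset V, ∀ᶠ t in nhdsWithin (0 : ℝ) (Set.Ioi 0), S ⊆ C → S.Nonempty →
      mass a b (shift x i j t) S ≤ D * ((#S : ℝ) - 1) := by
    intro S
    simp only [mass_shift]
    by_cases hSC : S ⊆ C ∧ S.Nonempty
    · by_cases ht : mass a b x S = D * ((#S : ℝ) - 1)
      · have := hS S ⟨hSC.1, hSC.2, ht⟩
        simp [this, ht]
      · have hlt : mass a b x S < D * ((#S : ℝ) - 1) :=
          lt_of_le_of_ne (h.mass_le S hSC.1 hSC.2) ht
        set c : ℝ := (if a i ∈ S ∧ b i ∈ S then 1 else 0) - (if a j ∈ S ∧ b j ∈ S then 1 else 0)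
        have hc : Filter.Tendsto (fun t => mass a b x S + t * c) (nhds 0)
            (nhds (mass a b x S + 0 * c)) := by
          refine Continuous.tendsto ?_ 0
          fun_prop
        rw [zero_mul, add_zero] at hc
        filter_upwards [nhdsWithin_le_nhds (hc.eventually_lt_const hlt)] with t ht _ _ using ht.le
    · exact Filter.Eventually.of_forall fun t h1 h2 => absurd ⟨h1, h2⟩ hSC
  have h3 : ∀ᶠ t in nhdsWithin (0 : ℝ) (Set.Ioi 0), 0 < t := eventually_mem_nhdsWithin
  obtain ⟨t, ht1, ht2, ht3⟩ := (h1.and ((Filter.eventually_all.2 h2).and h3)).exists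
  refine ⟨t, ht3, fun e => ?_, by rw [sum_shift, h.total], ht2⟩
  by_cases he : e = j
  · subst he
    rw [shift_right x hij]
    linarith
  · have h0 := h.nonneg e
    simp only [shift, he, if_false]
    split <;> linarith

/-- The feasible step lengths form a compact set. At its maximum the pair is blocked, since
otherwise `exists_pos_shift` would extend the move. -/
theorem exists_blocked_shift (hij : i ≠ j) (h : InTreePolytope C a b D x) :
    ∃ t ≥ 0, InTreePolytope C a b D (shift x i j t) ∧ Blocked C a b D (shift x i j t) i j := by
  have hcont : ∀ e, Continuous fun t => shift x i j t e := fun e => by unfold shift; fun_prop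
  let A : Set ℝ := {t | 0 ≤ t ∧ InTreePolytope C a b D (shift x i j t)}
  have hA : A = Set.Ici 0 ∩ ((⋂ e, {t | 0 ≤ shift x i j t e}) ∩
      ⋂ S : Finset V, {t | S ⊆ C → S.Nonempty →
        mass a b (shift x i j t) S ≤ D * ((#S : ℝ) - 1)}) := by
    ext t
    simp only [A, Set.mem_ofPred_eq, Set.mem_inter_iff, Set.mem_Ici, Set.mem_iInter]
    exact and_congr_right fun _ => ⟨fun h => ⟨h.nonneg, h.mass_le⟩,
      fun h' => ⟨h'.1, by rw [sum_shift, h.total], h'.2⟩⟩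
  have hclosed : IsClosed A := by
    rw [hA]
    refine isClosed_Ici.inter ((isClosed_iInter fun e => isClosed_le continuous_const (hcont e)).inter
      (isClosed_iInter fun S => ?_))
    by_cases hSC : S ⊆ C ∧ S.Nonempty
    · simp only [hSC.1, hSC.2, true_imp_iff]
      exact isClosed_le (continuous_finsetSum _ fun e _ => hcont e) continuous_const
    · have : {t | S ⊆ C → S.Nonempty → mass a b (shift x i j t) S ≤ D * ((#S : ℝ) - 1)} =
          Set.univ := by
        ext t
        simp only [Set.mem_ofPred_eq, Set.mem_univ, iff_true]
        exact fun h1 h2 => absurd ⟨h1, h2⟩ hSC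
      rw [this]
      exact isClosed_univ
  have hbdd : A ⊆ Set.Icc 0 (x j) := by
    intro t ht
    refine ⟨ht.1, ?_⟩
    have := ht.2.nonneg j
    rw [shift_right x hij] at this
    linarith
  have hcomp : IsCompact A := isCompact_Icc.of_isClosed_subset hclosed hbdd
  obtain ⟨t, ht, hmax⟩ := hcomp.exists_isGreatest ⟨0, le_rfl, by rwa [shift_zero]⟩
  refine ⟨t, ht.1, ht.2, ?_⟩
  by_contra hbl
  obtain ⟨s, hs, hs'⟩ := exists_pos_shift hij ht.2 hbl
  rw [shift_shift] at hs'
  have := hmax (a := t + s) ⟨add_nonneg ht.1 hs.le, hs'⟩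
  linarith

theorem exists_pipage_step (d : E → ℝ) {p : Y → ℝ} (hp : ∀ v, 0 ≤ p v) (cov : E → Y → Bool)
    (hD : 0 ≤ D) (hx : ∀ e, x e ≤ D) (hij : i ≠ j) (h : InTreePolytope C a b D x) :
    ∃ x', InTreePolytope C a b D x' ∧ objective d p cov D x' ≤ objective d p cov D x ∧
      Blocked C a b D x' i j ∧
      ∀ i' j', Blocked C a b D x i' j' → Blocked C a b D x' i' j' := by
  by_cases hbl : Blocked C a b D x i j
  · exact ⟨x, h, le_rfl, hbl, fun _ _ h => h⟩
  · rcases le_total (objective d p cov D (shift x i j 1))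
      (objective d p cov D (shift x i j (-1))) with hle | hle
    · obtain ⟨t, ht, h1, h2⟩ := exists_blocked_shift hij h
      exact ⟨_, h1, objective_shift_le d hp cov hD hx hij hle ht, h2,
        fun i' j' h' => h'.shift hbl t⟩
    -- If the opposite direction is better, the same argument applies with `i` and `j` interchanged.
    · rw [← shift_swap x i j 1, ← neg_neg (1 : ℝ), ← shift_swap x i j (-1), neg_neg] at hle
      obtain ⟨t, ht, h1, h2⟩ := exists_blocked_shift hij.symm h
      exact ⟨_, h1, objective_shift_le d hp cov hD hx hij.symm hle ht, h2.symm,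
        fun i' j' h' => h'.shift (fun h'' => hbl h''.symm) t⟩

/-- Pipage rounding. -/
theorem InTreePolytope.exists_integral (d : E → ℝ) {p : Y → ℝ} (hp : ∀ v, 0 ≤ p v)
    (cov : E → Y → Bool) (hD : 0 ≤ D) (ha : ∀ e, a e ∈ C) (hb : ∀ e, b e ∈ C)
    (hab : ∀ e, a e ≠ b e) (h : InTreePolytope C a b D x) :
    ∃ x', InTreePolytope C a b D x' ∧ objective d p cov D x' ≤ objective d p cov D x ∧
      ∀ e, x' e = 0 ∨ x' e = D := by
  have key : ∀ l : List (E × E), ∃ x', InTreePolytope C a b D x' ∧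
      objective d p cov D x' ≤ objective d p cov D x ∧
      ∀ q ∈ l, q.1 ≠ q.2 → Blocked C a b D x' q.1 q.2 := by
    intro l
    induction l with
    | nil => exact ⟨x, h, le_rfl, by simp⟩
    | cons q l ih =>
      obtain ⟨x', h1, h2, h3⟩ := ih
      by_cases hq : q.1 = q.2
      · refine ⟨x', h1, h2, fun r hr hne => ?_⟩
        rcases List.mem_cons.1 hr with rfl | hr
        · exact absurd hq hne
        · exact h3 r hr hne
      · obtain ⟨x'', h1', h2', h3', h4'⟩ :=
          exists_pipage_step d hp cov hD (h1.le ha hb hab) hq h1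
        refine ⟨x'', h1', h2'.trans h2, fun r hr hne => ?_⟩
        rcases List.mem_cons.1 hr with rfl | hr
        · exact h3'
        · exact h4' _ _ (h3 r hr hne)
  obtain ⟨x', h1, h2, h3⟩ := key (Finset.univ : Finset (E × E)).toList
  exact ⟨x', h1, h2, h1.integral ha hb hab fun i j hij => h3 (i, j) (by simp) hij⟩

end PipageReal

/-! ### A membership test for the spanning tree polytope by load balancing -/

section Balance

open Finset

variable {V E : Type*} [DecidableEq V] [Fintype E]

/-- The load of `v` if the edge `e` contributes `p e` to `a e` and the rest of `X e` to `b e`. -/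
def load (a b : E → V) (X p : E → ℤ) (v : V) : ℤ :=
  ∑ e, ((if a e = v then p e else 0) + (if b e = v then X e - p e else 0))

/-- The load that exceeds the capacity. -/
def excess (a b : E → V) (X : E → ℤ) (cap : V → ℤ) (p : E → ℤ) (v : V) : ℤ :=
  load a b X p v - cap v

/-- The amount to be moved from the first to the second endpoint of an edge of weight `X` with
contribution `p` to the first endpoint, where `Δ` is the difference of the excesses. -/
def transfer (M X p Δ : ℤ) : ℤ :=
  if 0 ≤ Δ then min p (Δ / 2) / M else -(min (X - p) (-Δ / 2) / M)

/-- One round of load balancing. -/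
def balance (a b : E → V) (X : E → ℤ) (cap : V → ℤ) (M : ℤ) (p : E → ℤ) (e : E) : ℤ :=
  max 0 (min (X e) (p e - transfer M (X e) (p e)
    (excess a b X cap p (a e) - excess a b X cap p (b e))))

variable {a b : E → V} {X : E → ℤ} {cap : V → ℤ} {M : ℤ} {p : E → ℤ} {C : Finset V}

theorem transfer_le {M X p Δ : ℤ} (hM : 1 ≤ M) (hp : 0 ≤ p) (hX : p ≤ X) :
    transfer M X p Δ ≤ p ∧ -(X - p) ≤ transfer M X p Δ := by
  unfold transfer
  split
  · have h1 : 0 ≤ min p (Δ / 2) := le_min hp (by omega)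
    have h2 := Int.ediv_le_self M h1
    have h3 := Int.ediv_nonneg h1 (by omega : 0 ≤ M)
    have := min_le_left p (Δ / 2)
    omega
  · have h1 : 0 ≤ min (X - p) (-Δ / 2) := le_min (by omega) (by omega)
    have h2 := Int.ediv_le_self M h1
    have h3 := Int.ediv_nonneg h1 (by omega : 0 ≤ M)
    have := min_le_left (X - p) (-Δ / 2)
    omega

/-- All edges transfer simultaneously. Division by `M`, which is at least the number of edges, damps
each transfer to at most `|Δ| / (2 * M)` in absolute value, so the quadratic effect of the joint
transfers cannot outweigh the linear gain. -/
theorem transfer_mul_ge {M X p Δ : ℤ} (hM : 1 ≤ M) (hp : 0 ≤ p) (hX : p ≤ X) :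
    2 * M * transfer M X p Δ ^ 2 ≤ transfer M X p Δ * Δ := by
  unfold transfer
  split
  · have h1 : 0 ≤ min p (Δ / 2) := le_min hp (by omega)
    have h3 := Int.ediv_nonneg h1 (by omega : 0 ≤ M)
    have h4 := Int.ediv_mul_le (min p (Δ / 2)) (by omega : M ≠ 0)
    have h5 := min_le_right p (Δ / 2)
    generalize min p (Δ / 2) / M = t at *
    have h6 : 2 * M * t ≤ Δ := by
      have : t * M ≤ Δ / 2 := h4.trans h5
      rw [mul_assoc, mul_comm M t]
      omega
    nlinarith
  · have h1 : 0 ≤ min (X - p) (-Δ / 2) := le_min (by omega) (by omega)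
    have h3 := Int.ediv_nonneg h1 (by omega : 0 ≤ M)
    have h4 := Int.ediv_mul_le (min (X - p) (-Δ / 2)) (by omega : M ≠ 0)
    have h5 := min_le_right (X - p) (-Δ / 2)
    generalize min (X - p) (-Δ / 2) / M = t at *
    have h6 : 2 * M * t ≤ -Δ := by
      have : t * M ≤ -Δ / 2 := h4.trans h5
      rw [mul_assoc, mul_comm M t]
      omega
    nlinarith

/-- If little is transferred over an edge with a large difference of the excesses, then there is
little left to transfer. -/
theorem lt_of_transfer_le {M X p Δ g : ℤ} (hM : 1 ≤ M) (hg : 0 ≤ g)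
    (ht : transfer M X p Δ ≤ g) (hΔ : 4 * M * (g + 1) ≤ Δ) : p ≤ M * (g + 1) := by
  have hMg : 0 ≤ M * (g + 1) := by positivity
  have h0 : 0 ≤ Δ := by nlinarith
  rw [transfer, if_pos h0] at ht
  by_contra hp
  have h1 : M * (g + 1) ≤ min p (Δ / 2) := by
    refine le_min (by omega) ?_
    have : 4 * (M * (g + 1)) ≤ Δ := by linarith
    omega
  have h2 := Int.ediv_le_ediv (by omega : 0 < M) h1
  rw [Int.mul_ediv_cancel_left _ (by omega)] at h2
  omega

theorem lt_of_le_transfer {M X p Δ g : ℤ} (hM : 1 ≤ M) (hg : 0 ≤ g)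
    (ht : -g ≤ transfer M X p Δ) (hΔ : Δ ≤ -(4 * M * (g + 1))) : X - p ≤ M * (g + 1) := by
  have hMg : 0 < M * (g + 1) := by positivity
  have h0 : ¬ 0 ≤ Δ := by nlinarith
  rw [transfer, if_neg h0] at ht
  by_contra hp
  have h1 : M * (g + 1) ≤ min (X - p) (-Δ / 2) := by
    refine le_min (by omega) ?_
    have : 4 * (M * (g + 1)) ≤ -Δ := by linarith
    omega
  have h2 := Int.ediv_le_ediv (by omega : 0 < M) h1
  rw [Int.mul_ediv_cancel_left _ (by omega)] at h2
  omega

theorem balance_mem (hX : ∀ e, 0 ≤ X e) (e : E) :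
    0 ≤ balance a b X cap M p e ∧ balance a b X cap M p e ≤ X e := by
  have := hX e
  unfold balance
  exact ⟨le_max_left _ _, max_le this (min_le_left _ _)⟩

/-- The clamping to `[0, X e]` never acts under these hypotheses. It makes `balance_mem` independent
of `M` and, in the program, keeps numbers small on arbitrary inputs. -/
theorem balance_eq (hM : 1 ≤ M) (hp : ∀ e, 0 ≤ p e ∧ p e ≤ X e) (e : E) :
    balance a b X cap M p e = p e - transfer M (X e) (p e)
      (excess a b X cap p (a e) - excess a b X cap p (b e)) := by
  obtain ⟨h1, h2⟩ := transfer_le (Δ := excess a b X cap p (a e) - excess a b X cap p (b e)) hM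
    (hp e).1 (hp e).2
  unfold balance
  rw [min_eq_right (by linarith), max_eq_right (by linarith)]

theorem sum_load (S : Finset V) : ∑ v ∈ S, load a b X p v =
    mass a b X S + ∑ e, ((if a e ∈ S ∧ b e ∉ S then p e else 0) +
      (if b e ∈ S ∧ a e ∉ S then X e - p e else 0)) := by
  simp only [load, mass]
  rw [Finset.sum_comm, Finset.sum_filter, ← Finset.sum_add_distrib]
  refine Finset.sum_congr rfl fun e _ => ?_
  rw [Finset.sum_add_distrib, Finset.sum_ite_eq, Finset.sum_ite_eq]
  by_cases h1 : a e ∈ S <;> by_cases h2 : b e ∈ S <;> simp [h1, h2]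

/-- The easy half of the orientation criterion: any splitting with small loads certifies small mass.
-/
theorem mass_le_sum_load (hp : ∀ e, 0 ≤ p e ∧ p e ≤ X e) (S : Finset V) :
    mass a b X S ≤ ∑ v ∈ S, load a b X p v := by
  rw [sum_load, le_add_iff_nonneg_right]
  refine Finset.sum_nonneg fun e _ => ?_
  have := hp e
  split <;> split <;> omega

theorem sum_excess_mul (ha : ∀ e, a e ∈ C) (hb : ∀ e, b e ∈ C) (f : V → ℤ) (η : E → ℤ) :
    ∑ v ∈ C, f v * ∑ e, η e * ((if a e = v then 1 else 0) - (if b e = v then 1 else 0)) =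
      ∑ e, η e * (f (a e) - f (b e)) := by
  simp only [Finset.mul_sum]
  rw [Finset.sum_comm]
  refine Finset.sum_congr rfl fun e _ => ?_
  have : ∀ v, f v * (η e * ((if a e = v then 1 else 0) - (if b e = v then 1 else 0))) =
      (if a e = v then η e * f v else 0) - (if b e = v then η e * f v else 0) := by
    intro v
    split <;> split <;> ring
  simp only [this, Finset.sum_sub_distrib, Finset.sum_ite_eq, ha e, hb e, if_true]
  ring

/-- Cauchy-Schwarz at every vertex; the factor 2 arises because each edge is counted at both
endpoints. -/
theorem sum_sq_le (ha : ∀ e, a e ∈ C) (hb : ∀ e, b e ∈ C) (hab : ∀ e, a e ≠ b e) (η : E → ℤ) :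
    ∑ v ∈ C, (∑ e, η e * ((if a e = v then 1 else 0) - (if b e = v then 1 else 0))) ^ 2 ≤
      2 * (Fintype.card E : ℤ) * ∑ e, η e ^ 2 := by
  calc _ ≤ ∑ v ∈ C, (Fintype.card E : ℤ) *
        ∑ e, (η e * ((if a e = v then 1 else 0) - (if b e = v then 1 else 0))) ^ 2 :=
        Finset.sum_le_sum fun v _ => sq_sum_le_card_mul_sum_sq
    _ = (Fintype.card E : ℤ) * ∑ e, ∑ v ∈ C,
        ((if a e = v then η e ^ 2 else 0) + (if b e = v then η e ^ 2 else 0)) := by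
        rw [← Finset.mul_sum, Finset.sum_comm]
        congr 1
        refine Finset.sum_congr rfl fun e _ => Finset.sum_congr rfl fun v _ => ?_
        have := hab e
        by_cases h1 : a e = v <;> by_cases h2 : b e = v
        · exact absurd (h1.trans h2.symm) this
        all_goals simp [h1, h2]
    _ = _ := by
        simp only [Finset.sum_add_distrib, Finset.sum_ite_eq, ha, hb, if_true]
        ring

/-- The potential decreases. -/
theorem potential_balance (ha : ∀ e, a e ∈ C) (hb : ∀ e, b e ∈ C) (hab : ∀ e, a e ≠ b e)
    (hM : 1 ≤ M) (hE : (Fintype.card E : ℤ) ≤ M) (hp : ∀ e, 0 ≤ p e ∧ p e ≤ X e) :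
    ∑ v ∈ C, excess a b X cap (balance a b X cap M p) v ^ 2 +
      ∑ e, transfer M (X e) (p e) (excess a b X cap p (a e) - excess a b X cap p (b e)) ^ 2 ≤
      ∑ v ∈ C, excess a b X cap p v ^ 2 := by
  set η : E → ℤ := fun e =>
    transfer M (X e) (p e) (excess a b X cap p (a e) - excess a b X cap p (b e)) with hη
  have h1 : ∀ v, excess a b X cap (balance a b X cap M p) v = excess a b X cap p v -
      ∑ e, η e * ((if a e = v then 1 else 0) - (if b e = v then 1 else 0)) := by
    intro v
    have : load a b X (balance a b X cap M p) v = load a b X p v -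
        ∑ e, η e * ((if a e = v then 1 else 0) - (if b e = v then 1 else 0)) := by
      simp only [load, ← Finset.sum_sub_distrib]
      refine Finset.sum_congr rfl fun e _ => ?_
      rw [balance_eq hM hp e]
      split <;> split <;> simp only [hη] <;> ring
    rw [excess, this, excess]
    ring
  have h2 := sum_excess_mul ha hb (excess a b X cap p) η
  have h3 := sum_sq_le ha hb hab η
  -- The linear gain in the potential is at least `4 * M * ∑ η ^ 2`, and the quadratic loss is at
  -- most `2 * M * ∑ η ^ 2` by `h3` and `hE`. The difference suffices.
  have h4 : ∑ e, 2 * M * η e ^ 2 ≤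
      ∑ e, η e * (excess a b X cap p (a e) - excess a b X cap p (b e)) :=
    Finset.sum_le_sum fun e _ => transfer_mul_ge hM (hp e).1 (hp e).2
  rw [← Finset.mul_sum] at h4
  have h0 : 0 ≤ ∑ e, η e ^ 2 := Finset.sum_nonneg fun e _ => sq_nonneg _
  have h5 : ∑ v ∈ C, excess a b X cap (balance a b X cap M p) v ^ 2 =
      ∑ v ∈ C, excess a b X cap p v ^ 2 -
      2 * ∑ v ∈ C, excess a b X cap p v *
        ∑ e, η e * ((if a e = v then 1 else 0) - (if b e = v then 1 else 0)) +
      ∑ v ∈ C, (∑ e, η e * ((if a e = v then 1 else 0) - (if b e = v then 1 else 0))) ^ 2 := by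
    rw [Finset.mul_sum, ← Finset.sum_sub_distrib, ← Finset.sum_add_distrib]
    refine Finset.sum_congr rfl fun v _ => ?_
    rw [h1]
    ring
  rw [h5, h2]
  nlinarith

/-- Two consecutive members of a chain of vertex sets coincide. -/
theorem exists_stable {S : ℕ → Finset V} (hS : ∀ j, S j ⊆ C) (h1 : (S 1).Nonempty) :
    ∃ j, 1 ≤ j ∧ j ≤ #C ∧ ¬ (S j ⊂ S (j + 1)) := by
  by_contra hcon
  push Not at hcon
  have : ∀ j, j ≤ #C → j + 1 ≤ #(S (j + 1)) := by
    intro j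
    induction j with
    | zero => intro _; simpa using h1.card_pos
    | succ j ih =>
      intro hj
      have := Finset.card_lt_card (hcon (j + 1) (by omega) hj)
      have := ih (by omega)
      omega
  have h2 := this _ le_rfl
  have h3 := Finset.card_le_card (hS (#C + 1))
  omega

/-- If little is transferred, then no excess is large. -/
theorem excess_le (ha : ∀ e, a e ∈ C) (hb : ∀ e, b e ∈ C) (hM : 1 ≤ M)
    (hE : (Fintype.card E : ℤ) ≤ M) (hC : (#C : ℤ) ≤ M)
    (hX : ∀ S ⊆ C, S.Nonempty → mass a b X S ≤ ∑ v ∈ S, cap v) {g : ℤ} (hg : 0 ≤ g)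
    (ht : ∀ e, |transfer M (X e) (p e)
      (excess a b X cap p (a e) - excess a b X cap p (b e))| ≤ g) {v : V} (hv : v ∈ C) :
    excess a b X cap p v ≤ 4 * M ^ 2 * (g + 1) := by
  obtain ⟨w, hw, hmax⟩ := Finset.exists_max_image C (excess a b X cap p) ⟨v, hv⟩
  refine (hmax v hv).trans ?_
  by_contra hcon
  push Not at hcon
  set m := excess a b X cap p w with hm
  have hG : 0 < 4 * M * (g + 1) := by positivity
  -- The level sets of the excess at distance `4 * M * (g + 1)` below the maximum form a chain, so
  -- one of the first `#C` bands is empty: all vertices outside of `S` have an excess smaller by a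
  -- full band.
  obtain ⟨j, hj1, hj2, hj3⟩ := exists_stable (C := C)
    (S := fun j => C.filter fun v => m - j * (4 * M * (g + 1)) < excess a b X cap p v)
    (fun j => Finset.filter_subset _ _) ⟨w, by
      simp only [Finset.mem_filter, hw, true_and, ← hm, Nat.cast_one]; linarith⟩
  set S := C.filter fun v => m - j * (4 * M * (g + 1)) < excess a b X cap p v with hS
  have hgap : ∀ v ∈ C, v ∉ S → excess a b X cap p v ≤ m - (j + 1) * (4 * M * (g + 1)) := by
    intro v hv hvS
    by_contra hc
    push Not at hc
    refine hj3 (Finset.ssubset_iff_subset_ne.2 ⟨fun u hu => ?_, fun heq => hvS ?_⟩)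
    · rw [Finset.mem_filter] at hu ⊢
      refine ⟨hu.1, lt_of_le_of_lt ?_ hu.2⟩
      push_cast
      linarith
    · rw [heq, Finset.mem_filter]
      exact ⟨hv, by push_cast; exact hc⟩
  -- At most `M` bands lie above the threshold of `S`, so the threshold is still positive if the
  -- maximum exceeds `4 * M ^ 2 * (g + 1)`.
  have hpos : ∀ v ∈ S, 0 ≤ excess a b X cap p v := by
    intro v hv
    rw [hS, Finset.mem_filter] at hv
    have h1 : (j : ℤ) ≤ M := le_trans (by exact_mod_cast hj2) hC
    have h2 : (j : ℤ) * (4 * M * (g + 1)) ≤ M * (4 * M * (g + 1)) :=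
      mul_le_mul_of_nonneg_right h1 hG.le
    nlinarith
  have hwS : w ∈ S := by
    rw [hS, Finset.mem_filter]
    refine ⟨hw, ?_⟩
    have : (0 : ℤ) < j := by exact_mod_cast hj1
    have := mul_pos this hG
    linarith
  have h1 : m ≤ ∑ v ∈ S, excess a b X cap p v := Finset.single_le_sum hpos hwS
  have h2 : ∑ v ∈ S, excess a b X cap p v = ∑ v ∈ S, load a b X p v - ∑ v ∈ S, cap v := by
    simp only [excess, Finset.sum_sub_distrib]
  have h3 := hX S (Finset.filter_subset _ _) ⟨w, hwS⟩
  -- Across the gap small transfers mean that each cut edge has at most `M * (g + 1)` left on the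
  -- side of `S`. So the load of `S` exceeds its mass, and hence its capacity, by at most `M ^ 2 *
  -- (g + 1)`, which contradicts the excess of `w` alone.
  have h4 : ∑ e, ((if a e ∈ S ∧ b e ∉ S then p e else 0) +
      (if b e ∈ S ∧ a e ∉ S then X e - p e else 0)) ≤ ∑ _e : E, M * (g + 1) := by
    have hMg : 0 ≤ M * (g + 1) := by positivity
    refine Finset.sum_le_sum fun e _ => ?_
    have hte := abs_le.1 (ht e)
    by_cases h5 : a e ∈ S <;> by_cases h6 : b e ∈ S
    · simpa [h5, h6] using hMg
    · have h7 := hgap _ (hb e) h6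
      have h8 := (Finset.mem_filter.1 (hS ▸ h5)).2
      simpa [h5, h6] using lt_of_transfer_le hM hg hte.2 (by linarith)
    · have h7 := hgap _ (ha e) h5
      have h8 := (Finset.mem_filter.1 (hS ▸ h6)).2
      simpa [h5, h6] using lt_of_le_transfer hM hg hte.1 (by linarith)
    · simpa [h5, h6] using hMg
  rw [Finset.sum_const, Finset.card_univ, nsmul_eq_mul] at h4
  rw [sum_load] at h2
  have h5 : (Fintype.card E : ℤ) * (M * (g + 1)) ≤ M * (M * (g + 1)) :=
    mul_le_mul_of_nonneg_right hE (by positivity)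
  have h6 : 0 ≤ M * (M * (g + 1)) := by positivity
  nlinarith

theorem sum_excess_eq_zero (ha : ∀ e, a e ∈ C) (hb : ∀ e, b e ∈ C)
    (hXC : ∑ e, X e = ∑ v ∈ C, cap v) : ∑ v ∈ C, excess a b X cap p v = 0 := by
  simp only [excess, Finset.sum_sub_distrib]
  rw [sum_load, ← hXC, mass, Finset.filter_true_of_mem fun e _ => ⟨ha e, hb e⟩]
  simp [ha, hb]

/-- `excess_le` bounds the excesses from above by `B`. They sum to zero, so they are also at least
`-(M * B)`, and at most `M` squares are added. Thus a large potential forces a large transfer. -/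
theorem potential_le (ha : ∀ e, a e ∈ C) (hb : ∀ e, b e ∈ C) (hM : 1 ≤ M)
    (hE : (Fintype.card E : ℤ) ≤ M) (hC : (#C : ℤ) ≤ M)
    (hX : ∀ S ⊆ C, S.Nonempty → mass a b X S ≤ ∑ v ∈ S, cap v)
    (hXC : ∑ e, X e = ∑ v ∈ C, cap v) {g : ℤ} (hg : 0 ≤ g)
    (ht : ∀ e, |transfer M (X e) (p e)
      (excess a b X cap p (a e) - excess a b X cap p (b e))| ≤ g) :
    ∑ v ∈ C, excess a b X cap p v ^ 2 ≤ 16 * M ^ 7 * (g + 1) ^ 2 := by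
  set B := 4 * M ^ 2 * (g + 1) with hB
  have hB0 : 0 ≤ B := by positivity
  have h1 : ∀ v ∈ C, excess a b X cap p v ≤ B := fun v hv => excess_le ha hb hM hE hC hX hg ht hv
  have h2 : ∀ v ∈ C, -(M * B) ≤ excess a b X cap p v := by
    intro v hv
    have h3 := sum_excess_eq_zero (cap := cap) (p := p) ha hb hXC
    rw [← Finset.add_sum_erase _ _ hv] at h3
    have h4 : ∑ u ∈ C.erase v, excess a b X cap p u ≤ ∑ _u ∈ C.erase v, B :=
      Finset.sum_le_sum fun u hu => h1 u (Finset.mem_of_mem_erase hu)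
    rw [Finset.sum_const, nsmul_eq_mul] at h4
    have h5 : (#(C.erase v) : ℤ) ≤ M := le_trans (by
      exact_mod_cast Finset.card_le_card (Finset.erase_subset v C)) hC
    have := mul_le_mul_of_nonneg_right h5 hB0
    linarith
  have h3 : ∀ v ∈ C, excess a b X cap p v ^ 2 ≤ (M * B) ^ 2 := by
    intro v hv
    refine sq_le_sq' (h2 v hv) ((h1 v hv).trans ?_)
    nlinarith
  calc _ ≤ ∑ _v ∈ C, (M * B) ^ 2 := Finset.sum_le_sum h3
    _ = #C * (M * B) ^ 2 := by rw [Finset.sum_const, nsmul_eq_mul]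
    _ ≤ M * (M * B) ^ 2 := mul_le_mul_of_nonneg_right hC (sq_nonneg _)
    _ = _ := by rw [hB]; ring

/-- Bernoulli's inequality for `(1 + 1/q) ^ (q + 1)`, cleared of denominators. -/
theorem two_mul_pow_le {q : ℕ} (hq : 0 < q) : 2 * q ^ (q + 1) ≤ (q + 1) ^ (q + 1) := by
  have h : ∀ k, q ^ k * (q + k) ≤ (q + 1) ^ k * q := by
    intro k
    induction k with
    | zero => simp
    | succ k ih =>
      calc q ^ (k + 1) * (q + (k + 1)) ≤ (q + 1) * (q ^ k * (q + k)) := by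
            rw [pow_succ]
            nlinarith [Nat.zero_le (q ^ k), Nat.zero_le (q ^ k * k)]
        _ ≤ (q + 1) * ((q + 1) ^ k * q) := Nat.mul_le_mul_left _ ih
        _ = _ := by ring
  have h1 := h (q + 1)
  refine Nat.le_of_mul_le_mul_right (le_trans ?_ h1) hq
  calc 2 * q ^ (q + 1) * q = q ^ (q + 1) * (2 * q) := by ring
    _ ≤ _ := Nat.mul_le_mul_left _ (by omega)

/-- A sequence of natural numbers that decreases geometrically stops. -/
theorem exists_stop {f : ℕ → ℕ} {P : ℕ → Prop} {Q s : ℕ} (hQ : 2 ≤ Q)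
    (hf : ∀ k, P k ∨ (Q * f (k + 1) ≤ (Q - 1) * f k ∧ 0 < f k)) (h0 : f 0 < 2 ^ s) :
    ∃ k ≤ Q * s, P k := by
  by_contra hcon
  push Not at hcon
  obtain ⟨q, rfl⟩ : ∃ q, Q = q + 1 := ⟨Q - 1, by omega⟩
  simp only [Nat.add_sub_cancel] at hf
  have h1 : ∀ k ≤ (q + 1) * s, (q + 1) ^ k * f k ≤ q ^ k * f 0 := by
    intro k
    induction k with
    | zero => simp
    | succ k ih =>
      intro hk
      have h2 := ((hf k).resolve_left (hcon k (by omega))).1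
      calc (q + 1) ^ (k + 1) * f (k + 1) = (q + 1) ^ k * ((q + 1) * f (k + 1)) := by ring
        _ ≤ (q + 1) ^ k * (q * f k) := Nat.mul_le_mul_left _ h2
        _ = q * ((q + 1) ^ k * f k) := by ring
        _ ≤ q * (q ^ k * f 0) := Nat.mul_le_mul_left _ (ih (by omega))
        _ = _ := by ring
  have h2 := h1 _ le_rfl
  have h3 := ((hf ((q + 1) * s)).resolve_left (hcon _ le_rfl)).2
  -- Each of the `s` blocks of `Q` rounds at least halves `f`, so after `Q * s` rounds a positive
  -- natural number would have dropped below one.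
  have h4 : 2 ^ s * q ^ ((q + 1) * s) ≤ (q + 1) ^ ((q + 1) * s) := by
    rw [pow_mul, pow_mul, ← mul_pow]
    exact Nat.pow_le_pow_left (two_mul_pow_le (by omega)) s
  have h5 : q ^ ((q + 1) * s) * f 0 < q ^ ((q + 1) * s) * 2 ^ s :=
    Nat.mul_lt_mul_of_pos_left h0 (Nat.pow_pos (by omega))
  have h6 : (q + 1) ^ ((q + 1) * s) ≤ (q + 1) ^ ((q + 1) * s) * f ((q + 1) * s) :=
    Nat.le_mul_of_pos_right _ h3
  rw [mul_comm] at h4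
  omega

theorem iterate_balance_mem (hp : ∀ e, 0 ≤ p e ∧ p e ≤ X e) (k : ℕ) (e : E) :
    0 ≤ (balance a b X cap M)^[k] p e ∧ (balance a b X cap M)^[k] p e ≤ X e := by
  cases k with
  | zero => exact hp e
  | succ k =>
    rw [Function.iterate_succ_apply']
    exact balance_mem (fun e => (hp e).1.trans (hp e).2) e

/-- Load balancing finds an assignment with small excess, if the cut condition holds. -/
theorem excess_iterate_le (ha : ∀ e, a e ∈ C) (hb : ∀ e, b e ∈ C) (hab : ∀ e, a e ≠ b e)
    (hM : 1 ≤ M) (hE : (Fintype.card E : ℤ) ≤ M) (hC : (#C : ℤ) ≤ M)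
    (hp : ∀ e, 0 ≤ p e ∧ p e ≤ X e)
    (hX : ∀ S ⊆ C, S.Nonempty → mass a b X S ≤ ∑ v ∈ S, cap v)
    (hXC : ∑ e, X e = ∑ v ∈ C, cap v) {s k : ℕ}
    (hs : ∑ v ∈ C, excess a b X cap p v ^ 2 < 2 ^ s) (hk : 64 * M ^ 7 * s ≤ k) {v : V}
    (hv : v ∈ C) : excess a b X cap ((balance a b X cap M)^[k] p) v ≤ 4 * M ^ 2 := by
  set P : ℕ → E → ℤ := fun k => (balance a b X cap M)^[k] p with hP
  have hPmem : ∀ k e, 0 ≤ P k e ∧ P k e ≤ X e := fun k e => iterate_balance_mem hp k e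
  have hPsucc : ∀ k, P (k + 1) = balance a b X cap M (P k) := fun k =>
    Function.iterate_succ_apply' _ _ _
  set η : ℕ → E → ℤ := fun k e => transfer M (X e) (P k e)
    (excess a b X cap (P k) (a e) - excess a b X cap (P k) (b e)) with hη
  set Ψ : ℕ → ℤ := fun k => ∑ v ∈ C, excess a b X cap (P k) v ^ 2 with hΨ
  have hΨ0 : ∀ k, 0 ≤ Ψ k := fun k => Finset.sum_nonneg fun v _ => sq_nonneg _
  have hdec : ∀ k, Ψ (k + 1) + ∑ e, η k e ^ 2 ≤ Ψ k := by
    intro k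
    simp only [hΨ, hPsucc]
    exact potential_balance ha hb hab hM hE (hPmem k)
  -- If the largest transfer `g` is at least 1, then `(g + 1) ^ 2 ≤ 4 * g ^ 2` and the potential is
  -- at most `64 * M ^ 7 * g ^ 2`, while it drops by at least `g ^ 2`. So it shrinks by the factor
  -- `1 - 1 / (64 * M ^ 7)` in each round until all transfers vanish.
  obtain ⟨i, hi, hi0⟩ : ∃ i ≤ (64 * M ^ 7).toNat * s, ∀ e, η i e = 0 := by
    have hM7 : 1 ≤ M ^ 7 := one_le_pow₀ hM
    refine exists_stop (f := fun k => (Ψ k).toNat) (by omega) (fun k => ?_) ?_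
    · by_cases hk0 : ∀ e, η k e = 0
      · exact .inl hk0
      · right
        push Not at hk0
        obtain ⟨e₀, he₀⟩ := hk0
        obtain ⟨e, -, he⟩ := Finset.exists_max_image Finset.univ (fun e => |η k e|)
          ⟨e₀, Finset.mem_univ _⟩
        set g := |η k e| with hg
        have hg1 : 1 ≤ g := (Int.one_le_abs he₀).trans (he e₀ (Finset.mem_univ _))
        have h1 := potential_le (p := P k) ha hb hM hE hC hX hXC (by omega : 0 ≤ g)
          fun e => he e (Finset.mem_univ _)
        have h2 : g ^ 2 ≤ ∑ e, η k e ^ 2 := by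
          rw [hg, sq_abs]
          exact Finset.single_le_sum (f := fun e => η k e ^ 2) (fun e _ => sq_nonneg _)
            (Finset.mem_univ e)
        have h3 := hdec k
        have h4 : Ψ k ≤ 64 * M ^ 7 * g ^ 2 := by
          refine h1.trans ?_
          have h5 : (g + 1) ^ 2 ≤ 4 * g ^ 2 := by nlinarith
          have := mul_le_mul_of_nonneg_left h5 (by positivity : 0 ≤ 16 * M ^ 7)
          linarith
        have h5 : 64 * M ^ 7 * Ψ (k + 1) ≤ (64 * M ^ 7 - 1) * Ψ k := by
          have h6 : Ψ (k + 1) ≤ Ψ k - g ^ 2 := by linarith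
          have := mul_le_mul_of_nonneg_left h6 (by positivity : 0 ≤ 64 * M ^ 7)
          linarith
        have h6 : 0 < Ψ k := by
          have := hΨ0 (k + 1)
          have : 0 < g ^ 2 := by positivity
          linarith
        constructor
        · zify
          rw [Nat.cast_sub (by omega)]
          rw [Int.toNat_of_nonneg (by omega), Int.toNat_of_nonneg (hΨ0 _),
            Int.toNat_of_nonneg (hΨ0 _)]
          exact_mod_cast h5
        · omega
    · have : ((Ψ 0).toNat : ℤ) < 2 ^ s := by
        rw [Int.toNat_of_nonneg (hΨ0 0)]
        exact hs
      exact_mod_cast this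
  have hik : i ≤ k := by
    have : ((64 * M ^ 7).toNat * s : ℤ) ≤ k := by
      rw [Int.toNat_of_nonneg (by positivity)]
      exact hk
    have : (64 * M ^ 7).toNat * s ≤ k := by exact_mod_cast this
    omega
  -- A round without transfers is a fixed point, so surplus rounds are harmless.
  have hfix : balance a b X cap M (P i) = P i := by
    ext e
    rw [balance_eq hM (hPmem i) e]
    have := hi0 e
    simp only [hη] at this
    rw [this, sub_zero]
  have hk' : P k = P i := by
    obtain ⟨j, rfl⟩ := Nat.exists_eq_add_of_le' hik
    simp only [hP, Function.iterate_add_apply]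
    exact Function.iterate_fixed hfix j
  change excess a b X cap (P k) v ≤ _
  rw [hk']
  have := excess_le (g := 0) (p := P i) ha hb hM hE hC hX le_rfl
    (fun e => by have := hi0 e; simp only [hη] at this; rw [this, abs_zero]) hv
  simpa using this

/-- The capacities for the root `r`. -/
def capacity (D : ℤ) (r v : V) : ℤ := if v = r then 0 else D

theorem sum_capacity (D : ℤ) {r : V} {S : Finset V} :
    ∑ v ∈ S, capacity D r v = D * ((#S : ℤ) - if r ∈ S then 1 else 0) := by
  have : ∀ v, capacity D r v = D - if v = r then D else 0 := by
    intro v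
    simp only [capacity]
    split <;> ring
  simp only [this, Finset.sum_sub_distrib, Finset.sum_const, nsmul_eq_mul, Finset.sum_ite_eq']
  split <;> ring

theorem mass_mul (F : ℤ) (x : E → ℤ) (S : Finset V) :
    mass a b (fun e => F * x e) S = F * mass a b x S := by
  simp only [mass, Finset.mul_sum]

/-- Load balancing with all roots decides membership in the spanning tree polytope. -/
theorem balance_test_iff {D F : ℤ} {x : E → ℤ} {s k : ℕ} (ha : ∀ e, a e ∈ C)
    (hb : ∀ e, b e ∈ C) (hab : ∀ e, a e ≠ b e)
    (hM : 1 ≤ M) (hE : (Fintype.card E : ℤ) ≤ M) (hC : (#C : ℤ) ≤ M) (hD : 0 ≤ D)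
    (hF : F = 4 * M ^ 3 + 1) (hx : ∀ e, 0 ≤ x e) (hxC : ∑ e, x e = D * ((#C : ℤ) - 1))
    (hs : M * (F * D * M) ^ 2 < 2 ^ s) (hk : 64 * M ^ 7 * s ≤ k) :
    (∀ r ∈ C, ∀ v ∈ C, M * excess a b (fun e => F * x e) (capacity (F * D) r)
      ((balance a b (fun e => F * x e) (capacity (F * D) r) M)^[k] fun e => F * x e) v < F) ↔
    InTreePolytope C a b D x := by
  have hF0 : 0 < F := by rw [hF]; positivity
  have hp : ∀ e, 0 ≤ F * x e ∧ F * x e ≤ F * x e := fun e =>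
    ⟨mul_nonneg hF0.le (hx e), le_rfl⟩
  constructor
  -- For a set `S` the test with a root in `S` is used. The excesses in `S` sum to at most `F - 1`,
  -- which gives `F * mass < F * (D * (#S - 1) + 1)`, and integrality removes the error.
  · intro h
    refine ⟨hx, hxC, fun S hSC hS => ?_⟩
    obtain ⟨r, hr⟩ := hS
    have h1 := mass_le_sum_load (a := a) (b := b) (X := fun e => F * x e)
      (iterate_balance_mem (a := a) (b := b) (cap := capacity (F * D) r) (M := M) hp k) S
    have h2 := sum_capacity (F * D) (r := r) (S := S)
    rw [if_pos hr] at h2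
    have h3 : ∀ v ∈ S, M * excess a b (fun e => F * x e) (capacity (F * D) r)
      ((balance a b (fun e => F * x e) (capacity (F * D) r) M)^[k] fun e => F * x e) v ≤ F - 1 :=
      fun v hv => by have := h r (hSC hr) v (hSC hv); omega
    have h4 := Finset.sum_le_sum h3
    rw [← Finset.mul_sum, Finset.sum_const, nsmul_eq_mul] at h4
    simp only [excess, Finset.sum_sub_distrib, h2] at h4
    have h5 : (#S : ℤ) * (F - 1) ≤ M * (F - 1) :=
      mul_le_mul_of_nonneg_right (le_trans (by exact_mod_cast Finset.card_le_card hSC) hC)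
        (by omega)
    have h6 := le_of_mul_le_mul_left (h4.trans h5) (by omega : 0 < M)
    rw [mass_mul] at h1
    have h7 : F * mass a b x S < F * (D * ((#S : ℤ) - 1) + 1) := by linarith
    have := lt_of_mul_lt_mul_left h7 hF0.le
    omega
  -- For every root the capacity of `S` is at least `F * D * (#S - 1)`, so the cut condition of load
  -- balancing holds. The final excess is at most `4 * M ^ 2`, and `F` was chosen to exceed `M`
  -- times this.
  · intro h r hr v hv
    have hXC : ∑ e, F * x e = ∑ v ∈ C, capacity (F * D) r v := by
      rw [sum_capacity, if_pos hr, ← Finset.mul_sum, hxC, mul_assoc]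
    have h1 : ∀ S ⊆ C, S.Nonempty →
        mass a b (fun e => F * x e) S ≤ ∑ v ∈ S, capacity (F * D) r v := by
      intro S hSC hS
      rw [mass_mul, sum_capacity, mul_assoc]
      refine mul_le_mul_of_nonneg_left ((h.mass_le S hSC hS).trans ?_) hF0.le
      refine mul_le_mul_of_nonneg_left ?_ hD
      split <;> omega
    have hFD : 0 ≤ F * D := mul_nonneg hF0.le hD
    have h2 : ∀ v ∈ C, excess a b (fun e => F * x e) (capacity (F * D) r) (fun e => F * x e) v ^ 2 ≤
        (F * D * M) ^ 2 := by
      intro v hv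
      have h3 : ∀ u ∈ C, 0 ≤ load a b (fun e => F * x e) (fun e => F * x e) u := by
        intro u _
        refine Finset.sum_nonneg fun e _ => ?_
        have h4 : 0 ≤ F * x e := (hp e).1
        split <;> split <;> simp [h4]
      have h4 : load a b (fun e => F * x e) (fun e => F * x e) v ≤ F * D * M := by
        refine (Finset.single_le_sum h3 hv).trans ?_
        have h5 := sum_excess_eq_zero (p := fun e => F * x e) ha hb hXC
        simp only [excess, Finset.sum_sub_distrib] at h5
        rw [sub_eq_zero.1 h5, sum_capacity, if_pos hr]
        exact mul_le_mul_of_nonneg_left (by omega) hFD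
      have h5 := h3 v hv
      have h6 : 0 ≤ capacity (F * D) r v ∧ capacity (F * D) r v ≤ F * D * M := by
        have : F * D ≤ F * D * M := le_mul_of_one_le_right hFD hM
        unfold capacity
        split <;> constructor <;> linarith
      refine sq_le_sq' ?_ ?_ <;> unfold excess <;> linarith
    have h3 : ∑ v ∈ C, excess a b (fun e => F * x e) (capacity (F * D) r) (fun e => F * x e) v ^ 2 <
        2 ^ s := by
      refine lt_of_le_of_lt (Finset.sum_le_sum h2) (lt_of_le_of_lt ?_ hs)
      rw [Finset.sum_const, nsmul_eq_mul]
      exact mul_le_mul_of_nonneg_right hC (sq_nonneg _)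
    have h4 := excess_iterate_le ha hb hab hM hE hC hp h1 hXC h3 hk hv
    have := mul_le_mul_of_nonneg_left h4 (by omega : 0 ≤ M)
    rw [hF]
    rw [hF] at this
    linarith

end Balance

/-! ### Backbones -/

section Graph

variable {V : Type*} {T : (⊤ : SimpleGraph V).Subgraph} {U : Set V} {α β : V}

/-- Being a tree is a property of `T.coe`, while backbones are defined by walks in `T.spanningCoe`.
A walk that starts in `T` never leaves it, which allows changing between the two. -/
theorem exists_walk_coe {u v : V} (p : T.spanningCoe.Walk u v) (hu : u ∈ T.verts) :
    ∃ (hv : v ∈ T.verts) (q : T.coe.Walk ⟨u, hu⟩ ⟨v, hv⟩),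
      q.map T.coeEmbeddingSpanningCoe.toHom = p := by
  induction p with
  | nil => exact ⟨hu, .nil, rfl⟩
  | cons h p ih =>
    have hadj : T.Adj _ _ := h
    obtain ⟨hv, q, rfl⟩ := ih hadj.snd_mem
    have hadj' : T.coe.Adj ⟨_, hu⟩ ⟨_, hadj.snd_mem⟩ := hadj
    exact ⟨hv, .cons hadj' q, rfl⟩

theorem reachable_spanningCoe (hT : T.coe.Connected) {u v : V} (hu : u ∈ T.verts)
    (hv : v ∈ T.verts) : T.spanningCoe.Reachable u v :=
  (hT.preconnected ⟨u, hu⟩ ⟨v, hv⟩).map T.coeEmbeddingSpanningCoe.toHom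

theorem path_unique (hT : T.coe.IsTree) {u v : V} (hu : u ∈ T.verts)
    {p q : T.spanningCoe.Walk u v} (hp : p.IsPath) (hq : q.IsPath) : p = q := by
  obtain ⟨hv, p, rfl⟩ := exists_walk_coe p hu
  obtain ⟨_, q, rfl⟩ := exists_walk_coe q hu
  have hinj : Function.Injective T.coeEmbeddingSpanningCoe.toHom := Subtype.val_injective
  have hp' := (SimpleGraph.Walk.isPath_map_iff_of_injective hinj).1 hp
  have hq' := (SimpleGraph.Walk.isPath_map_iff_of_injective hinj).1 hq
  have h := (hT.isAcyclic.subsingleton_path _ _).elim ⟨p, hp'⟩ ⟨q, hq'⟩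
  exact congrArg (fun r : T.coe.Path _ _ => r.1.map T.coeEmbeddingSpanningCoe.toHom) h

theorem backbone_eq (hT : T.coe.IsTree) (hU : T.verts ∩ U = {α, β}) (hne : α ≠ β) :
    ∃ p : T.spanningCoe.Walk α β, p.IsPath ∧ backbone U T = {e | e ∈ p.edges} := by
  classical
  have hα : α ∈ T.verts ∩ U := by rw [hU]; simp
  have hβ : β ∈ T.verts ∩ U := by rw [hU]; simp
  obtain ⟨p, hp⟩ := (reachable_spanningCoe hT.connected hα.1 hβ.1).exists_isPath
  refine ⟨p, hp, Set.ext fun e => ⟨?_, fun he => ⟨α, hα, β, hβ, hne, p, hp, he⟩⟩⟩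
  rintro ⟨a, ha, b, hb, hab, q, hq, he⟩
  rw [hU] at ha hb
  rcases ha with rfl | rfl <;> rcases hb with rfl | rfl
  · exact absurd rfl hab
  · rwa [path_unique hT hα.1 hq hp] at he
  · rw [path_unique hT hα.1 hp hq.reverse]
    simpa using he
  · exact absurd rfl hab

/-- The path between the anchors is unique, so its edges are exactly those whose removal separates
the anchors. This reduces the computation of backbones to graph search. -/
theorem mem_backbone_iff (hT : T.coe.IsTree) (hU : T.verts ∩ U = {α, β}) (hne : α ≠ β) (u v : V) :
    s(u, v) ∈ backbone U T ↔
      T.Adj u v ∧ ¬ (T.spanningCoe.deleteEdges {s(u, v)}).Reachable α β := by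
  classical
  have hα : α ∈ T.verts ∩ U := by rw [hU]; simp
  obtain ⟨p, hp, h⟩ := backbone_eq hT hU hne
  rw [h, Set.mem_ofPred_eq]
  constructor
  · intro he
    refine ⟨p.edges_subset_edgeSet he, fun hr => ?_⟩
    rw [SimpleGraph.reachable_deleteEdges_iff_exists_walk] at hr
    obtain ⟨q, hq⟩ := hr
    rw [path_unique hT hα.1 hp q.bypass_isPath] at he
    exact hq (q.edges_bypass_subset_edges he)
  · rintro ⟨-, hr⟩
    exact p.mem_edges_of_not_reachable_deleteEdges hr

theorem backbone_subset (U : Set V) (T : (⊤ : SimpleGraph V).Subgraph) :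
    backbone U T ⊆ T.edgeSet := by
  rintro e ⟨a, -, b, -, -, p, -, he⟩
  have := p.edges_subset_edgeSet he
  rwa [SimpleGraph.Subgraph.edgeSet_spanningCoe] at this

/-- The input encodes trees by adjacency matrices only. A connected graph with two distinct anchors
has no isolated vertices, so its vertex set can be recovered. -/
theorem exists_adj (hT : T.coe.IsTree) (hU : T.verts ∩ U = {α, β}) (hne : α ≠ β) (v : V) :
    v ∈ T.verts ↔ ∃ w, T.Adj v w := by
  refine ⟨fun hv => ?_, fun ⟨w, h⟩ => h.fst_mem⟩
  have hα : α ∈ T.verts ∩ U := by rw [hU]; simp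
  have hβ : β ∈ T.verts ∩ U := by rw [hU]; simp
  obtain ⟨w, hw, hvw⟩ : ∃ w ∈ T.verts, v ≠ w := by
    by_cases h : v = α
    · exact ⟨β, hβ.1, h ▸ hne⟩
    · exact ⟨α, hα.1, h⟩
  obtain ⟨p⟩ := reachable_spanningCoe hT.connected hv hw
  cases p with
  | nil => exact absurd rfl hvw
  | cons h p => exact ⟨_, h⟩

end Graph

/-! ### The selected multigraph -/

section Selection

open Finset

variable {V ι : Type*} [Finite V]

theorem total_eq_sum {κ : Type*} [Fintype κ] (f : κ → ℝ) (F : Set κ) [DecidablePred (· ∈ F)] :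
    total f F = ∑ k, if k ∈ F then f k else 0 := by
  classical
  rw [total, finsum_mem_def, finsum_eq_sum_of_fintype]
  refine Finset.sum_congr rfl fun k _ => ?_
  rw [Set.indicator_apply]

/-- The finite set of the elements of a set of edges. -/
noncomputable def edgeFinset (F : Set (Sym2 V)) : Finset (Sym2 V) := (Set.toFinite F).toFinset

theorem mem_edgeFinset {F : Set (Sym2 V)} {e : Sym2 V} : e ∈ edgeFinset F ↔ e ∈ F := by
  simp [edgeFinset]

theorem total_eq_sum_edgeFinset (f : Sym2 V → ℝ) (F : Set (Sym2 V)) :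
    total f F = ((edgeFinset F).val.map f).sum := by
  rw [total, finsum_mem_eq_finite_toFinset_sum _ (Set.toFinite F)]
  rfl

variable (I : Input V ι ℝ)

/-- The edges of the selected multigraph: backbones, and twice the limbs of the trees in `full`. -/
noncomputable def selectionEdges (full half : Finset ι) : Multiset (Sym2 V) :=
  ∑ i ∈ full, ((edgeFinset (backbone (core I.y) (I.tree i))).val +
    2 • (edgeFinset (limbs (core I.y) (I.tree i))).val) +
  ∑ i ∈ half, (edgeFinset (backbone (core I.y) (I.tree i))).val

/-- The vertices of the selected multigraph. -/
def selectionVerts (full half : Finset ι) : Set V :=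
  {v | v ∈ core I.y ∨ (∃ i ∈ full, v ∈ (I.tree i).verts) ∨
    ∃ i ∈ half, ∃ e ∈ backbone (core I.y) (I.tree i), v ∈ e}

variable {I}

theorem mem_selectionEdges {full half : Finset ι} {e : Sym2 V} :
    e ∈ selectionEdges I full half ↔ (∃ i ∈ full, e ∈ (I.tree i).edgeSet) ∨
      ∃ i ∈ half, e ∈ backbone (core I.y) (I.tree i) := by
  classical
  rw [selectionEdges, Multiset.mem_add, Multiset.mem_sum, Multiset.mem_sum]
  refine or_congr (exists_congr fun i => and_congr_right fun _ => ?_)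
    (exists_congr fun i => and_congr_right fun _ => ?_)
  · rw [Multiset.mem_add, Multiset.mem_nsmul, Finset.mem_val, Finset.mem_val, mem_edgeFinset,
      mem_edgeFinset, limbs, Set.mem_sdiff]
    have := @backbone_subset _ (core I.y) (I.tree i) e
    tauto
  · rw [Finset.mem_val, mem_edgeFinset]

variable (I) in
/-- The selected multigraph. -/
noncomputable def selection (full half : Finset ι) : Multigraph V where
  verts := (Set.toFinite (selectionVerts I full half)).toFinset
  edges := selectionEdges I full half
  not_isDiag e he := by
    rw [mem_selectionEdges] at he
    have : ∃ i, e ∈ (I.tree i).edgeSet := by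
      rcases he with ⟨i, -, h⟩ | ⟨i, -, h⟩
      · exact ⟨i, h⟩
      · exact ⟨i, backbone_subset _ _ h⟩
    obtain ⟨i, h⟩ := this
    exact SimpleGraph.not_isDiag_of_mem_edgeSet _ ((I.tree i).edgeSet_subset h)
  mem_verts e he v hv := by
    rw [mem_selectionEdges] at he
    simp only [Set.Finite.mem_toFinset, selectionVerts, Set.mem_ofPred_eq]
    rcases he with ⟨i, hi, h⟩ | ⟨i, hi, h⟩
    · exact .inr (.inl ⟨i, hi, (I.tree i).mem_verts_of_mem_edge h hv⟩)
    · exact .inr (.inr ⟨i, hi, e, h, hv⟩)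

theorem mem_selection_verts {full half : Finset ι} {v : V} :
    v ∈ (selection I full half).verts ↔ v ∈ selectionVerts I full half := by
  simp [selection]

variable {α β : ι → V} {full half : Finset ι}

theorem selection_reachable {i : ι} (hT : (I.tree i).coe.IsTree)
    (hU : (I.tree i).verts ∩ core I.y = {α i, β i}) (hne : α i ≠ β i) :
    (i ∈ full → ∀ v ∈ (I.tree i).verts,
      (selection I full half).toSubgraph.spanningCoe.Reachable (α i) v) ∧
    (i ∈ full ∨ i ∈ half → ∀ e ∈ backbone (core I.y) (I.tree i), ∀ v ∈ e,
      (selection I full half).toSubgraph.spanningCoe.Reachable (α i) v) ∧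
    (i ∈ full ∨ i ∈ half →
      (selection I full half).toSubgraph.spanningCoe.Reachable (α i) (β i)) := by
  classical
  have hα : α i ∈ (I.tree i).verts ∩ core I.y := by rw [hU]; simp
  obtain ⟨p, hp, hbb⟩ := backbone_eq hT hU hne
  have hadj : i ∈ full ∨ i ∈ half → ∀ e ∈ p.edges,
      e ∈ (selection I full half).toSubgraph.spanningCoe.edgeSet := by
    intro hi e he
    have h1 : e ∈ backbone (core I.y) (I.tree i) := by rw [hbb]; exact he
    have : e ∈ selectionEdges I full half := by
      rw [mem_selectionEdges]
      rcases hi with hi | hi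
      · exact .inl ⟨i, hi, backbone_subset _ _ h1⟩
      · exact .inr ⟨i, hi, h1⟩
    induction e using Sym2.ind with
    | _ a b => exact this
  refine ⟨fun hi v hv => ?_, fun hi e he v hv => ?_, fun hi => ⟨p.transfer _ (hadj hi)⟩⟩
  · refine (reachable_spanningCoe hT.connected hα.1 hv).mono ?_
    intro a b hab
    have : s(a, b) ∈ selectionEdges I full half := mem_selectionEdges.2 (.inl ⟨i, hi, hab⟩)
    exact this
  · rw [hbb] at he
    have hvp : v ∈ p.support := p.mem_support_of_mem_edges he hv
    exact ⟨(p.takeUntil v hvp).transfer _ fun e he =>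
      hadj hi e (p.edges_takeUntil_subset_edges hvp he)⟩

theorem selection_connected (hT : ∀ i, (I.tree i).coe.IsTree)
    (hU : ∀ i, (I.tree i).verts ∩ core I.y = {α i, β i}) (hne : ∀ i, α i ≠ β i)
    (hcore : (core I.y).Nonempty)
    (hcut : ∀ S ⊂ core I.y, S.Nonempty → ∃ i, (i ∈ full ∨ i ∈ half) ∧ ¬ (α i ∈ S ↔ β i ∈ S)) :
    (selection I full half).toSubgraph.Connected := by
  classical
  obtain ⟨r, hr⟩ := hcore
  set H := selection I full half with hH
  have hαc : ∀ i, α i ∈ core I.y := fun i => (show α i ∈ (I.tree i).verts ∩ core I.y by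
    rw [hU]; simp).2
  have hβc : ∀ i, β i ∈ core I.y := fun i => (show β i ∈ (I.tree i).verts ∩ core I.y by
    rw [hU]; simp).2
  have h1 : ∀ v ∈ core I.y, H.toSubgraph.spanningCoe.Reachable r v := by
    by_contra hcon
    push Not at hcon
    obtain ⟨w, hw, hrw⟩ := hcon
    -- A selected anchor edge would leave the set of core vertices reachable from `r`, but its
    -- endpoints are joined by a backbone.
    obtain ⟨i, hi, hi'⟩ := hcut {v | v ∈ core I.y ∧ H.toSubgraph.spanningCoe.Reachable r v}
      ⟨fun v hv => hv.1, fun h => hrw (h hw).2⟩ ⟨r, hr, .rfl⟩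
    have h2 := (selection_reachable (hT i) (hU i) (hne i)).2.2 hi
    exact hi' ⟨fun h => ⟨hβc i, h.2.trans h2⟩, fun h => ⟨hαc i, h.2.trans h2.symm⟩⟩
  have h2 : ∀ v ∈ H.verts, H.toSubgraph.spanningCoe.Reachable r v := by
    intro v hv
    rw [hH, mem_selection_verts] at hv
    rcases hv with hv | ⟨i, hi, hv⟩ | ⟨i, hi, e, he, hv⟩
    · exact h1 v hv
    · exact (h1 _ (hαc i)).trans ((selection_reachable (hT i) (hU i) (hne i)).1 hi v hv)
    · exact (h1 _ (hαc i)).trans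
        ((selection_reachable (hT i) (hU i) (hne i)).2.1 (.inr hi) e he v hv)
  have hrH : r ∈ H.toSubgraph.verts := by
    have : r ∈ H.verts := by
      rw [hH, mem_selection_verts]
      exact .inl hr
    exact this
  rw [SimpleGraph.Subgraph.connected_iff]
  refine ⟨?_, ⟨r, hrH⟩⟩
  rw [SimpleGraph.Subgraph.preconnected_iff]
  have h3 : ∀ v : H.toSubgraph.verts, H.toSubgraph.coe.Reachable ⟨r, hrH⟩ v := by
    intro v
    obtain ⟨p⟩ := h2 v v.2
    obtain ⟨_, q, _⟩ := exists_walk_coe p hrH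
    exact ⟨q⟩
  exact fun u v => (h3 u).symm.trans (h3 v)

/-- The backbone is the edge set of a path whose endpoints lie in the core, so `v` is an inner
vertex of the path or not on it. -/
theorem even_countP_backbone {i : ι} [DecidableEq V] (hT : (I.tree i).coe.IsTree)
    (hU : (I.tree i).verts ∩ core I.y = {α i, β i}) (hne : α i ≠ β i) {v : V} (hv : v ∉ core I.y) :
    Even ((edgeFinset (backbone (core I.y) (I.tree i))).val.countP fun e => v ∈ e) := by
  obtain ⟨p, hp, hbb⟩ := backbone_eq hT hU hne
  have hα : α i ∈ (I.tree i).verts ∩ core I.y := by rw [hU]; simp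
  have hβ : β i ∈ (I.tree i).verts ∩ core I.y := by rw [hU]; simp
  have h1 : (edgeFinset (backbone (core I.y) (I.tree i))).val = (p.edges : Multiset (Sym2 V)) := by
    refine (Multiset.Nodup.ext (Finset.nodup _) (Multiset.coe_nodup.2 hp.isTrail.edges_nodup)).2
      fun e => ?_
    rw [Finset.mem_val, mem_edgeFinset, hbb]
    rfl
  rw [h1, Multiset.coe_countP, hp.isTrail.even_countP_edges_iff]
  exact fun _ => ⟨fun h => hv (h ▸ hα.2), fun h => hv (h ▸ hβ.2)⟩

theorem selection_even_degree (hT : ∀ i, (I.tree i).coe.IsTree)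
    (hU : ∀ i, (I.tree i).verts ∩ core I.y = {α i, β i}) (hne : ∀ i, α i ≠ β i) {v : V}
    (hv : v ∉ core I.y) : Even ((selection I full half).degree v) := by
  classical
  have h1 : (selection I full half).degree v =
      Multiset.countPAddMonoidHom (fun e => v ∈ e) (selectionEdges I full half) := by
    unfold Multigraph.degree
    simp only [Multiset.coe_countPAddMonoidHom]
    convert rfl
    rfl
  rw [h1, selectionEdges, map_add, map_sum, map_sum]
  refine Even.add (Finset.even_sum _ fun i _ => ?_) (Finset.even_sum _ fun i _ => ?_)
  · rw [map_add, map_nsmul]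
    exact (even_countP_backbone (hT i) (hU i) (hne i) hv).add (by simp)
  · exact even_countP_backbone (hT i) (hU i) (hne i) hv

theorem selection_length (c : Sym2 V → ℝ) : (selection I full half).length c =
    ∑ i ∈ full, (total c (backbone (core I.y) (I.tree i)) +
      2 * total c (limbs (core I.y) (I.tree i))) +
    ∑ i ∈ half, total c (backbone (core I.y) (I.tree i)) := by
  have h : ∀ m : Multiset (Sym2 V), (m.map c).sum =
      ((Multiset.sumAddMonoidHom (M := ℝ)).comp (Multiset.mapAddMonoidHom c)) m := fun m => rfl
  change ((selectionEdges I full half).map c).sum = _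
  rw [h, selectionEdges, map_add, map_sum, map_sum]
  simp only [total_eq_sum_edgeFinset, h, map_add, map_nsmul]
  simp

end Selection

/-! ### Rounding the decomposition -/

section Rounding

open Finset

theorem crosses_pair {V : Type*} {u w : V} (huw : u ≠ w) (S : Set V) :
    Crosses {u, w} S ↔ ¬ (u ∈ S ↔ w ∈ S) := by
  unfold Crosses
  by_cases hu : u ∈ S <;> by_cases hw : w ∈ S
  · have h1 : ({u, w} : Set V) \ S = ∅ := by
      ext v; simp only [Set.mem_sdiff, Set.mem_insert_iff, Set.mem_singleton_iff,
        Set.mem_empty_iff_false, iff_false]; rintro ⟨rfl | rfl, h⟩ <;> contradiction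
    simp [h1, hu, hw]
  · have h1 : ({u, w} : Set V) ∩ S = {u} := by
      ext v; simp only [Set.mem_inter_iff, Set.mem_insert_iff, Set.mem_singleton_iff]
      constructor
      · rintro ⟨rfl | rfl, h⟩ <;> trivial
      · rintro rfl; exact ⟨.inl rfl, hu⟩
    have h2 : ({u, w} : Set V) \ S = {w} := by
      ext v; simp only [Set.mem_sdiff, Set.mem_insert_iff, Set.mem_singleton_iff]
      constructor
      · rintro ⟨rfl | rfl, h⟩ <;> trivial
      · rintro rfl; exact ⟨.inr rfl, hw⟩
    simp [h1, h2, hu, hw]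
  · have h1 : ({u, w} : Set V) ∩ S = {w} := by
      ext v; simp only [Set.mem_inter_iff, Set.mem_insert_iff, Set.mem_singleton_iff]
      constructor
      · rintro ⟨rfl | rfl, h⟩ <;> trivial
      · rintro rfl; exact ⟨.inr rfl, hw⟩
    have h2 : ({u, w} : Set V) \ S = {u} := by
      ext v; simp only [Set.mem_sdiff, Set.mem_insert_iff, Set.mem_singleton_iff]
      constructor
      · rintro ⟨rfl | rfl, h⟩ <;> trivial
      · rintro rfl; exact ⟨.inl rfl, hu⟩
    simp [h1, h2, hu, hw]
  · have h1 : ({u, w} : Set V) ∩ S = ∅ := by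
      ext v; simp only [Set.mem_inter_iff, Set.mem_insert_iff, Set.mem_singleton_iff,
        Set.mem_empty_iff_false, iff_false]; rintro ⟨rfl | rfl, h⟩ <;> contradiction
    simp [h1, hu, hw]

variable {V ι : Type*} [DecidableEq V]

/-- The degree constraints relate the value of the induced edges to the value of the cut. -/
theorem two_mul_mass_add_cut {κ : Type*} [Fintype κ] {A B : κ → V} (hAB : ∀ k, A k ≠ B k)
    {z : κ → ℝ} {S : Finset V}
    (hdeg : ∀ v ∈ S, (∑ k, if ¬ (A k = v ↔ B k = v) then z k else 0) = 2) :
    2 * mass A B z S + (∑ k, if ¬ (A k ∈ S ↔ B k ∈ S) then z k else 0) = 2 * #S := by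
  have h1 : ∑ v ∈ S, (∑ k, if ¬ (A k = v ↔ B k = v) then z k else 0) = 2 * #S := by
    rw [Finset.sum_congr rfl hdeg, Finset.sum_const, nsmul_eq_mul, mul_comm]
  rw [← h1, Finset.sum_comm, mass, Finset.sum_filter, Finset.mul_sum, ← Finset.sum_add_distrib]
  refine Finset.sum_congr rfl fun k _ => ?_
  have h2 : ∀ v, (if ¬ (A k = v ↔ B k = v) then z k else 0) =
      (if A k = v then z k else 0) + (if B k = v then z k else 0) := by
    intro v
    have := hAB k
    by_cases h3 : A k = v <;> by_cases h4 : B k = v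
    · exact absurd (h3.trans h4.symm) this
    all_goals simp [h3, h4]
  simp only [h2, Finset.sum_add_distrib, Finset.sum_ite_eq]
  by_cases h3 : A k ∈ S <;> by_cases h4 : B k ∈ S <;> simp [h3, h4]
  ring

variable [Fintype V] [Fintype ι] (I : Input V ι ℝ)

/-- The weights of the two copies of a tree: the first one stands for the tree with doubled limbs,
the second one for the backbone alone. -/
noncomputable def copyWeight (e : ι × Bool) : ℝ :=
  if e.2 then 3 / 4 * I.weight e.1 else 1 / 4 * I.weight e.1

/-- The lengths of the two copies of a tree. -/
noncomputable def copyLength (e : ι × Bool) : ℝ :=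
  total I.length (backbone (core I.y) (I.tree e.1)) +
    if e.2 then 2 * total I.length (limbs (core I.y) (I.tree e.1)) else 0

open Classical in
/-- Only the first copy of a tree covers its vertices. -/
noncomputable def copyCovers (e : ι × Bool) (v : V) : Bool := e.2 && decide (v ∈ (I.tree e.1).verts)

open Classical in
/-- The penalties of the vertices outside of the core. -/
noncomputable def outerPenalty (v : V) : ℝ := if v ∈ core I.y then 0 else I.penalty v

variable {I} {α β : ι → V} {C : Finset V}

/-- Summing degrees gives `2 z(E[S]) + z(δ(S)) = 2 |S|`, so cuts of value at least 2 bound the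
induced edges by `|S| - 1`. The core has no cut and induces `|C|`, and the unit of `e₀` accounts for
the missing 1. The two copies together carry the weight of the tree. -/
theorem copyWeight_mem (hI : I.Valid) (hU : ∀ i, (I.tree i).verts ∩ core I.y = {α i, β i})
    (hne : ∀ i, α i ≠ β i) (hC : ∀ v, v ∈ C ↔ v ∈ core I.y) :
    InTreePolytope C (fun e : ι × Bool => α e.1) (fun e => β e.1) 1 (copyWeight I) := by
  classical
  obtain ⟨he₀, hmem, -⟩ := hI.isCoreEdge
  have hK := hI.isDecomposition.heldKarp
  have hw := fun i => (hI.isDecomposition.weight_mem i).1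
  have hαC : ∀ i, α i ∈ C := fun i => (hC _).2 (show α i ∈ (I.tree i).verts ∩ core I.y by
    rw [hU]; simp).2
  have hβC : ∀ i, β i ∈ C := fun i => (hC _).2 (show β i ∈ (I.tree i).verts ∩ core I.y by
    rw [hU]; simp).2
  obtain ⟨u₀, w₀, he⟩ : ∃ u₀ w₀, I.e₀ = s(u₀, w₀) := by
    induction I.e₀ using Sym2.ind with
    | _ u w => exact ⟨u, w, rfl⟩
  rw [he] at he₀ hmem hK
  have hne₀ : u₀ ≠ w₀ := by simpa using he₀
  have hu₀ : u₀ ∈ C := (hC _).2 (hmem _ (by simp))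
  have hw₀ : w₀ ∈ C := (hC _).2 (hmem _ (by simp))
  let A : Option ι → V := fun k => k.elim u₀ α
  let B : Option ι → V := fun k => k.elim w₀ β
  let z : Option ι → ℝ := fun k => k.elim 1 I.weight
  have hAB : ∀ k, A k ≠ B k := by
    rintro (_ | i)
    · exact hne₀
    · exact hne i
  have hset : ∀ k : Option ι, k.elim ((s(u₀, w₀) : Sym2 V) : Set V)
      (fun i => (I.tree i).verts ∩ core I.y) = {A k, B k} := by
    rintro (_ | i)
    · ext v; simp [A, B]
    · exact hU i
  have hcross : ∀ (S : Set V) (P : Option ι → Prop) [DecidablePred P],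
      (∀ k, P k ↔ ¬ (A k ∈ S ↔ B k ∈ S)) →
      total z {k | Crosses (k.elim ((s(u₀, w₀) : Sym2 V) : Set V)
        (fun i => (I.tree i).verts ∩ core I.y)) S} = ∑ k, if P k then z k else 0 := by
    intro S P _ hP
    rw [total_eq_sum]
    refine Finset.sum_congr rfl fun k _ => ?_
    exact if_congr (by rw [Set.mem_ofPred_eq, hset, crosses_pair (hAB k), hP]) rfl rfl
  have hdeg : ∀ v ∈ C, (∑ k, if ¬ (A k = v ↔ B k = v) then z k else 0) = 2 := by
    intro v hv
    rw [← hK.degree v ((hC v).1 hv)]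
    exact (hcross {v} _ fun k => Iff.rfl).symm
  have hcopy : ∀ S, mass A B z S = mass (fun e : ι × Bool => α e.1) (fun e => β e.1)
      (copyWeight I) S + if u₀ ∈ S ∧ w₀ ∈ S then 1 else 0 := by
    intro S
    rw [mass, mass, Finset.sum_filter, Finset.sum_filter, Fintype.sum_option,
      Fintype.sum_prod_type, add_comm]
    congr 1
    refine Finset.sum_congr rfl fun i _ => ?_
    rw [Fintype.sum_bool]
    by_cases h : α i ∈ S ∧ β i ∈ S
    · refine (if_pos h).trans ?_
      rw [if_pos h, if_pos h]
      simp only [copyWeight, z, Option.elim_some, if_true, Bool.false_eq_true, if_false]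
      ring
    · refine (if_neg h).trans ?_
      rw [if_neg h, if_neg h, add_zero]
  have hcore : mass (fun e : ι × Bool => α e.1) (fun e => β e.1) (copyWeight I) C = #C - 1 := by
    have h1 := two_mul_mass_add_cut hAB hdeg
    have hAC : ∀ k, A k ∈ C := by rintro (_ | i); exacts [hu₀, hαC i]
    have hBC : ∀ k, B k ∈ C := by rintro (_ | i); exacts [hw₀, hβC i]
    simp only [hAC, hBC, not_true, if_false, Finset.sum_const_zero, add_zero] at h1
    rw [hcopy, if_pos ⟨hu₀, hw₀⟩] at h1
    linarith
  refine ⟨?_, ?_, ?_⟩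
  · intro e
    have := hw e.1
    unfold copyWeight
    split <;> positivity
  · rw [one_mul, ← hcore, mass, Finset.filter_true_of_mem fun e _ => ⟨hαC e.1, hβC e.1⟩]
  · intro S hSC hS
    rw [one_mul]
    rcases eq_or_ssubset_of_subset hSC with rfl | hlt
    · exact hcore.le
    · have h1 := two_mul_mass_add_cut hAB (fun v hv => hdeg v (hSC hv))
      have h2 := hK.connectivity (S : Set V) ?_ (by simpa using hS)
      · have h3 : (2 : ℝ) ≤ ∑ k, if ¬ (A k ∈ S ↔ B k ∈ S) then z k else 0 := by
          exact h2.trans (le_of_eq (hcross (S : Set V) _ fun k => Iff.rfl))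
        rw [hcopy] at h1
        have : (0 : ℝ) ≤ if u₀ ∈ S ∧ w₀ ∈ S then 1 else 0 := by split <;> norm_num
        linarith
      · have : core I.y = (C : Set V) := by ext v; rw [Finset.mem_coe, hC]
        rw [this]
        exact_mod_cast hlt

theorem prod_copyCovers (x : ι × Bool → ℝ) (v : V) [DecidablePred fun i => v ∈ (I.tree i).verts] :
    ∏ e, (if copyCovers I e v then 1 - x e else 1) =
      ∏ i, (if v ∈ (I.tree i).verts then 1 - x (i, true) else 1) := by
  rw [Fintype.prod_prod_type]
  refine Finset.prod_congr rfl fun i _ => ?_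
  simp [copyCovers]

/-- The linear parts agree because of the weights 3/4 and 1/4. In the penalty part `1 - t ≤ exp
(-t)` is applied to each factor, and the exponents add up by the condition that the trees containing
`v` have total weight `y v`. -/
theorem objective_copyWeight_le (hI : I.Valid) :
    objective (copyLength I) (outerPenalty I) (copyCovers I) 1 (copyWeight I) ≤
      ∑ᶠ i, I.weight i * (total I.length (backbone (core I.y) (I.tree i)) +
        3 / 2 * total I.length (limbs (core I.y) (I.tree i))) +
      total (fun v => I.penalty v * Real.exp (-(3 * I.y v / 4))) {v | v ∉ core I.y} := by
  classical
  have hw := hI.isDecomposition.weight_mem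
  unfold objective
  refine add_le_add (le_of_eq ?_) ?_
  · rw [finsum_eq_sum_of_fintype, Fintype.sum_prod_type]
    refine Finset.sum_congr rfl fun i _ => ?_
    simp only [Fintype.sum_bool, copyLength, copyWeight, if_true, Bool.false_eq_true, if_false]
    ring
  · rw [total_eq_sum]
    refine Finset.sum_le_sum fun v _ => ?_
    simp only [Set.mem_ofPred_eq, outerPenalty]
    by_cases hv : v ∈ core I.y
    · simp [hv]
    · simp only [hv, if_false, not_false_eq_true, if_true]
      refine mul_le_mul_of_nonneg_left ?_ (hI.isInstance.penalty_nonneg v)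
      rw [prod_copyCovers]
      have h1 := hI.isDecomposition.vertices v hv
      rw [total_eq_sum] at h1
      calc _ ≤ ∏ i, Real.exp (-(3 / 4 * if i ∈ {i | v ∈ (I.tree i).verts} then I.weight i
              else 0)) := by
            refine Finset.prod_le_prod (fun i _ => ?_) fun i _ => ?_
            · have := hw i
              simp only [copyWeight, if_true]
              split
              · have := this.2; linarith
              · norm_num
            · simp only [copyWeight, if_true, Set.mem_ofPred_eq]
              split
              · have := Real.add_one_le_exp (-(3 / 4 * I.weight i))
                linarith
              · simp
        _ = _ := by
            rw [← Real.exp_sum, Finset.sum_neg_distrib, ← Finset.mul_sum, h1]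
            congr 1
            ring

/-- An integral point of the spanning tree polytope yields a multigraph. -/
theorem good_selection (hI : I.Valid) (hU : ∀ i, (I.tree i).verts ∩ core I.y = {α i, β i})
    (hne : ∀ i, α i ≠ β i) (hC : ∀ v, v ∈ C ↔ v ∈ core I.y) {x : ι × Bool → ℝ}
    (hx : InTreePolytope C (fun e : ι × Bool => α e.1) (fun e => β e.1) 1 x)
    (hx01 : ∀ e, x e = 0 ∨ x e = 1)
    (hobj : objective (copyLength I) (outerPenalty I) (copyCovers I) 1 x ≤
      objective (copyLength I) (outerPenalty I) (copyCovers I) 1 (copyWeight I))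
    {full half : Finset ι} (hfull : ∀ i, i ∈ full ↔ x (i, true) = 1)
    (hhalf : ∀ i, i ∈ half ↔ x (i, false) = 1) : I.Good (selection I full half) := by
  classical
  have hT := hI.isDecomposition.isTree
  have hαC : ∀ i, α i ∈ C := fun i => (hC _).2 (show α i ∈ (I.tree i).verts ∩ core I.y by
    rw [hU]; simp).2
  have hβC : ∀ i, β i ∈ C := fun i => (hC _).2 (show β i ∈ (I.tree i).verts ∩ core I.y by
    rw [hU]; simp).2
  have hxf : ∀ i, x (i, true) = if i ∈ full then 1 else 0 := by
    intro i
    rw [if_congr (hfull i) rfl rfl]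
    rcases hx01 (i, true) with h | h <;> simp [h]
  have hxh : ∀ i, x (i, false) = if i ∈ half then 1 else 0 := by
    intro i
    rw [if_congr (hhalf i) rfl rfl]
    rcases hx01 (i, false) with h | h <;> simp [h]
  refine ⟨selection_connected hT hU hne ?_ ?_, ?_, fun v hv => selection_even_degree hT hU hne hv,
    le_trans ?_ (hobj.trans (objective_copyWeight_le hI))⟩
  · have := hI.isCoreEdge.mem_core
    induction h : I.e₀ using Sym2.ind with
    | _ u w => exact ⟨u, this u (by simp [h])⟩
  · intro S hS hS0
    have hSC : (Set.toFinite S).toFinset ⊆ C := fun v hv => (hC v).2 (hS.1 (by simpa using hv))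
    have hSne : (Set.toFinite S).toFinset ≠ C := by
      rintro rfl
      refine hS.2 fun v hv => ?_
      simpa using (hC v).2 hv
    -- The support of the integral point crosses every cut of the core, and its elements are the
    -- selected copies.
    obtain ⟨e, he, he'⟩ := hx.exists_crossing one_pos
      (fun e => hαC e.1) (fun e => hβC e.1) hSC (by simpa using hS0) hSne
    refine ⟨e.1, ?_, by simpa using he'⟩
    rw [hfull, hhalf]
    obtain ⟨i, b⟩ := e
    cases b
    · exact .inr ((hx01 _).resolve_left he)
    · exact .inl ((hx01 _).resolve_left he)
  · intro v hv
    rw [mem_selection_verts]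
    exact .inl hv
  · unfold objective
    refine add_le_add (le_of_eq ?_) ?_
    · rw [selection_length, Fintype.sum_prod_type]
      simp only [Fintype.sum_bool, Finset.sum_add_distrib, hxf, hxh, copyLength, if_true,
        Bool.false_eq_true, if_false, mul_ite, mul_one, mul_zero, Finset.sum_ite_mem,
        Finset.univ_inter, add_zero]
    · rw [total_eq_sum]
      refine Finset.sum_le_sum fun v _ => ?_
      rw [prod_copyCovers]
      simp only [Set.mem_ofPred_eq]
      have hpos : 0 ≤ outerPenalty I v := by
        unfold outerPenalty
        split
        · exact le_rfl
        · exact hI.isInstance.penalty_nonneg v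
      -- A vertex that is missing has all factors equal to 1, so the objective charges its full
      -- penalty. For a visited vertex the term only has to be nonnegative; it may be positive if
      -- the vertex lies on selected half copies only.
      by_cases hv : v ∈ (selection I full half).verts
      · rw [if_neg (not_not.2 hv)]
        refine mul_nonneg hpos (Finset.prod_nonneg fun i _ => ?_)
        rcases hx01 (i, true) with h | h <;> simp only [h] <;> split <;> norm_num
      · rw [if_pos hv]
        rw [mem_selection_verts] at hv
        simp only [selectionVerts, Set.mem_ofPred_eq, not_or, not_exists, not_and] at hv
        rw [Finset.prod_eq_one, outerPenalty, if_neg hv.1, mul_one]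
        intro i _
        split
        · rename_i hvi
          have : i ∉ full := fun hi => hv.2.1 i hi hvi
          rw [hxf, if_neg this, sub_zero]
        · rfl

theorem exists_anchors (hI : I.Valid) : ∃ α β : ι → V,
    (∀ i, (I.tree i).verts ∩ core I.y = {α i, β i}) ∧ ∀ i, α i ≠ β i := by
  choose α β h using fun i => Set.ncard_eq_two.1 (hI.isDecomposition.anchors i)
  exact ⟨α, β, fun i => (h i).2, fun i => (h i).1⟩

theorem outerPenalty_nonneg (hI : I.Valid) (v : V) : 0 ≤ outerPenalty I v := by
  unfold outerPenalty
  split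
  · exact le_rfl
  · exact hI.isInstance.penalty_nonneg v

theorem exists_good (hI : I.Valid) : ∃ H, I.Good H := by
  classical
  obtain ⟨α, β, hU, hne⟩ := exists_anchors hI
  let C : Finset V := (Set.toFinite (core I.y)).toFinset
  have hC : ∀ v, v ∈ C ↔ v ∈ core I.y := fun v => by simp [C]
  have hαC : ∀ i, α i ∈ C := fun i => (hC _).2 (show α i ∈ (I.tree i).verts ∩ core I.y by
    rw [hU]; simp).2
  have hβC : ∀ i, β i ∈ C := fun i => (hC _).2 (show β i ∈ (I.tree i).verts ∩ core I.y by
    rw [hU]; simp).2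
  obtain ⟨x, h1, h2, h3⟩ := (copyWeight_mem hI hU hne hC).exists_integral (copyLength I)
    (outerPenalty_nonneg hI) (copyCovers I) zero_le_one (fun e => hαC e.1) (fun e => hβC e.1)
    (fun e => hne e.1)
  exact ⟨_, good_selection hI hU hne hC h1 h3 h2
    (full := Finset.univ.filter fun i => x (i, true) = 1)
    (half := Finset.univ.filter fun i => x (i, false) = 1) (by simp) (by simp)⟩

end Rounding

/-! ### The algorithm -/

section Programs

variable {γ : Type} [Enc γ]

@[fun_prop]
theorem PT.transfer {M X p Δ : γ → ℤ} (hM : PT M) (hX : PT X) (hp : PT p) (hΔ : PT Δ) :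
    PT fun x => transfer (M x) (X x) (p x) (Δ x) := by
  unfold PCTSP.transfer
  fun_prop

/-- The excess of the vertex `v`, given the list of all edges with their endpoints, their weight,
and their contribution to the first endpoint. -/
def excessProg (D r : ℤ) (st : List (ℤ × ℤ × ℤ × ℤ)) (v : ℤ) : ℤ :=
  (st.map fun s => (if s.1 = v then s.2.2.2 else 0) +
    (if s.2.1 = v then s.2.2.1 - s.2.2.2 else 0)).sum - (if v = r then 0 else D)

@[fun_prop]
theorem PT.excessProg {D r v : γ → ℤ} {st : γ → List (ℤ × ℤ × ℤ × ℤ)} (hD : PT D) (hr : PT r)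
    (hst : PT st) (hv : PT v) : PT fun x => excessProg (D x) (r x) (st x) (v x) := by
  unfold PCTSP.excessProg
  fun_prop

/-- One round of load balancing. -/
def balanceProg (M D r : ℤ) (st : List (ℤ × ℤ × ℤ × ℤ)) : List (ℤ × ℤ × ℤ × ℤ) :=
  st.map fun s => (s.1, s.2.1, s.2.2.1, max 0 (min s.2.2.1 (s.2.2.2 -
    transfer M s.2.2.1 s.2.2.2 (excessProg D r st s.1 - excessProg D r st s.2.1))))

@[fun_prop]
theorem PT.balanceProg {M D r : γ → ℤ} {st : γ → List (ℤ × ℤ × ℤ × ℤ)} (hM : PT M) (hD : PT D)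
    (hr : PT r) (hst : PT st) : PT fun x => balanceProg (M x) (D x) (r x) (st x) := by
  unfold PCTSP.balanceProg
  fun_prop

theorem esize_le_of_natAbs_le {a b : ℤ} (h : a.natAbs ≤ b.natAbs) : esize a ≤ esize b := by
  rw [esize_int, esize_int]
  have := Nat.size_le_size h
  omega

theorem esize_le_of_forall₂ {α : Type} [Enc α] {l l' : List α} {B : ℕ}
    (h : List.Forall₂ (fun a a' => esize a' ≤ esize a + B) l l') :
    esize l' ≤ esize l + l.length * B := by
  induction h with
  | nil => simp
  | cons h _ ih =>
    rw [esize_cons, esize_cons, List.length_cons, add_mul]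
    omega

theorem forall₂_imp_of_mem {α β : Type*} {R S : α → β → Prop} {l : List α} {l' : List β}
    (H : List.Forall₂ R l l') (h : ∀ a b, a ∈ l → b ∈ l' → R a b → S a b) :
    List.Forall₂ S l l' := by
  induction H with
  | nil => exact .nil
  | cons hab _ ih =>
    exact .cons (h _ _ (by simp) (by simp) hab) (ih fun a b ha hb =>
      h a b (List.mem_cons_of_mem _ ha) (List.mem_cons_of_mem _ hb))

/-- A number of rounds of load balancing, given by the length of a list. -/
def balanceRounds (M D r : ℤ) (fuel : List ℤ) (st : List (ℤ × ℤ × ℤ × ℤ)) :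
    List (ℤ × ℤ × ℤ × ℤ) :=
  fuel.foldl (fun st _ => balanceProg M D r st) st

-- Only the contributions change from round to round, and after clamping their absolute value is
-- bounded by that of the edge weight. This bounds the state for arbitrary parameters, as `PT`
-- speaks of all inputs.
@[fun_prop]
theorem PT.balanceRounds {M D r : γ → ℤ} {fuel : γ → List ℤ} {st : γ → List (ℤ × ℤ × ℤ × ℤ)}
    (hM : PT M) (hD : PT D) (hr : PT r) (hf : PT fuel) (hst : PT st) :
    PT fun x => balanceRounds (M x) (D x) (r x) (fuel x) (st x) := by
  obtain ⟨q, hq⟩ := hst.size_bound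
  unfold PCTSP.balanceRounds
  refine foldl (step := fun x st (_ : ℤ) => PCTSP.balanceProg (M x) (D x) (r x) st) hf hst
    (by fun_prop) (q + q * q) fun x l₁ l₂ hl => ?_
  clear hl
  have h1 : List.Forall₂ (fun s s' : ℤ × ℤ × ℤ × ℤ => s'.1 = s.1 ∧ s'.2.1 = s.2.1 ∧
      s'.2.2.1 = s.2.2.1 ∧ (s'.2.2.2 = s.2.2.2 ∨ s'.2.2.2.natAbs ≤ s.2.2.1.natAbs)) (st x)
      (l₁.foldl (fun st _ => PCTSP.balanceProg (M x) (D x) (r x) st) (st x)) := by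
    induction l₁ using List.reverseRecOn with
    | nil => exact List.forall₂_same.2 fun s _ => ⟨rfl, rfl, rfl, .inl rfl⟩
    | append_singleton l a ih =>
      rw [List.foldl_append, List.foldl_cons, List.foldl_nil, PCTSP.balanceProg,
        List.forall₂_map_right_iff]
      refine ih.imp fun s s' h => ⟨h.1, h.2.1, h.2.2.1, .inr ?_⟩
      rw [h.2.2.1]
      dsimp only
      omega
  have h2 := esize_le_of_forall₂ (B := esize (st x)) (forall₂_imp_of_mem h1 (fun s s' hs _ h => ?_) :
    List.Forall₂ (fun s s' => esize s' ≤ esize s + esize (st x)) _ _)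
  · have h3 := hq x
    have h4 := length_lt_esize (st x)
    have h5 : (st x).length * esize (st x) ≤ q.eval (esize x) * q.eval (esize x) :=
      Nat.mul_le_mul (by omega) h3
    simp only [Polynomial.eval_add, Polynomial.eval_mul]
    omega
  · have h3 := esize_le_of_mem hs
    have h4 : esize s' ≤ esize s + esize s := by
      rw [esize_prod s', esize_prod s'.2, esize_prod s'.2.2, esize_prod s, esize_prod s.2,
        esize_prod s.2.2, h.1, h.2.1, h.2.2.1]
      rcases h.2.2.2 with h | h
      · rw [h]; omega
      · have := esize_le_of_natAbs_le h
        omega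
    omega

/-- A list whose length is the square of the length of `l`. -/
def squareList (l : List ℤ) : List ℤ := l.flatMap fun _ => l

@[fun_prop]
theorem PT.squareList {l : γ → List ℤ} (hl : PT l) : PT fun x => squareList (l x) := by
  unfold PCTSP.squareList
  fun_prop

theorem length_squareList (l : List ℤ) : (squareList l).length = l.length * l.length := by
  simp [squareList]

/-- A list whose length is a sufficient number of rounds of load balancing. -/
def roundList (u : List ℤ) (z : ℤ) : List ℤ :=
  (powers z).flatMap fun _ => squareList (squareList (squareList u))

@[fun_prop]
theorem PT.roundList {u : γ → List ℤ} {z : γ → ℤ} (hu : PT u) (hz : PT z) :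
    PT fun x => roundList (u x) (z x) := by
  unfold PCTSP.roundList
  fun_prop

/-- The elements of the ground set: number, endpoints, length, list of covered vertices, value. -/
abbrev Elem := ℤ × ℤ × ℤ × ℤ × List ℤ × ℤ

/-- The membership test with all parameters. -/
def testProg (core : List ℤ) (D : ℤ) (els : List Elem) (M F : ℤ) (fuel : List ℤ) : Prop :=
  (∀ e ∈ els, 0 ≤ e.2.2.2.2.2 ∧ e.2.2.2.2.2 ≤ D) ∧ ∀ r ∈ core, ∀ v ∈ core,
    M * excessProg (F * D) r (balanceRounds M (F * D) r fuel
      (els.map fun e => (e.2.1, e.2.2.1, F * e.2.2.2.2.2, F * e.2.2.2.2.2))) v < F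

instance (core : List ℤ) (D : ℤ) (els : List Elem) (M F : ℤ) (fuel : List ℤ) :
    Decidable (testProg core D els M F fuel) := by
  unfold testProg; infer_instance

@[fun_prop]
theorem PT.testProg {core : γ → List ℤ} {D : γ → ℤ} {els : γ → List Elem} {M F : γ → ℤ}
    {fuel : γ → List ℤ} (hc : PT core) (hD : PT D) (he : PT els) (hM : PT M) (hF : PT F)
    (hf : PT fuel) : PT fun x => decide (testProg (core x) (D x) (els x) (M x) (F x) (fuel x)) := by
  have : PT fun x => decide ((∀ e ∈ els x, 0 ≤ e.2.2.2.2.2 ∧ e.2.2.2.2.2 ≤ D x) ∧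
    ∀ r ∈ core x, ∀ v ∈ core x,
    M x * PCTSP.excessProg (F x * D x) r (PCTSP.balanceRounds (M x) (F x * D x) r (fuel x)
      ((els x).map fun e => (e.2.1, e.2.2.1, F x * e.2.2.2.2.2, F x * e.2.2.2.2.2))) v < F x) := by
    fun_prop
  simpa only [PCTSP.testProg] using this

/-- A list that is longer than the list of the elements and the list of the core vertices. -/
def sizeList (core : List ℤ) (els : List Elem) : List ℤ :=
  els.map (fun e => e.1) ++ core ++ List.replicate 64 0

@[fun_prop]
theorem PT.sizeList {core : γ → List ℤ} {els : γ → List Elem} (hc : PT core) (he : PT els) :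
    PT fun x => sizeList (core x) (els x) := by
  unfold PCTSP.sizeList
  fun_prop

/-- The membership test for the spanning tree polytope. -/
def memProg (core : List ℤ) (D : ℤ) (els : List Elem) : Prop :=
  testProg core D els (sizeList core els).length (4 * ((sizeList core els).length *
    ((sizeList core els).length * (sizeList core els).length)) + 1)
    (roundList (sizeList core els) ((sizeList core els).length *
      (((4 * ((sizeList core els).length *
        ((sizeList core els).length * (sizeList core els).length)) + 1) * D *
          (sizeList core els).length) * ((4 * ((sizeList core els).length *
        ((sizeList core els).length * (sizeList core els).length)) + 1) * D *
          (sizeList core els).length))))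

instance (core : List ℤ) (D : ℤ) (els : List Elem) : Decidable (memProg core D els) := by
  unfold memProg; infer_instance

@[fun_prop]
theorem PT.memProg {core : γ → List ℤ} {D : γ → ℤ} {els : γ → List Elem} (hc : PT core) (hD : PT D)
    (he : PT els) : PT fun x => decide (memProg (core x) (D x) (els x)) := by
  have : PT fun x => (((PCTSP.sizeList (core x) (els x)).length : ℕ) : ℤ) := by fun_prop
  unfold PCTSP.memProg
  fun_prop

/-- Move `t` units from the element number `j` to the element number `i`. -/
def shiftProg (els : List Elem) (i j t : ℤ) : List Elem :=
  els.map fun e => (e.1, e.2.1, e.2.2.1, e.2.2.2.1, e.2.2.2.2.1, e.2.2.2.2.2 +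
    t * ((if e.1 = i then 1 else 0) - (if e.1 = j then 1 else 0)))

@[fun_prop]
theorem PT.shiftProg {els : γ → List Elem} {i j t : γ → ℤ} (he : PT els) (hi : PT i) (hj : PT j)
    (ht : PT t) : PT fun x => shiftProg (els x) (i x) (j x) (t x) := by
  unfold PCTSP.shiftProg
  fun_prop

/-- The objective function, given the list of the vertices with their penalties. -/
def objectiveProg (pen : List (ℤ × ℤ)) (D : ℤ) (els : List Elem) : ℤ :=
  (els.map fun e => e.2.2.2.1 * e.2.2.2.2.2).sum +
  (pen.map fun v => v.2 *
    (els.map fun e => if v.1 ∈ e.2.2.2.2.1 then D - e.2.2.2.2.2 else D).prod).sum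

@[fun_prop]
theorem PT.objectiveProg {pen : γ → List (ℤ × ℤ)} {D : γ → ℤ} {els : γ → List Elem} (hp : PT pen)
    (hD : PT D) (he : PT els) : PT fun x => objectiveProg (pen x) (D x) (els x) := by
  unfold PCTSP.objectiveProg
  fun_prop

/-- Move `t` units if this is feasible. -/
def tryProg (core : List ℤ) (D i j : ℤ) (els : List Elem) (t : ℤ) : List Elem :=
  if memProg core D (shiftProg els i j t) then shiftProg els i j t else els

@[fun_prop]
theorem PT.tryProg {core : γ → List ℤ} {D i j t : γ → ℤ} {els : γ → List Elem} (hc : PT core)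
    (hD : PT D) (hi : PT i) (hj : PT j) (he : PT els) (ht : PT t) :
    PT fun x => tryProg (core x) (D x) (i x) (j x) (els x) (t x) := by
  unfold PCTSP.tryProg
  fun_prop

/-- The lists differ in the values of the elements only, and the new values are at most `D`. -/
def Revalued (D : ℤ) (els els' : List Elem) : Prop :=
  List.Forall₂ (fun e e' : Elem => e'.1 = e.1 ∧ e'.2.1 = e.2.1 ∧ e'.2.2.1 = e.2.2.1 ∧
    e'.2.2.2.1 = e.2.2.2.1 ∧ e'.2.2.2.2.1 = e.2.2.2.2.1 ∧
    (e'.2.2.2.2.2 = e.2.2.2.2.2 ∨ 0 ≤ e'.2.2.2.2.2 ∧ e'.2.2.2.2.2 ≤ D)) els els'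

theorem Revalued.refl (D : ℤ) (els : List Elem) : Revalued D els els :=
  List.forall₂_same.2 fun _ _ => ⟨rfl, rfl, rfl, rfl, rfl, .inl rfl⟩

theorem Revalued.esize_le {D : ℤ} {els els' : List Elem} (h : Revalued D els els') :
    esize els' ≤ esize els + els.length * esize D := by
  refine esize_le_of_forall₂ (h.imp fun e e' h => ?_)
  rw [esize_prod e', esize_prod e'.2, esize_prod e'.2.2, esize_prod e'.2.2.2,
    esize_prod e'.2.2.2.2, esize_prod e, esize_prod e.2, esize_prod e.2.2, esize_prod e.2.2.2,
    esize_prod e.2.2.2.2, h.1, h.2.1, h.2.2.1, h.2.2.2.1, h.2.2.2.2.1]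
  rcases h.2.2.2.2.2 with h | h
  · rw [h]; omega
  · have := esize_le_of_natAbs_le (a := e'.2.2.2.2.2) (b := D) (by omega)
    omega

/-- A move is accepted only if the membership test succeeds, and this test begins with a check that
all values are between 0 and `D`. Hence the states of the rounding stay small even on meaningless
inputs. -/
theorem Revalued.tryProg {core : List ℤ} {D i j t : ℤ} {els els' : List Elem}
    (h : Revalued D els els') : Revalued D els (tryProg core D i j els' t) := by
  unfold PCTSP.tryProg
  split
  · rename_i hmem
    have h1 := hmem.1
    unfold PCTSP.shiftProg at h1 ⊢
    rw [Revalued, List.forall₂_map_right_iff]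
    refine forall₂_imp_of_mem h fun e e' _ he' h => ?_
    refine ⟨h.1, h.2.1, h.2.2.1, h.2.2.2.1, h.2.2.2.2.1, .inr ?_⟩
    exact h1 _ (List.mem_map_of_mem he')
  · exact h

/-- The move from `j` to `i` (or in the opposite direction, if `s = -1`) by the maximum amount. -/
def moveProg (core pws : List ℤ) (D i j s : ℤ) (els : List Elem) : List Elem :=
  pws.foldl (fun els t => tryProg core D i j els (s * t)) els

theorem Revalued.moveProg {core pws : List ℤ} {D i j s : ℤ} {els els' : List Elem}
    (h : Revalued D els els') : Revalued D els (moveProg core pws D i j s els') := by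
  unfold PCTSP.moveProg
  induction pws generalizing els' with
  | nil => exact h
  | cons t l ih => exact ih h.tryProg

theorem esize_revalued_le {f : γ → List Elem} {D : γ → ℤ} (hf : PT f) (hD : PT D) :
    ∃ q : Polynomial ℕ, ∀ x l, Revalued (D x) (f x) l → esize l ≤ q.eval (esize x) := by
  obtain ⟨q, hq⟩ := hf.size_bound
  obtain ⟨q', hq'⟩ := hD.size_bound
  refine ⟨q + q * q', fun x l h => h.esize_le.trans ?_⟩
  have h1 := hq x
  have h2 := length_lt_esize (f x)
  have h3 : (f x).length * esize (D x) ≤ q.eval (esize x) * q'.eval (esize x) :=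
    Nat.mul_le_mul (by omega) (hq' x)
  simp only [Polynomial.eval_add, Polynomial.eval_mul]
  omega

@[fun_prop]
theorem PT.moveProg {core pws : γ → List ℤ} {D i j s : γ → ℤ} {els : γ → List Elem} (hc : PT core)
    (hw : PT pws) (hD : PT D) (hi : PT i) (hj : PT j) (hs : PT s) (he : PT els) :
    PT fun x => moveProg (core x) (pws x) (D x) (i x) (j x) (s x) (els x) := by
  obtain ⟨q, hq⟩ := esize_revalued_le he hD
  exact foldl (step := fun x els t => PCTSP.tryProg (core x) (D x) (i x) (j x) els (s x * t)) hw he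
    (by fun_prop) q fun x l₁ l₂ _ => hq x _ (Revalued.moveProg (pws := l₁) (.refl _ _))

/-- The treatment of a pair of elements. -/
def pairProg (core pws : List ℤ) (pen : List (ℤ × ℤ)) (D : ℤ) (els : List Elem) (p : ℤ × ℤ) :
    List Elem :=
  if ¬ p.1 = p.2 ∧ memProg core D (shiftProg els p.1 p.2 1) ∧
      memProg core D (shiftProg els p.1 p.2 (-1)) then
    moveProg core pws D p.1 p.2 (if objectiveProg pen D (shiftProg els p.1 p.2 1) ≤
      objectiveProg pen D (shiftProg els p.1 p.2 (-1)) then 1 else -1) els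
  else els

@[fun_prop]
theorem PT.pairProg {core pws : γ → List ℤ} {pen : γ → List (ℤ × ℤ)} {D : γ → ℤ}
    {els : γ → List Elem} {p : γ → ℤ × ℤ} (hc : PT core) (hw : PT pws) (hp : PT pen) (hD : PT D)
    (he : PT els) (hq : PT p) :
    PT fun x => pairProg (core x) (pws x) (pen x) (D x) (els x) (p x) := by
  unfold PCTSP.pairProg
  fun_prop

/-- Pipage rounding. -/
def pipageProg (core pws : List ℤ) (pen : List (ℤ × ℤ)) (D : ℤ) (pairs : List (ℤ × ℤ))
    (els : List Elem) : List Elem :=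
  pairs.foldl (pairProg core pws pen D) els

theorem Revalued.pipageProg {core pws : List ℤ} {pen : List (ℤ × ℤ)} {D : ℤ}
    {pairs : List (ℤ × ℤ)} {els els' : List Elem} (h : Revalued D els els') :
    Revalued D els (pipageProg core pws pen D pairs els') := by
  unfold PCTSP.pipageProg
  induction pairs generalizing els' with
  | nil => exact h
  | cons t l ih =>
    refine ih ?_
    unfold PCTSP.pairProg
    split
    · exact h.moveProg
    · exact h

@[fun_prop]
theorem PT.pipageProg {core pws : γ → List ℤ} {pen pairs : γ → List (ℤ × ℤ)} {D : γ → ℤ}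
    {els : γ → List Elem} (hc : PT core) (hw : PT pws) (hp : PT pen) (hD : PT D)
    (hq : PT pairs) (he : PT els) :
    PT fun x => pipageProg (core x) (pws x) (pen x) (D x) (pairs x) (els x) := by
  obtain ⟨q, hq'⟩ := esize_revalued_le he hD
  exact foldl (step := fun x els p => PCTSP.pairProg (core x) (pws x) (pen x) (D x) els p) hq he
    (by fun_prop) q fun x l₁ l₂ _ => hq' x _ (Revalued.pipageProg (pairs := l₁) (.refl _ _))

end Programs

/-! ### The program on the encoded input: core, trees, ground set, selection, output. -/

section MainProgram

variable {γ : Type} [Enc γ]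

/-- All pairs of elements. -/
def allPairs (els : List Elem) : List (ℤ × ℤ) := els.flatMap fun e => els.map fun e' => (e.1, e'.1)

@[fun_prop]
theorem PT.allPairs {els : γ → List Elem} (he : PT els) : PT fun x => allPairs (els x) := by
  unfold PCTSP.allPairs
  fun_prop

/-- A common denominator: the product of all denominators. -/
def commonDen (l : List (ℤ × ℤ)) : ℤ := (l.map fun q => q.2).prod

@[fun_prop]
theorem PT.commonDen {l : γ → List (ℤ × ℤ)} (hl : PT l) : PT fun x => commonDen (l x) := by
  unfold PCTSP.commonDen
  fun_prop

/-- The numerator of a fraction with respect to a common denominator. -/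
def scale (L : ℤ) (q : ℤ × ℤ) : ℤ := q.1 * (L / q.2)

@[fun_prop]
theorem PT.scale {L : γ → ℤ} {q : γ → ℤ × ℤ} (hL : PT L) (hq : PT q) :
    PT fun x => scale (L x) (q x) := by
  unfold PCTSP.scale
  fun_prop

/-- The vertices `v` with `y v = 1`. -/
def coreProg (y : List (ℤ × ℤ)) : List ℤ :=
  (positions y).filter fun v => (nth y v).1 = (nth y v).2

@[fun_prop]
theorem PT.coreProg {y : γ → List (ℤ × ℤ)} (hy : PT y) : PT fun x => coreProg (y x) := by
  unfold PCTSP.coreProg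
  fun_prop

/-- The non-isolated vertices of a graph. -/
def treeVerts (verts : List ℤ) (A : List (List ℤ)) : List ℤ :=
  verts.filter fun v => ∃ w ∈ verts, nth (nth A v) w = 1

@[fun_prop]
theorem PT.treeVerts {verts : γ → List ℤ} {A : γ → List (List ℤ)} (hv : PT verts) (hA : PT A) :
    PT fun x => treeVerts (verts x) (A x) := by
  unfold PCTSP.treeVerts
  fun_prop

/-- The vertices of the core in a tree. -/
def anchorsProg (core verts : List ℤ) (A : List (List ℤ)) : List ℤ :=
  core.filter fun v => v ∈ treeVerts verts A

@[fun_prop]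
theorem PT.anchorsProg {core verts : γ → List ℤ} {A : γ → List (List ℤ)} (hc : PT core)
    (hv : PT verts) (hA : PT A) : PT fun x => anchorsProg (core x) (verts x) (A x) := by
  unfold PCTSP.anchorsProg
  fun_prop

/-- One round of the search in a graph without the edge `e`. -/
def reachStep (verts : List ℤ) (A : List (List ℤ)) (e : ℤ × ℤ) (R : List ℤ) : List ℤ :=
  verts.filter fun w => w ∈ R ∨ ∃ z ∈ R, nth (nth A z) w = 1 ∧
    ¬ ((z = e.1 ∧ w = e.2) ∨ (z = e.2 ∧ w = e.1))

@[fun_prop]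
theorem PT.reachStep {verts R : γ → List ℤ} {A : γ → List (List ℤ)} {e : γ → ℤ × ℤ}
    (hv : PT verts) (hA : PT A) (he : PT e) (hR : PT R) :
    PT fun x => reachStep (verts x) (A x) (e x) (R x) := by
  unfold PCTSP.reachStep
  fun_prop

/-- The vertices that can be reached from `a` in a graph without the edge `e`. -/
def reachProg (verts : List ℤ) (A : List (List ℤ)) (e : ℤ × ℤ) (a : ℤ) : List ℤ :=
  verts.foldl (fun R _ => reachStep verts A e R) [a]

theorem esize_filter_le {α : Type} [Enc α] (p : α → Bool) (l : List α) :
    esize (l.filter p) ≤ esize l := by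
  induction l with
  | nil => simp
  | cons a l ih =>
    rw [List.filter_cons, esize_cons]
    split
    · rw [esize_cons]; omega
    · omega

@[fun_prop]
theorem PT.reachProg {verts : γ → List ℤ} {A : γ → List (List ℤ)} {e : γ → ℤ × ℤ} {a : γ → ℤ}
    (hv : PT verts) (hA : PT A) (he : PT e) (ha : PT a) :
    PT fun x => reachProg (verts x) (A x) (e x) (a x) := by
  have ha' : PT fun x => [a x] := by fun_prop
  obtain ⟨q, hq⟩ := hv.size_bound
  obtain ⟨q', hq'⟩ := ha'.size_bound
  refine foldl (step := fun x R (_ : ℤ) => PCTSP.reachStep (verts x) (A x) (e x) R) hv ha'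
    (by fun_prop) (q + q') fun x l₁ l₂ _ => ?_
  have h1 := hq x
  have h2 := hq' x
  rw [Polynomial.eval_add]
  rcases List.eq_nil_or_concat l₁ with rfl | ⟨l, z, rfl⟩
  · rw [List.foldl_nil]
    omega
  · rw [List.concat_eq_append, List.foldl_append, List.foldl_cons, List.foldl_nil]
    refine (esize_filter_le _ _).trans ?_
    omega

/-- The edges of a graph. -/
def treeEdges (verts : List ℤ) (A : List (List ℤ)) : List (ℤ × ℤ) :=
  verts.flatMap fun u => (verts.filter fun v => u < v ∧ nth (nth A u) v = 1).map fun v => (u, v)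

@[fun_prop]
theorem PT.treeEdges {verts : γ → List ℤ} {A : γ → List (List ℤ)} (hv : PT verts) (hA : PT A) :
    PT fun x => treeEdges (verts x) (A x) := by
  unfold PCTSP.treeEdges
  fun_prop

/-- The edges of the backbone, given the two anchors. -/
def bbEdges (verts : List ℤ) (A : List (List ℤ)) (ab : List ℤ) : List (ℤ × ℤ) :=
  (treeEdges verts A).filter fun e => ¬ nth ab 1 ∈ reachProg verts A e (nth ab 0)

@[fun_prop]
theorem PT.bbEdges {verts ab : γ → List ℤ} {A : γ → List (List ℤ)} (hv : PT verts) (hA : PT A)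
    (hab : PT ab) : PT fun x => bbEdges (verts x) (A x) (ab x) := by
  unfold PCTSP.bbEdges
  fun_prop

/-- The edges of the limbs, given the two anchors. -/
def lbEdges (verts : List ℤ) (A : List (List ℤ)) (ab : List ℤ) : List (ℤ × ℤ) :=
  (treeEdges verts A).filter fun e => nth ab 1 ∈ reachProg verts A e (nth ab 0)

@[fun_prop]
theorem PT.lbEdges {verts ab : γ → List ℤ} {A : γ → List (List ℤ)} (hv : PT verts) (hA : PT A)
    (hab : PT ab) : PT fun x => lbEdges (verts x) (A x) (ab x) := by
  unfold PCTSP.lbEdges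
  fun_prop

/-- The total length of a list of edges, multiplied by `L`. -/
def edgesLength (L : ℤ) (len : List (List (ℤ × ℤ))) (es : List (ℤ × ℤ)) : ℤ :=
  (es.map fun e => scale L (nth (nth len e.1) e.2)).sum

@[fun_prop]
theorem PT.edgesLength {L : γ → ℤ} {len : γ → List (List (ℤ × ℤ))} {es : γ → List (ℤ × ℤ)}
    (hL : PT L) (hl : PT len) (he : PT es) : PT fun x => edgesLength (L x) (len x) (es x) := by
  unfold PCTSP.edgesLength
  fun_prop

/-- The two elements of the ground set that belong to a tree. -/
def treeElems (core verts : List ℤ) (L W c : ℤ) (len : List (List (ℤ × ℤ))) (i : ℤ)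
    (A : List (List ℤ)) (w : ℤ × ℤ) : List Elem :=
  [(2 * i, nth (anchorsProg core verts A) 0, nth (anchorsProg core verts A) 1,
    c * (edgesLength L len (bbEdges verts A (anchorsProg core verts A)) +
      2 * edgesLength L len (lbEdges verts A (anchorsProg core verts A))),
    treeVerts verts A, 3 * scale W w),
   (2 * i + 1, nth (anchorsProg core verts A) 0, nth (anchorsProg core verts A) 1,
    c * edgesLength L len (bbEdges verts A (anchorsProg core verts A)), [], scale W w)]

@[fun_prop]
theorem PT.treeElems {core verts : γ → List ℤ} {L W c i : γ → ℤ} {len : γ → List (List (ℤ × ℤ))}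
    {A : γ → List (List ℤ)} {w : γ → ℤ × ℤ} (hc : PT core) (hv : PT verts) (hL : PT L) (hW : PT W)
    (hcc : PT c) (hi : PT i) (hl : PT len) (hA : PT A) (hw : PT w) :
    PT fun x => treeElems (core x) (verts x) (L x) (W x) (c x) (len x) (i x) (A x) (w x) := by
  unfold PCTSP.treeElems
  fun_prop

/-- The ground set. -/
def allElems (core verts : List ℤ) (L W c : ℤ) (len : List (List (ℤ × ℤ)))
    (trees : List (List (List ℤ))) (w : List (ℤ × ℤ)) : List Elem :=
  (positions trees).flatMap fun i => treeElems core verts L W c len i (nth trees i) (nth w i)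

@[fun_prop]
theorem PT.allElems {core verts : γ → List ℤ} {L W c : γ → ℤ} {len : γ → List (List (ℤ × ℤ))}
    {trees : γ → List (List (List ℤ))} {w : γ → List (ℤ × ℤ)} (hc : PT core) (hv : PT verts)
    (hL : PT L) (hW : PT W) (hcc : PT c) (hl : PT len) (hA : PT trees) (hw : PT w) :
    PT fun x => allElems (core x) (verts x) (L x) (W x) (c x) (len x) (trees x) (w x) := by
  unfold PCTSP.allElems
  fun_prop

/-- The vertices with their scaled penalties, with penalty zero for the core. -/
def penaltyList (core verts : List ℤ) (L D : ℤ) (pen : List (ℤ × ℤ)) : List (ℤ × ℤ) :=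
  verts.map fun v => (v, if v ∈ core then 0 else D * scale L (nth pen v))

@[fun_prop]
theorem PT.penaltyList {core verts : γ → List ℤ} {L D : γ → ℤ} {pen : γ → List (ℤ × ℤ)}
    (hc : PT core) (hv : PT verts) (hL : PT L) (hD : PT D) (hp : PT pen) :
    PT fun x => penaltyList (core x) (verts x) (L x) (D x) (pen x) := by
  unfold PCTSP.penaltyList
  fun_prop

/-- The numbers of the elements that are selected by pipage rounding. -/
def selectProg (core : List ℤ) (pen : List (ℤ × ℤ)) (D : ℤ) (els : List Elem) : List ℤ :=
  ((pipageProg core (powers D) pen D (allPairs els) els).filter fun e => e.2.2.2.2.2 = D).map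
    fun e => e.1

@[fun_prop]
theorem PT.selectProg {core : γ → List ℤ} {pen : γ → List (ℤ × ℤ)} {D : γ → ℤ}
    {els : γ → List Elem} (hc : PT core) (hp : PT pen) (hD : PT D) (he : PT els) :
    PT fun x => selectProg (core x) (pen x) (D x) (els x) := by
  unfold PCTSP.selectProg
  fun_prop

/-- The vertices of the selected multigraph. -/
def outVerts (core verts : List ℤ) (trees : List (List (List ℤ))) (sel : List ℤ) : List ℤ :=
  verts.filter fun v => v ∈ core ∨ ∃ i ∈ positions trees,
    (2 * i ∈ sel ∧ v ∈ treeVerts verts (nth trees i)) ∨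
    (2 * i + 1 ∈ sel ∧ ∃ e ∈ bbEdges verts (nth trees i) (anchorsProg core verts (nth trees i)),
      v = e.1 ∨ v = e.2)

@[fun_prop]
theorem PT.outVerts {core verts sel : γ → List ℤ} {trees : γ → List (List (List ℤ))}
    (hc : PT core) (hv : PT verts) (ht : PT trees) (hs : PT sel) :
    PT fun x => outVerts (core x) (verts x) (trees x) (sel x) := by
  unfold PCTSP.outVerts
  fun_prop

/-- The edges of the selected multigraph. -/
def outEdges (core verts : List ℤ) (trees : List (List (List ℤ))) (sel : List ℤ) :
    List (ℤ × ℤ) :=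
  ((positions trees).flatMap fun i => if 2 * i ∈ sel then
    bbEdges verts (nth trees i) (anchorsProg core verts (nth trees i)) ++
    (lbEdges verts (nth trees i) (anchorsProg core verts (nth trees i)) ++
     lbEdges verts (nth trees i) (anchorsProg core verts (nth trees i))) else []) ++
  ((positions trees).flatMap fun i => if 2 * i + 1 ∈ sel then
    bbEdges verts (nth trees i) (anchorsProg core verts (nth trees i)) else [])

@[fun_prop]
theorem PT.outEdges {core verts sel : γ → List ℤ} {trees : γ → List (List (List ℤ))}
    (hc : PT core) (hv : PT verts) (ht : PT trees) (hs : PT sel) :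
    PT fun x => outEdges (core x) (verts x) (trees x) (sel x) := by
  unfold PCTSP.outEdges
  fun_prop

/-- The type of the input data. -/
abbrev RawInput := ℤ × ℤ × ℤ × List (List (ℤ × ℤ)) × List (ℤ × ℤ) × List (List (ℤ × ℤ)) ×
  List (ℤ × ℤ) × (ℤ × ℤ) × List (List (List ℤ)) × List (ℤ × ℤ) × ℤ

/-- The selection for given lengths, penalties, values `y`, trees and weights. -/
def chooseProg (len : List (List (ℤ × ℤ))) (pen y : List (ℤ × ℤ)) (trees : List (List (List ℤ)))
    (w : List (ℤ × ℤ)) : List ℤ :=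
  selectProg (coreProg y)
    (penaltyList (coreProg y) (positions y) (commonDen (len.flatten ++ pen)) (4 * commonDen w) pen)
    (4 * commonDen w)
    (allElems (coreProg y) (positions y) (commonDen (len.flatten ++ pen)) (commonDen w)
      ((positions trees).map fun _ => (4 * commonDen w) * (4 * commonDen w)).prod len trees w)

@[fun_prop]
theorem PT.chooseProg {len : γ → List (List (ℤ × ℤ))} {pen y w : γ → List (ℤ × ℤ)}
    {trees : γ → List (List (List ℤ))} (hl : PT len) (hp : PT pen) (hy : PT y) (ht : PT trees)
    (hw : PT w) : PT fun x => chooseProg (len x) (pen x) (y x) (trees x) (w x) := by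
  unfold PCTSP.chooseProg
  fun_prop

/-- The output for given values `y`, trees, and selection. -/
def resultProg (y : List (ℤ × ℤ)) (trees : List (List (List ℤ))) (sel : List ℤ) :
    List ℤ × List (ℤ × ℤ) :=
  (outVerts (coreProg y) (positions y) trees sel, outEdges (coreProg y) (positions y) trees sel)

@[fun_prop]
theorem PT.resultProg {y : γ → List (ℤ × ℤ)} {trees : γ → List (List (List ℤ))} {sel : γ → List ℤ}
    (hy : PT y) (ht : PT trees) (hs : PT sel) :
    PT fun x => resultProg (y x) (trees x) (sel x) := by
  unfold PCTSP.resultProg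
  fun_prop

/-- The whole algorithm. -/
def mainProg (I : RawInput) : List ℤ × List (ℤ × ℤ) :=
  resultProg I.2.2.2.2.2.2.1 I.2.2.2.2.2.2.2.2.1
    (chooseProg I.2.2.2.1 I.2.2.2.2.1 I.2.2.2.2.2.2.1 I.2.2.2.2.2.2.2.2.1 I.2.2.2.2.2.2.2.2.2.1)

theorem PT.mainProg : PT PCTSP.mainProg := by
  unfold PCTSP.mainProg
  fun_prop

end MainProgram

/-! ### Correctness of the rounding algorithm -/

open Finset

/-- An enumerated ground set of edges with integer names for its elements and the vertices. -/
structure Coding (V E : Type*) where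
  code : V → ℤ
  code_injective : Function.Injective code
  ident : E → ℤ
  ident_injective : Function.Injective ident
  enum : List E
  enum_nodup : enum.Nodup
  mem_enum : ∀ e, e ∈ enum
  cores : List V
  cores_nodup : cores.Nodup
  verts : List V
  verts_nodup : verts.Nodup
  mem_verts : ∀ v, v ∈ verts
  a : E → V
  b : E → V
  a_mem : ∀ e, a e ∈ cores
  b_mem : ∀ e, b e ∈ cores
  a_ne_b : ∀ e, a e ≠ b e
  length : E → ℤ
  covers : E → V → Bool
  cover : E → List ℤ
  mem_cover : ∀ e v, code v ∈ cover e ↔ covers e v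
  penalty : V → ℤ
  penalty_nonneg : ∀ v, 0 ≤ penalty v

theorem sum_map_of_complete {α : Type*} [Fintype α] {l : List α} (hl : l.Nodup) (h : ∀ a, a ∈ l)
    (f : α → ℤ) : (l.map f).sum = ∑ a, f a := by
  classical
  rw [← List.sum_toFinset f hl]
  exact Finset.sum_congr (by ext a; simp [h]) fun _ _ => rfl

theorem prod_map_of_complete {α : Type*} [Fintype α] {l : List α} (hl : l.Nodup) (h : ∀ a, a ∈ l)
    (f : α → ℤ) : (l.map f).prod = ∏ a, f a := by
  classical
  rw [← List.prod_toFinset f hl]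
  exact Finset.prod_congr (by ext a; simp [h]) fun _ _ => rfl

namespace Coding

variable {V E : Type*} [DecidableEq V] [Fintype V] [Fintype E] [DecidableEq E] (c : Coding V E)

/-- The list of the elements with given values. -/
def elems (x : E → ℤ) : List Elem :=
  c.enum.map fun e => (c.ident e, c.code (c.a e), c.code (c.b e), c.length e, c.cover e, x e)

/-- The state of load balancing. -/
def state (X p : E → ℤ) : List (ℤ × ℤ × ℤ × ℤ) :=
  c.enum.map fun e => (c.code (c.a e), c.code (c.b e), X e, p e)

theorem excessProg_state (D : ℤ) (r v : V) (X p : E → ℤ) :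
    excessProg D (c.code r) (c.state X p) (c.code v) = excess c.a c.b X (capacity D r) p v := by
  rw [excessProg, state, List.map_map, sum_map_of_complete c.enum_nodup c.mem_enum]
  simp only [Function.comp_apply, c.code_injective.eq_iff]
  rfl

theorem balanceProg_state (M D : ℤ) (r : V) (X p : E → ℤ) :
    balanceProg M D (c.code r) (c.state X p) =
      c.state X (balance c.a c.b X (capacity D r) M p) := by
  rw [balanceProg]
  conv_lhs => rw [state, List.map_map]
  rw [state]
  refine List.map_congr_left fun e _ => ?_
  simp only [Function.comp_apply]
  have : (c.enum.map fun e => (c.code (c.a e), c.code (c.b e), X e, p e)) = c.state X p := rfl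
  rw [this, excessProg_state, excessProg_state]
  rfl

theorem balanceRounds_state (M D : ℤ) (r : V) (fuel : List ℤ) (X p : E → ℤ) :
    balanceRounds M D (c.code r) fuel (c.state X p) =
      c.state X ((balance c.a c.b X (capacity D r) M)^[fuel.length] p) := by
  unfold balanceRounds
  induction fuel generalizing p with
  | nil => rfl
  | cons t l ih => rw [List.foldl_cons, balanceProg_state, ih]; rfl

/-- The eighth power covers `64 * M ^ 7` rounds per bit, as the list `u` used in `memProg` has at
least 64 entries. -/
theorem length_roundList (u : List ℤ) (z : ℤ) :
    (roundList u z).length = z.toNat.size * u.length ^ 8 := by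
  simp only [roundList, List.length_flatMap, length_squareList, powers]
  rw [List.map_congr_left (g := fun _ => u.length ^ 8) fun _ _ => by ring]
  simp [Function.comp_def]

variable {c} {D : ℤ} {x : E → ℤ}

/-- The program does not verify the equation for the total. It is a hypothesis here, and exchange
moves preserve it. -/
theorem memProg_elems (hD : 0 ≤ D) (hx : ∑ e, x e = D * ((#c.cores.toFinset : ℤ) - 1)) :
    memProg (c.cores.map c.code) D (c.elems x) ↔
      InTreePolytope c.cores.toFinset c.a c.b D x := by
  have ha : ∀ e, c.a e ∈ c.cores.toFinset := fun e => List.mem_toFinset.2 (c.a_mem e)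
  have hb : ∀ e, c.b e ∈ c.cores.toFinset := fun e => List.mem_toFinset.2 (c.b_mem e)
  have hE : Fintype.card E = c.enum.length := by
    rw [← List.toFinset_card_of_nodup c.enum_nodup, ← Finset.card_univ]
    congr 1
    ext e
    simp [c.mem_enum]
  have hC : #c.cores.toFinset = c.cores.length := List.toFinset_card_of_nodup c.cores_nodup
  obtain ⟨u, hu⟩ : ∃ u, sizeList (c.cores.map c.code) (c.elems x) = u := ⟨_, rfl⟩
  have hlen : u.length = c.enum.length + c.cores.length + 64 := by
    rw [← hu]
    simp [sizeList, elems, add_assoc]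
  -- These are the parameters of `memProg`: `M` bounds the numbers of elements and core vertices,
  -- `F` is the scaling factor, and the bit length of `z` is the exponent `s` of `balance_test_iff`.
  obtain ⟨M, hM⟩ : ∃ M : ℤ, (u.length : ℤ) = M := ⟨_, rfl⟩
  have hM64 : 64 ≤ M := by omega
  obtain ⟨F, hF⟩ : ∃ F, 4 * (M * (M * M)) + 1 = F := ⟨_, rfl⟩
  obtain ⟨z, hz⟩ : ∃ z, M * ((F * D * M) * (F * D * M)) = z := ⟨_, rfl⟩
  have hz0 : 0 ≤ z := by rw [← hz]; exact mul_nonneg (by omega) (mul_self_nonneg _)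
  obtain ⟨fuel, hfuel⟩ : ∃ fuel, roundList u z = fuel := ⟨_, rfl⟩
  have hk : 64 * M ^ 7 * (z.toNat.size : ℕ) ≤ (fuel.length : ℤ) := by
    rw [← hfuel, length_roundList]
    push_cast
    rw [hM, mul_comm _ (M ^ 8), pow_succ M 7]
    refine mul_le_mul_of_nonneg_right ?_ (by positivity)
    rw [mul_comm]
    exact mul_le_mul_of_nonneg_left hM64 (by positivity)
  have hs : M * (F * D * M) ^ 2 < 2 ^ z.toNat.size := by
    rw [sq, hz]
    have := Nat.lt_size_self z.toNat
    zify at this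
    rwa [Int.toNat_of_nonneg hz0] at this
  have key : (∀ e, 0 ≤ x e) → _ := fun h0 => balance_test_iff ha hb c.a_ne_b (by omega : 1 ≤ M)
    (by omega) (by omega) hD (by rw [← hF]; ring : F = 4 * M ^ 3 + 1) h0 hx hs hk
  unfold memProg
  rw [hu, hM, hF, hz, hfuel, testProg]
  have hst : ((c.elems x).map fun e => (e.2.1, e.2.2.1, F * e.2.2.2.2.2, F * e.2.2.2.2.2)) =
      c.state (fun e => F * x e) fun e => F * x e := by
    rw [elems, List.map_map]
    rfl
  rw [hst]
  have hbd : (∀ e ∈ c.elems x, 0 ≤ e.2.2.2.2.2 ∧ e.2.2.2.2.2 ≤ D) ↔ ∀ e, 0 ≤ x e ∧ x e ≤ D := by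
    simp [elems, c.mem_enum]
  rw [hbd]
  have htest : (∀ r ∈ c.cores.map c.code, ∀ v ∈ c.cores.map c.code, M * excessProg (F * D) r
      (balanceRounds M (F * D) r fuel (c.state (fun e => F * x e) fun e => F * x e)) v < F) ↔
      ∀ r ∈ c.cores.toFinset, ∀ v ∈ c.cores.toFinset, M * excess c.a c.b (fun e => F * x e)
        (capacity (F * D) r) ((balance c.a c.b (fun e => F * x e) (capacity (F * D) r)
          M)^[fuel.length] fun e => F * x e) v < F := by
    simp only [List.forall_mem_map, List.mem_toFinset, balanceRounds_state, excessProg_state]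
  rw [htest]
  constructor
  · rintro ⟨h1, h2⟩
    exact (key fun e => (h1 e).1).1 h2
  · intro h
    exact ⟨fun e => ⟨h.nonneg e, h.le ha hb c.a_ne_b e⟩, (key h.nonneg).2 h⟩

theorem shiftProg_elems (i j : E) (t : ℤ) :
    shiftProg (c.elems x) (c.ident i) (c.ident j) t = c.elems (shift x i j t) := by
  rw [shiftProg, elems, List.map_map]
  refine List.map_congr_left fun e _ => ?_
  simp only [Function.comp_apply, c.ident_injective.eq_iff]
  rfl

variable (c) in
/-- The list of the penalties. -/
def penalties : List (ℤ × ℤ) := c.verts.map fun v => (c.code v, c.penalty v)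

theorem objectiveProg_elems : objectiveProg c.penalties D (c.elems x) =
    objective c.length c.penalty c.covers D x := by
  rw [objectiveProg, objective, elems, penalties, List.map_map, List.map_map,
    sum_map_of_complete c.enum_nodup c.mem_enum, sum_map_of_complete c.verts_nodup c.mem_verts]
  congr 1
  refine Finset.sum_congr rfl fun v _ => ?_
  simp only [Function.comp_apply]
  rw [List.map_map, prod_map_of_complete c.enum_nodup c.mem_enum]
  simp only [Function.comp_apply, c.mem_cover]

/-- Binary search with the invariant that `t` is feasible and `t + 2 ^ m` is not. It ends with an
infeasible next unit step, which is all that is needed for a blocked pair. -/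
theorem moveProg_elems {i j : E} (hij : i ≠ j) (hD : 0 ≤ D)
    (hx : InTreePolytope c.cores.toFinset c.a c.b D x) {s : ℤ} (hs : s = 1 ∨ s = -1) :
    ∃ t, 0 ≤ t ∧ moveProg (c.cores.map c.code) (powers D) D (c.ident i) (c.ident j) s (c.elems x) =
      c.elems (shift x i j (s * t)) ∧
      InTreePolytope c.cores.toFinset c.a c.b D (shift x i j (s * t)) ∧
      ¬ InTreePolytope c.cores.toFinset c.a c.b D (shift x i j (s * (t + 1))) := by
  have ha : ∀ e, c.a e ∈ c.cores.toFinset := fun e => List.mem_toFinset.2 (c.a_mem e)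
  have hb : ∀ e, c.b e ∈ c.cores.toFinset := fun e => List.mem_toFinset.2 (c.b_mem e)
  have key : ∀ (m : ℕ) (t : ℤ), 0 ≤ t →
      InTreePolytope c.cores.toFinset c.a c.b D (shift x i j (s * t)) →
      ¬ InTreePolytope c.cores.toFinset c.a c.b D (shift x i j (s * (t + 2 ^ m))) →
      ∃ t', 0 ≤ t' ∧ moveProg (c.cores.map c.code) ((List.range m).map fun i => (2 : ℤ) ^ i).reverse
        D (c.ident i) (c.ident j) s (c.elems (shift x i j (s * t))) =
      c.elems (shift x i j (s * t')) ∧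
      InTreePolytope c.cores.toFinset c.a c.b D (shift x i j (s * t')) ∧
      ¬ InTreePolytope c.cores.toFinset c.a c.b D (shift x i j (s * (t' + 1))) := by
    intro m
    induction m with
    | zero => exact fun t ht h1 h2 => ⟨t, ht, rfl, h1, by simpa using h2⟩
    | succ m ih =>
      intro t ht h1 h2
      have h3 : shiftProg (c.elems (shift x i j (s * t))) (c.ident i) (c.ident j) (s * 2 ^ m) =
          c.elems (shift x i j (s * (t + 2 ^ m))) := by
        rw [shiftProg_elems, shift_shift, mul_add]
      have h4 := memProg_elems (c := c) (x := shift x i j (s * (t + 2 ^ m))) hD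
        (by rw [sum_shift, hx.total])
      rw [List.range_succ, List.map_append, List.reverse_append]
      simp only [List.map_cons, List.map_nil, List.reverse_cons, List.reverse_nil, List.nil_append,
        List.cons_append]
      rw [moveProg, List.foldl_cons, tryProg, h3]
      by_cases h5 : InTreePolytope c.cores.toFinset c.a c.b D (shift x i j (s * (t + 2 ^ m)))
      · rw [if_pos (h4.2 h5)]
        refine ih _ (by positivity) h5 ?_
        rwa [add_assoc, ← two_mul, ← pow_succ']
      · rw [if_neg fun h => h5 (h4.1 h)]
        exact ih t ht h1 h5
  -- All values of a feasible point lie between 0 and `D`, so a move by more than `D` is infeasible.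
  -- This starts the search.
  obtain ⟨t, h⟩ := key D.toNat.size 0 le_rfl (by rwa [mul_zero, shift_zero]) (by
    intro h
    have h1 := Nat.lt_size_self D.toNat
    zify at h1
    rw [Int.toNat_of_nonneg hD] at h1
    rw [zero_add] at h
    rcases hs with rfl | rfl
    · have h2 := h.le ha hb c.a_ne_b i
      have h3 := hx.nonneg i
      rw [shift_left _ hij] at h2
      omega
    · have h2 := h.le ha hb c.a_ne_b j
      have h3 := hx.nonneg j
      rw [shift_right _ hij] at h2
      omega)
  rw [mul_zero, shift_zero] at h
  exact ⟨t, h⟩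

/-- If a unit move is infeasible, the pair is already blocked by integrality. Otherwise it is
unblocked, and the longest move in the better direction blocks it without increasing the concave
objective. -/
theorem pairProg_elems (i j : E) (hD : 0 ≤ D)
    (hx : InTreePolytope c.cores.toFinset c.a c.b D x) : ∃ x' : E → ℤ,
    pairProg (c.cores.map c.code) (powers D) c.penalties D (c.elems x) (c.ident i, c.ident j) =
      c.elems x' ∧ InTreePolytope c.cores.toFinset c.a c.b D x' ∧
    objective c.length c.penalty c.covers D x' ≤ objective c.length c.penalty c.covers D x ∧
    (i ≠ j → Blocked c.cores.toFinset c.a c.b D x' i j) ∧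
    ∀ i' j', Blocked c.cores.toFinset c.a c.b D x i' j' →
      Blocked c.cores.toFinset c.a c.b D x' i' j' := by
  have ha : ∀ e, c.a e ∈ c.cores.toFinset := fun e => List.mem_toFinset.2 (c.a_mem e)
  have hb : ∀ e, c.b e ∈ c.cores.toFinset := fun e => List.mem_toFinset.2 (c.b_mem e)
  have hmem := fun t => memProg_elems (c := c) (x := shift x i j t) hD (by rw [sum_shift, hx.total])
  have hle := fun e => hx.le ha hb c.a_ne_b e
  by_cases hij : i = j
  · refine ⟨x, ?_, hx, le_rfl, fun h => absurd hij h, fun _ _ h => h⟩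
    rw [pairProg, if_neg fun h => h.1 (congrArg c.ident hij)]
  · rw [pairProg]
    split <;> rename_i hcond <;>
      simp only [shiftProg_elems, hmem, objectiveProg_elems, c.ident_injective.eq_iff] at hcond ⊢
    · obtain ⟨-, h1, h2⟩ := hcond
      have hnb := not_blocked hij h1 h2
      obtain ⟨s, hs, hs'⟩ : ∃ s : ℤ, (if objective c.length c.penalty c.covers D (shift x i j 1) ≤
          objective c.length c.penalty c.covers D (shift x i j (-1)) then 1 else -1) = s ∧
          ((s = 1 ∧ objective c.length c.penalty c.covers D (shift x i j 1) ≤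
          objective c.length c.penalty c.covers D (shift x i j (-1))) ∨
          (s = -1 ∧ objective c.length c.penalty c.covers D (shift x j i 1) ≤
          objective c.length c.penalty c.covers D (shift x j i (-1)))) := by
        refine ⟨_, rfl, ?_⟩
        split
        · rename_i h; exact .inl ⟨rfl, h⟩
        · rename_i h
          refine .inr ⟨rfl, ?_⟩
          rw [shift_swap x i j 1, shift_swap x i j (-1), neg_neg]
          exact (not_le.1 h).le
      have hs1 : s = 1 ∨ s = -1 := hs'.imp And.left And.left
      rw [hs]
      obtain ⟨t, ht, h3, h4, h5⟩ := moveProg_elems hij hD hx hs1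
      refine ⟨_, h3, h4, ?_, fun _ => blocked_of_shift hij h4 hs1 ?_, fun i' j' h => h.shift hnb _⟩
      · rcases hs' with ⟨rfl, h⟩ | ⟨rfl, h⟩
        · rw [one_mul]
          exact objective_shift_le _ c.penalty_nonneg _ hD hle hij h ht
        · rw [neg_one_mul, ← shift_swap]
          exact objective_shift_le _ c.penalty_nonneg _ hD hle (Ne.symm hij) h ht
      · rwa [shift_shift, ← mul_add_one]
    · refine ⟨x, rfl, hx, le_rfl, fun _ => ?_, fun _ _ h => h⟩
      by_cases h1 : InTreePolytope c.cores.toFinset c.a c.b D (shift x i j 1)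
      · exact blocked_of_shift hij hx (.inr rfl) fun h2 => hcond ⟨hij, h1, h2⟩
      · exact blocked_of_shift hij hx (.inl rfl) h1

theorem pipageProg_elems (hD : 0 ≤ D) (hx : InTreePolytope c.cores.toFinset c.a c.b D x) :
    ∃ x' : E → ℤ, pipageProg (c.cores.map c.code) (powers D) c.penalties D (allPairs (c.elems x))
      (c.elems x) = c.elems x' ∧ InTreePolytope c.cores.toFinset c.a c.b D x' ∧
    objective c.length c.penalty c.covers D x' ≤ objective c.length c.penalty c.covers D x ∧
    ∀ e, x' e = 0 ∨ x' e = D := by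
  have ha : ∀ e, c.a e ∈ c.cores.toFinset := fun e => List.mem_toFinset.2 (c.a_mem e)
  have hb : ∀ e, c.b e ∈ c.cores.toFinset := fun e => List.mem_toFinset.2 (c.b_mem e)
  have key : ∀ (l : List (E × E)) (x : E → ℤ), InTreePolytope c.cores.toFinset c.a c.b D x →
      ∃ x' : E → ℤ, pipageProg (c.cores.map c.code) (powers D) c.penalties D
        (l.map fun p => (c.ident p.1, c.ident p.2)) (c.elems x) = c.elems x' ∧
      InTreePolytope c.cores.toFinset c.a c.b D x' ∧
      objective c.length c.penalty c.covers D x' ≤ objective c.length c.penalty c.covers D x ∧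
      (∀ p ∈ l, p.1 ≠ p.2 → Blocked c.cores.toFinset c.a c.b D x' p.1 p.2) ∧
      ∀ i' j', Blocked c.cores.toFinset c.a c.b D x i' j' →
        Blocked c.cores.toFinset c.a c.b D x' i' j' := by
    intro l
    induction l with
    | nil => exact fun x hx => ⟨x, rfl, hx, le_rfl, by simp, fun _ _ h => h⟩
    | cons p l ih =>
      intro x hx
      obtain ⟨x₁, h1, h2, h3, h4, h5⟩ := pairProg_elems p.1 p.2 hD hx
      obtain ⟨x₂, g1, g2, g3, g4, g5⟩ := ih x₁ h2
      refine ⟨x₂, ?_, g2, g3.trans h3, ?_, fun i j h => g5 i j (h5 i j h)⟩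
      · rw [← g1, ← h1]
        rfl
      · intro p' hp'
        rcases List.mem_cons.1 hp' with rfl | hp'
        · exact fun hne => g5 _ _ (h4 hne)
        · exact g4 p' hp'
  obtain ⟨x', h1, h2, h3, h4, -⟩ := key (c.enum.flatMap fun i => c.enum.map fun j => (i, j)) x hx
  refine ⟨x', ?_, h2, h3, h2.integral ha hb c.a_ne_b fun i j hij => h4 (i, j) ?_ hij⟩
  · rw [← h1]
    congr 1
    simp [allPairs, elems, List.flatMap_map, List.map_flatMap, Function.comp_def]
  · simp [c.mem_enum]

theorem selectProg_elems (hD : 0 ≤ D) (hx : InTreePolytope c.cores.toFinset c.a c.b D x) :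
    ∃ x' : E → ℤ, (∀ e, c.ident e ∈ selectProg (c.cores.map c.code) c.penalties D (c.elems x) ↔
      x' e = D) ∧ InTreePolytope c.cores.toFinset c.a c.b D x' ∧
    objective c.length c.penalty c.covers D x' ≤ objective c.length c.penalty c.covers D x ∧
    ∀ e, x' e = 0 ∨ x' e = D := by
  obtain ⟨x', h1, h2⟩ := pipageProg_elems hD hx
  refine ⟨x', fun e => ?_, h2⟩
  rw [selectProg, h1, elems]
  simp [c.ident_injective.eq_iff, c.mem_enum]

end Coding

/-! ### Interpretation of the input data -/

section Interpret

/-- A vertex or the number of a tree as an integer. -/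
def finCode {n : ℕ} (v : Fin n) : ℤ := ((v : ℕ) : ℤ)

/-- A pair of vertices as a pair of integers. -/
def pairCode {n : ℕ} (e : Fin n × Fin n) : ℤ × ℤ := (finCode e.1, finCode e.2)

/-- Numerator and denominator. -/
def ratCode (q : ℚ) : ℤ × ℤ := (q.num, q.den)

/-- The adjacency matrix of a subgraph as a list of lists. -/
noncomputable def adjList {n : ℕ} (T : (⊤ : SimpleGraph (Fin n)).Subgraph) : List (List ℤ) :=
  open Classical in List.ofFn fun u => List.ofFn fun v => if T.Adj u v then 1 else 0

/-- An edge function as a list of lists. -/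
def edgeList {n : ℕ} (f : Sym2 (Fin n) → ℚ) : List (List (ℤ × ℤ)) :=
  List.ofFn fun u => List.ofFn fun v => ratCode (if u = v then 0 else f s(u, v))

/-- The input of the algorithm. -/
noncomputable def Input.raw {n k : ℕ} (I : Input (Fin n) (Fin k) ℚ) : RawInput :=
  (n, k, finCode I.root, edgeList I.length, List.ofFn fun v => ratCode (I.penalty v),
    edgeList I.x, List.ofFn fun v => ratCode (I.y v), (finCode I.e₀.inf, finCode I.e₀.sup),
    List.ofFn fun i => adjList (I.tree i), List.ofFn fun i => ratCode (I.weight i), 0)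

/-- A list is encoded by nested pairs ending in 0, so it has the same encoding as a tuple of typed
components with a final 0. This explains the last component of `RawInput`. -/
theorem Input.enc_raw {n k : ℕ} (I : Input (Fin n) (Fin k) ℚ) : enc I.raw = I.encode := by
  simp only [Input.raw, Input.encode, enc, List.map_ofFn, Function.comp_def, edgeList, adjList,
    Input.edgeMatrix, Input.adjMatrix, Val.ofList, Val.ofMat, Val.ofVec, ratCode, Val.ofRat,
    finCode, Val.ofFin]

variable {n : ℕ}

theorem finCode_injective : Function.Injective (finCode (n := n)) := fun u v h => by
  simpa [finCode, Fin.ext_iff] using h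

theorem nth_ofFn {α : Type} [Enc α] [Inhabited α] (f : Fin n → α) (v : Fin n) :
    nth (List.ofFn f) (finCode v) = f v := by
  rw [finCode, nth_natCast]
  simp [List.getD_eq_getElem?_getD]

theorem positions_ofFn {α : Type} [Enc α] (f : Fin n → α) :
    positions (List.ofFn f) = (List.finRange n).map finCode := by
  rw [positions, List.length_ofFn, ← List.map_coe_finRange_eq_range, List.map_map]
  rfl

theorem filter_map_of_iff {α β : Type*} {c : α → β} {P : β → Prop} {Q : α → Prop} {_ : DecidablePred P}
    {_ : DecidablePred Q} {l : List α} (h : ∀ a ∈ l, P (c a) ↔ Q a) :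
    (l.map c).filter (fun b => P b) = (l.filter fun a => Q a).map c := by
  rw [List.filter_map]
  congr 1
  exact List.filter_congr fun a ha => decide_eq_decide.2 (h a ha)

theorem ratCode_eq_iff (q : ℚ) : (ratCode q).1 = (ratCode q).2 ↔ q = 1 := by
  rw [Rat.eq_iff_mul_eq_mul]
  simp [ratCode]

theorem scale_ratCode {L : ℤ} {q : ℚ} (h : (ratCode q).2 ∣ L) :
    ((scale L (ratCode q) : ℤ) : ℝ) = L * q := by
  obtain ⟨m, rfl⟩ := h
  have h0 : (q.den : ℤ) ≠ 0 := by exact_mod_cast q.den_ne_zero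
  have h1 : ((q.den : ℕ) : ℝ) ≠ 0 := by exact_mod_cast q.den_ne_zero
  rw [scale, ratCode, Int.mul_ediv_cancel_left _ h0]
  rw [Rat.cast_def]
  push_cast
  field_simp

theorem dvd_commonDen {q : ℤ × ℤ} {l : List (ℤ × ℤ)} (h : q ∈ l) : q.2 ∣ commonDen l :=
  List.dvd_prod (List.mem_map_of_mem h)

theorem commonDen_pos {l : List (ℤ × ℤ)} (h : ∀ q ∈ l, 0 < q.2) : 0 < commonDen l := by
  refine List.prod_pos fun z hz => ?_
  obtain ⟨q, hq, rfl⟩ := List.mem_map.1 hz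
  exact h q hq

theorem ratCode_pos (q : ℚ) : 0 < (ratCode q).2 := by
  simpa [ratCode] using q.den_pos

/-- The list of all vertices as integers. -/
def vertCodes (n : ℕ) : List ℤ := (List.finRange n).map finCode

theorem mem_vertCodes {z : ℤ} : z ∈ vertCodes n ↔ ∃ v : Fin n, finCode v = z := by
  simp [vertCodes]

theorem finCode_mem_map {v : Fin n} {l : List (Fin n)} : finCode v ∈ l.map finCode ↔ v ∈ l :=
  List.mem_map_of_injective finCode_injective

open Classical in
/-- The core as a list. -/
noncomputable def coreList {K : Type} [One K] (y : Fin n → K) : List (Fin n) :=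
  (List.finRange n).filter fun v => y v = 1

theorem coreProg_ofFn (y : Fin n → ℚ) :
    coreProg (List.ofFn fun v => ratCode (y v)) = (coreList y).map finCode := by
  classical
  rw [coreProg, positions_ofFn, coreList]
  refine filter_map_of_iff fun v _ => ?_
  rw [nth_ofFn, ratCode_eq_iff]

variable {T : (⊤ : SimpleGraph (Fin n)).Subgraph}

theorem nth_adjList {u v : Fin n} :
    nth (nth (adjList T) (finCode u)) (finCode v) = 1 ↔ T.Adj u v := by
  rw [adjList, nth_ofFn, nth_ofFn]
  simp

theorem treeVerts_adjList (hT : ∀ v, v ∈ T.verts ↔ ∃ w, T.Adj v w)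
    [DecidablePred fun v => v ∈ T.verts] :
    treeVerts (vertCodes n) (adjList T) =
      ((List.finRange n).filter fun v => v ∈ T.verts).map finCode := by
  rw [treeVerts]
  conv_lhs => rw [vertCodes]
  refine filter_map_of_iff fun v _ => ?_
  simp [nth_adjList, hT]

theorem finCode_mem_treeVerts (hT : ∀ v, v ∈ T.verts ↔ ∃ w, T.Adj v w) (v : Fin n) :
    finCode v ∈ treeVerts (vertCodes n) (adjList T) ↔ v ∈ T.verts := by
  classical
  rw [treeVerts_adjList hT, finCode_mem_map]
  simp

/-- The names `α`, `β` follow the order in which the program lists the anchors, so that proof and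
program orient each anchor edge in the same way. -/
theorem anchorsProg_adjList (hT : ∀ v, v ∈ T.verts ↔ ∃ w, T.Adj v w)
    {C : List (Fin n)} {U : Set (Fin n)} (hC : C.Nodup) (hCU : ∀ v, v ∈ C ↔ v ∈ U)
    (hcard : (T.verts ∩ U).ncard = 2) :
    ∃ α β, T.verts ∩ U = {α, β} ∧ α ≠ β ∧
      anchorsProg (C.map finCode) (vertCodes n) (adjList T) = [finCode α, finCode β] := by
  classical
  have h1 : anchorsProg (C.map finCode) (vertCodes n) (adjList T) =
      (C.filter fun v => v ∈ T.verts).map finCode := by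
    rw [anchorsProg]
    exact filter_map_of_iff fun v _ => finCode_mem_treeVerts hT v
  obtain ⟨l, hl⟩ : ∃ l, C.filter (fun v => v ∈ T.verts) = l := ⟨_, rfl⟩
  have hnd : l.Nodup := hl ▸ hC.filter _
  have hmem : ∀ v, v ∈ l ↔ v ∈ T.verts ∩ U := fun v => by
    rw [← hl, List.mem_filter, hCU, decide_eq_true_eq, and_comm]
    rfl
  have hlen : l.length = 2 := by
    rw [← hcard, ← List.toFinset_card_of_nodup hnd, ← Set.ncard_coe_finset]
    congr 1
    ext v
    rw [Finset.mem_coe, List.mem_toFinset, hmem]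
  obtain ⟨α, β, rfl⟩ := List.length_eq_two.1 hlen
  refine ⟨α, β, Set.ext fun v => ?_, by simpa using hnd, by rw [h1, hl]; rfl⟩
  rw [← hmem]
  simp

theorem finCode_mem_reachStep {u v w : Fin n} {R : List ℤ} :
    finCode w ∈ reachStep (vertCodes n) (adjList T) (finCode u, finCode v) R ↔
      finCode w ∈ R ∨ ∃ z ∈ R, nth (nth (adjList T) z) (finCode w) = 1 ∧
        ¬ ((z = finCode u ∧ w = v) ∨ (z = finCode v ∧ w = u)) := by
  simp [reachStep, vertCodes, finCode_mem_map, finCode_injective.eq_iff]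

/-- Each round of the search advances by one edge, and paths have fewer than `n` edges, so `n`
rounds suffice. -/
theorem finCode_mem_reachProg {u v a w : Fin n} :
    finCode w ∈ reachProg (vertCodes n) (adjList T) (finCode u, finCode v) (finCode a) ↔
      (T.spanningCoe.deleteEdges {s(u, v)}).Reachable a w := by
  set G := T.spanningCoe.deleteEdges {s(u, v)} with hG
  have hadj : ∀ z w : Fin n, G.Adj z w ↔ nth (nth (adjList T) (finCode z)) (finCode w) = 1 ∧
      ¬ ((finCode z = finCode u ∧ w = v) ∨ (finCode z = finCode v ∧ w = u)) := by
    intro z w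
    rw [hG, SimpleGraph.deleteEdges_adj, nth_adjList]
    simp [finCode_injective.eq_iff]
  have hmono : ∀ (l R : List ℤ) (w : Fin n), finCode w ∈ R → finCode w ∈ l.foldl (fun R _ =>
      reachStep (vertCodes n) (adjList T) (finCode u, finCode v) R) R := by
    intro l
    induction l with
    | nil => exact fun _ _ h => h
    | cons t l ih => exact fun R w h => ih _ w (finCode_mem_reachStep.2 (.inl h))
  constructor
  · have key : ∀ (l R : List ℤ), (∀ z ∈ R, ∃ z' : Fin n, finCode z' = z ∧ G.Reachable a z') →
        ∀ z ∈ l.foldl (fun R _ => reachStep (vertCodes n) (adjList T) (finCode u, finCode v) R) R,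
        ∃ z' : Fin n, finCode z' = z ∧ G.Reachable a z' := by
      intro l
      induction l with
      | nil => exact fun _ h => h
      | cons t l ih =>
        refine fun R h => ih _ fun z hz => ?_
        obtain ⟨w, rfl⟩ := mem_vertCodes.1 (List.mem_filter.1 hz).1
        rw [finCode_mem_reachStep] at hz
        rcases hz with hz | ⟨z, hz, hz'⟩
        · exact h _ hz
        · obtain ⟨z, rfl, hr⟩ := h z hz
          exact ⟨w, rfl, hr.trans ((hadj z w).2 hz').reachable⟩
    intro h
    obtain ⟨w', hw', hr⟩ := key _ _ (by simpa using ⟨a, rfl, .rfl⟩) _ h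
    rwa [← finCode_injective hw']
  · have key : ∀ (z w : Fin n) (p : G.Walk z w) (l R : List ℤ), finCode z ∈ R →
        p.length ≤ l.length → finCode w ∈ l.foldl (fun R _ =>
          reachStep (vertCodes n) (adjList T) (finCode u, finCode v) R) R := by
      intro z w p
      induction p with
      | nil => exact fun l R h _ => hmono l R _ h
      | cons h p ih =>
        intro l R hR hl
        cases l with
        | nil => simp at hl
        | cons t l =>
          exact ih l _ (finCode_mem_reachStep.2 (.inr ⟨_, hR, (hadj _ _).1 h⟩)) (by simpa using hl)
    intro h
    obtain ⟨p, hp⟩ := h.exists_isPath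
    refine key a w p _ _ (by simp) ?_
    have := hp.length_lt
    rw [Fintype.card_fin] at this
    simpa [vertCodes] using this.le

open Classical in
/-- The edges of `T` that belong to `F`, with increasing endpoints. -/
noncomputable def edgePairs (T : (⊤ : SimpleGraph (Fin n)).Subgraph) (F : Set (Sym2 (Fin n))) :
    List (Fin n × Fin n) :=
  ((List.finRange n).flatMap fun u =>
    ((List.finRange n).filter fun v => u < v ∧ T.Adj u v).map fun v => (u, v)).filter
    fun e => s(e.1, e.2) ∈ F

theorem mem_edgePairs {F : Set (Sym2 (Fin n))} {e : Fin n × Fin n} :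
    e ∈ edgePairs T F ↔ (e.1 < e.2 ∧ T.Adj e.1 e.2) ∧ s(e.1, e.2) ∈ F := by
  obtain ⟨u, v⟩ := e
  simp [edgePairs]

theorem treeEdges_adjList : treeEdges (vertCodes n) (adjList T) =
    (edgePairs T Set.univ).map pairCode := by
  classical
  rw [treeEdges, edgePairs]
  simp only [Set.mem_univ, decide_true, List.filter_true, List.map_flatMap, List.map_map]
  conv_lhs => rw [vertCodes, List.flatMap_map]
  refine congrArg (fun f => List.flatMap f _) (funext fun u => ?_)
  rw [filter_map_of_iff (Q := fun v => u < v ∧ T.Adj u v), List.map_map]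
  · rfl
  · intro v _
    rw [nth_adjList]
    simp [finCode]

theorem filter_edgePairs (F : Set (Sym2 (Fin n))) [DecidablePred fun e => e ∈ F] :
    (edgePairs T Set.univ).filter (fun e => s(e.1, e.2) ∈ F) = edgePairs T F := by
  unfold edgePairs
  simp only [Set.mem_univ, decide_true, List.filter_true]
  exact List.filter_congr fun e _ => decide_eq_decide.2 Iff.rfl

theorem nodup_edgePairs {F : Set (Sym2 (Fin n))} : (edgePairs T F).Nodup := by
  refine List.Nodup.filter _ (List.nodup_flatMap.2 ⟨fun u _ => ?_, ?_⟩)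
  · exact ((List.nodup_finRange n).filter _).map fun v w h => (Prod.ext_iff.1 h).2
  · refine (List.nodup_finRange n).pairwise_of_forall_ne fun u _ v _ huv => ?_
    simp only [Function.onFun, List.disjoint_left, List.mem_map, not_exists, not_and]
    rintro _ ⟨w, -, rfl⟩ w' - h
    exact huv (Prod.ext_iff.1 h).1.symm

/-- Listing the endpoints in increasing order makes each edge occur exactly once. -/
theorem edgePairs_val {F : Set (Sym2 (Fin n))} (hF : F ⊆ T.edgeSet) :
    (((edgePairs T F).map fun e => s(e.1, e.2) : List (Sym2 (Fin n))) : Multiset (Sym2 (Fin n))) =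
      (edgeFinset F).val := by
  refine (Multiset.Nodup.ext (Multiset.coe_nodup.2 (List.Nodup.map_on ?_ nodup_edgePairs))
    (Finset.nodup _)).2 fun e => ?_
  · rintro ⟨u, v⟩ h ⟨u', v'⟩ h' he
    rw [mem_edgePairs] at h h'
    rcases Sym2.eq_iff.1 he with ⟨rfl, rfl⟩ | ⟨rfl, rfl⟩
    · rfl
    · exact absurd h.1.1 h'.1.1.asymm
  · rw [Finset.mem_val, mem_edgeFinset, Multiset.mem_coe, List.mem_map]
    constructor
    · rintro ⟨e, he, rfl⟩
      exact (mem_edgePairs.1 he).2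
    · intro he
      induction e using Sym2.ind with
      | _ u v =>
        have hadj : T.Adj u v := hF he
        rcases lt_or_gt_of_ne hadj.ne with h | h
        · exact ⟨(u, v), mem_edgePairs.2 ⟨⟨h, hadj⟩, he⟩, rfl⟩
        · exact ⟨(v, u), mem_edgePairs.2 ⟨⟨h, hadj.symm⟩, by rwa [Sym2.eq_swap]⟩, Sym2.eq_swap⟩

variable {U : Set (Fin n)} {α β : Fin n}

theorem bbEdges_adjList (hT : T.coe.IsTree) (hU : T.verts ∩ U = {α, β}) (hne : α ≠ β) :
    bbEdges (vertCodes n) (adjList T) [finCode α, finCode β] =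
      (edgePairs T (backbone U T)).map pairCode := by
  classical
  rw [bbEdges, treeEdges_adjList, ← filter_edgePairs (backbone U T)]
  refine filter_map_of_iff fun e he => ?_
  rw [mem_backbone_iff hT hU hne, ← finCode_mem_reachProg]
  have := (mem_edgePairs.1 he).1.2
  simp only [this, true_and]
  rfl

theorem lbEdges_adjList (hT : T.coe.IsTree) (hU : T.verts ∩ U = {α, β}) (hne : α ≠ β) :
    lbEdges (vertCodes n) (adjList T) [finCode α, finCode β] =
      (edgePairs T (limbs U T)).map pairCode := by
  classical
  rw [lbEdges, treeEdges_adjList, ← filter_edgePairs (limbs U T)]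
  refine filter_map_of_iff fun e he => ?_
  have := (mem_edgePairs.1 he).1.2
  rw [limbs, Set.mem_sdiff, SimpleGraph.Subgraph.mem_edgeSet, mem_backbone_iff hT hU hne,
    ← finCode_mem_reachProg]
  simp only [this, true_and, not_not]
  rfl

theorem edgesLength_edgePairs {L : ℤ} {f : Sym2 (Fin n) → ℚ} {F : Set (Sym2 (Fin n))}
    (hF : F ⊆ T.edgeSet) (hL : ∀ q ∈ (edgeList f).flatten, q.2 ∣ L) :
    ((edgesLength L (edgeList f) ((edgePairs T F).map pairCode) : ℤ) : ℝ) =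
      L * total (fun e => (f e : ℝ)) F := by
  rw [total_eq_sum_edgeFinset, ← edgePairs_val hF, edgesLength, List.map_map, Multiset.map_coe,
    Multiset.sum_coe, List.map_map, Int.cast_list_sum, List.map_map, ← List.sum_map_mul_left]
  refine congrArg List.sum (List.map_congr_left fun e he => ?_)
  have hne : e.1 ≠ e.2 := (mem_edgePairs.1 he).1.1.ne
  have h1 : nth (nth (edgeList f) (finCode e.1)) (finCode e.2) = ratCode (f s(e.1, e.2)) := by
    rw [edgeList, nth_ofFn, nth_ofFn, if_neg hne]
  have h2 : ratCode (f s(e.1, e.2)) ∈ (edgeList f).flatten := by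
    rw [List.mem_flatten]
    refine ⟨_, List.mem_ofFn.2 ⟨e.1, rfl⟩, List.mem_ofFn.2 ⟨e.2, ?_⟩⟩
    rw [if_neg hne]
  simp only [Function.comp_apply, pairCode]
  rw [h1, scale_ratCode (hL _ h2)]

end Interpret

/-! ### Comparison of the scaled integer problem with the real one. -/

section Scaling

open Finset

variable {V E Y : Type*} [DecidableEq V] [Fintype E] [Fintype Y]

theorem inTreePolytope_scale {C : Finset V} {a b : E → V} {D : ℤ} (hD : 0 < D) {x : E → ℤ}
    {ξ : E → ℝ} (h : ∀ e, (x e : ℝ) = D * ξ e) :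
    InTreePolytope C a b D x ↔ InTreePolytope C a b 1 ξ := by
  have hD' : (0 : ℝ) < D := by exact_mod_cast hD
  have h1 : ∀ S : Finset E, ((∑ e ∈ S, x e : ℤ) : ℝ) = D * ∑ e ∈ S, ξ e := by
    intro S
    push_cast
    rw [Finset.mul_sum]
    exact Finset.sum_congr rfl fun e _ => h e
  have h2 : (∀ e, 0 ≤ x e) ↔ ∀ e, 0 ≤ ξ e := by
    refine forall_congr' fun e => ?_
    rw [← Int.cast_nonneg_iff (R := ℝ), h, mul_nonneg_iff_of_pos_left hD']
  have h3 : (∑ e, x e = D * ((#C : ℤ) - 1)) ↔ ∑ e, ξ e = 1 * ((#C : ℝ) - 1) := by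
    rw [← Int.cast_inj (α := ℝ), h1]
    push_cast
    rw [one_mul, mul_right_inj' hD'.ne']
  have h4 : (∀ S ⊆ C, S.Nonempty → mass a b x S ≤ D * ((#S : ℤ) - 1)) ↔
      ∀ S ⊆ C, S.Nonempty → mass a b ξ S ≤ 1 * ((#S : ℝ) - 1) := by
    refine forall_congr' fun S => forall_congr' fun _ => forall_congr' fun _ => ?_
    rw [← Int.cast_le (R := ℝ), mass, h1]
    push_cast
    rw [one_mul, mul_le_mul_iff_right₀ hD']
    rfl
  exact ⟨fun g => ⟨h2.1 g.nonneg, h3.1 g.total, h4.1 g.mass_le⟩,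
    fun g => ⟨h2.2 g.nonneg, h3.2 g.total, h4.2 g.mass_le⟩⟩

/-- The objective has a factor `D` also for elements that do not cover `v`, so every product scales
by `D ^ Fintype.card E`, whereas the linear part scales by `D`. The additional factors in the
integer lengths and penalties balance the two parts. -/
theorem objective_scale {D L : ℤ} {x d : E → ℤ} {ξ d' : E → ℝ} {p : Y → ℤ} {p' : Y → ℝ}
    (cov : E → Y → Bool) (hx : ∀ e, (x e : ℝ) = D * ξ e)
    (hd : ∀ e, (d e : ℝ) = D ^ Fintype.card E * L * d' e) (hp : ∀ v, (p v : ℝ) = D * L * p' v) :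
    ((objective d p cov D x : ℤ) : ℝ) =
      D ^ Fintype.card E * L * D * objective d' p' cov 1 ξ := by
  unfold objective
  push_cast
  rw [mul_add, Finset.mul_sum, Finset.mul_sum]
  congr 1
  · refine Finset.sum_congr rfl fun e _ => ?_
    rw [hx, hd]
    ring
  · refine Finset.sum_congr rfl fun v _ => ?_
    have : ∀ e, (if cov e v then (D : ℝ) - x e else D) = D * if cov e v then 1 - ξ e else 1 := by
      intro e
      rw [hx]
      split <;> ring
    simp only [this, Finset.prod_mul_distrib, Finset.prod_const, Finset.card_univ]
    rw [hp]
    ring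

end Scaling

/-! ### Correctness of the algorithm -/

section Correctness

variable {n k : ℕ} {I : Input (Fin n) (Fin k) ℚ} {α β : Fin k → Fin n}

theorem mem_coreList (v : Fin n) : v ∈ coreList I.y ↔ v ∈ core I.toReal.y := by
  change _ ↔ (I.y v : ℝ) = 1
  norm_cast
  simp [coreList]

theorem nodup_coreList : (coreList I.y).Nodup := by
  classical
  exact (List.nodup_finRange n).filter _

theorem exists_anchors_prog (hI : I.toReal.Valid) : ∃ α β : Fin k → Fin n,
    (∀ i, (I.tree i).verts ∩ core I.toReal.y = {α i, β i}) ∧ (∀ i, α i ≠ β i) ∧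
    (∀ i v, v ∈ (I.tree i).verts ↔ ∃ w, (I.tree i).Adj v w) ∧
    ∀ i, anchorsProg ((coreList I.y).map finCode) (vertCodes n) (adjList (I.tree i)) =
      [finCode (α i), finCode (β i)] := by
  obtain ⟨α, β, hU, hne⟩ := exists_anchors hI
  have hT : ∀ i v, v ∈ (I.tree i).verts ↔ ∃ w, (I.tree i).Adj v w :=
    fun i v => exists_adj (hI.isDecomposition.isTree i) (hU i) (hne i) v
  choose α β h1 h2 h3 using fun i => anchorsProg_adjList (hT i) nodup_coreList mem_coreList
    (hI.isDecomposition.anchors i)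
  exact ⟨α, β, h1, h2, hT, h3⟩

/-- The integer name of a copy of a tree. -/
def copyCode (e : Fin k × Bool) : ℤ := if e.2 then 2 * finCode e.1 else 2 * finCode e.1 + 1

theorem copyCode_injective : Function.Injective (copyCode (k := k)) := by
  rintro ⟨i, b⟩ ⟨j, b'⟩ h
  have : finCode i = finCode j ∧ b = b' := by
    cases b <;> cases b' <;> simp [copyCode] at h ⊢ <;> omega
  rw [finCode_injective this.1, this.2]

/-- The list of all copies of trees. -/
def copyList (k : ℕ) : List (Fin k × Bool) :=
  (List.finRange k).flatMap fun i => [(i, true), (i, false)]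

theorem mem_copyList (e : Fin k × Bool) : e ∈ copyList k := by
  obtain ⟨i, b⟩ := e
  cases b <;> simp [copyList]

theorem nodup_copyList : (copyList k).Nodup := by
  refine List.nodup_flatMap.2 ⟨fun i _ => by simp, ?_⟩
  refine (List.nodup_finRange k).pairwise_of_forall_ne fun i _ j _ hij => ?_
  simp [Function.onFun, hij.symm]

/-- The ground set of the rounding algorithm. -/
noncomputable def copyCoding (I : Input (Fin n) (Fin k) ℚ) (α β : Fin k → Fin n)
    (hα : ∀ i, α i ∈ coreList I.y) (hβ : ∀ i, β i ∈ coreList I.y) (hne : ∀ i, α i ≠ β i)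
    (hT : ∀ i v, v ∈ (I.tree i).verts ↔ ∃ w, (I.tree i).Adj v w)
    (len : Fin k × Bool → ℤ) (pen : Fin n → ℤ) (hpen : ∀ v, 0 ≤ pen v) :
    Coding (Fin n) (Fin k × Bool) where
  code := finCode
  code_injective := finCode_injective
  ident := copyCode
  ident_injective := copyCode_injective
  enum := copyList k
  enum_nodup := nodup_copyList
  mem_enum := mem_copyList
  cores := coreList I.y
  cores_nodup := nodup_coreList
  verts := List.finRange n
  verts_nodup := List.nodup_finRange n
  mem_verts := List.mem_finRange
  a e := α e.1
  b e := β e.1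
  a_mem e := hα e.1
  b_mem e := hβ e.1
  a_ne_b e := hne e.1
  length := len
  covers := copyCovers I.toReal
  cover e := if e.2 then treeVerts (vertCodes n) (adjList (I.tree e.1)) else []
  mem_cover e v := by
    obtain ⟨i, b⟩ := e
    cases b
    · simp [copyCovers]
    · simp only [if_true, finCode_mem_treeVerts (hT i), copyCovers, Bool.true_and,
        decide_eq_true_eq]
      rfl
  penalty := pen
  penalty_nonneg := hpen

theorem denominators_dvd {I : Input (Fin n) (Fin k) ℚ} :
    (∀ q ∈ (edgeList I.length).flatten,
      q.2 ∣ commonDen ((edgeList I.length).flatten ++ List.ofFn fun v => ratCode (I.penalty v))) ∧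
    (∀ v, (ratCode (I.penalty v)).2 ∣
      commonDen ((edgeList I.length).flatten ++ List.ofFn fun v => ratCode (I.penalty v))) ∧
    0 < commonDen ((edgeList I.length).flatten ++ List.ofFn fun v => ratCode (I.penalty v)) := by
  refine ⟨fun q hq => dvd_commonDen (List.mem_append_left _ hq), fun v =>
    dvd_commonDen (List.mem_append_right _ (List.mem_ofFn.2 ⟨v, rfl⟩)), commonDen_pos fun q hq => ?_⟩
  rcases List.mem_append.1 hq with hq | hq
  · obtain ⟨l, hl, hq⟩ := List.mem_flatten.1 hq
    obtain ⟨u, rfl⟩ := List.mem_ofFn.1 hl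
    obtain ⟨v, rfl⟩ := List.mem_ofFn.1 hq
    exact ratCode_pos _
  · obtain ⟨v, rfl⟩ := List.mem_ofFn.1 hq
    exact ratCode_pos _

theorem exists_choice (hI : I.toReal.Valid) : ∃ full half : Finset (Fin k),
    (∀ i, 2 * finCode i ∈ chooseProg (edgeList I.length) (List.ofFn fun v => ratCode (I.penalty v))
      (List.ofFn fun v => ratCode (I.y v)) (List.ofFn fun i => adjList (I.tree i))
      (List.ofFn fun i => ratCode (I.weight i)) ↔ i ∈ full) ∧
    (∀ i, 2 * finCode i + 1 ∈ chooseProg (edgeList I.length)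
      (List.ofFn fun v => ratCode (I.penalty v)) (List.ofFn fun v => ratCode (I.y v))
      (List.ofFn fun i => adjList (I.tree i)) (List.ofFn fun i => ratCode (I.weight i)) ↔ i ∈ half) ∧
    I.toReal.Good (selection I.toReal full half) := by
  classical
  obtain ⟨α, β, hU, hne, hT, hab⟩ := exists_anchors_prog hI
  have hα : ∀ i, α i ∈ coreList I.y := fun i => (mem_coreList _).2
    (show α i ∈ (I.tree i).verts ∩ core I.toReal.y by rw [hU]; simp).2
  have hβ : ∀ i, β i ∈ coreList I.y := fun i => (mem_coreList _).2
    (show β i ∈ (I.tree i).verts ∩ core I.toReal.y by rw [hU]; simp).2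
  obtain ⟨hL1, hL2, hL0⟩ := denominators_dvd (I := I)
  obtain ⟨L, hL⟩ : ∃ L, commonDen ((edgeList I.length).flatten ++
    List.ofFn fun v => ratCode (I.penalty v)) = L := ⟨_, rfl⟩
  rw [hL] at hL1 hL2 hL0
  obtain ⟨W, hW⟩ : ∃ W, commonDen (List.ofFn fun i => ratCode (I.weight i)) = W := ⟨_, rfl⟩
  have hW0 : 0 < W := by
    rw [← hW]
    refine commonDen_pos fun q hq => ?_
    obtain ⟨v, rfl⟩ := List.mem_ofFn.1 hq
    exact ratCode_pos _
  have hW1 : ∀ i, (ratCode (I.weight i)).2 ∣ W := fun i => by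
    rw [← hW]
    exact dvd_commonDen (List.mem_ofFn.2 ⟨i, rfl⟩)
  -- `W` clears the denominators of the weights, and the factor 4 those of 3/4 and 1/4.
  obtain ⟨D, hD⟩ : ∃ D, 4 * W = D := ⟨_, rfl⟩
  have hD0 : 0 < D := by omega
  have hDR : (D : ℝ) = 4 * W := by rw [← hD]; push_cast; rfl
  -- There are two copies per tree, so one factor `D * D` per tree gives the power required by
  -- `objective_scale`.
  have hpow : (((List.finRange k).map finCode).map fun _ => D * D).prod =
      D ^ Fintype.card (Fin k × Bool) := by
    simp [← sq, Function.comp_def, ← pow_mul, mul_comm]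
  set K : ℤ := D ^ Fintype.card (Fin k × Bool) with hK
  let len : Fin k × Bool → ℤ := fun e => if e.2 then
    K * (edgesLength L (edgeList I.length) ((edgePairs (I.tree e.1)
        (backbone (core I.toReal.y) (I.tree e.1))).map pairCode) +
      2 * edgesLength L (edgeList I.length) ((edgePairs (I.tree e.1)
        (limbs (core I.toReal.y) (I.tree e.1))).map pairCode)) else
    K * edgesLength L (edgeList I.length) ((edgePairs (I.tree e.1)
        (backbone (core I.toReal.y) (I.tree e.1))).map pairCode)
  let pen : Fin n → ℤ := fun v =>
    if finCode v ∈ (coreList I.y).map finCode then 0 else D * scale L (ratCode (I.penalty v))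
  let x₀ : Fin k × Bool → ℤ := fun e =>
    if e.2 then 3 * scale W (ratCode (I.weight e.1)) else scale W (ratCode (I.weight e.1))
  have hpenR : ∀ v, (pen v : ℝ) = D * L * outerPenalty I.toReal v := by
    intro v
    simp only [pen, outerPenalty, finCode_mem_map, mem_coreList]
    split
    · simp
    · push_cast
      rw [scale_ratCode (hL2 v), mul_assoc]
      rfl
  have hpen : ∀ v, 0 ≤ pen v := by
    intro v
    have : (0 : ℝ) ≤ pen v := by
      rw [hpenR]
      have h1 : (0 : ℝ) < D := by exact_mod_cast hD0
      have h2 : (0 : ℝ) < L := by exact_mod_cast hL0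
      have h3 := outerPenalty_nonneg hI v
      positivity
    exact_mod_cast this
  have hlenR : ∀ e, (len e : ℝ) = D ^ Fintype.card (Fin k × Bool) * L * copyLength I.toReal e := by
    rintro ⟨i, b⟩
    have h1 := edgesLength_edgePairs (T := I.tree i) (L := L) (f := I.length)
      (backbone_subset (core I.toReal.y) (I.tree i)) hL1
    have h2 := edgesLength_edgePairs (T := I.tree i) (L := L) (f := I.length)
      (F := limbs (core I.toReal.y) (I.tree i)) Set.sdiff_subset hL1
    have h3 : (K : ℝ) = D ^ Fintype.card (Fin k × Bool) := by rw [hK]; push_cast; rfl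
    cases b
    · simp only [len, copyLength, Bool.false_eq_true, if_false, add_zero]
      push_cast
      rw [h1, h3, ← mul_assoc]
      rfl
    · simp only [len, copyLength, if_true]
      push_cast
      rw [h1, h2, h3]
      change _ = _ * (total (fun e => (I.length e : ℝ)) _ +
        2 * total (fun e => (I.length e : ℝ)) _)
      ring_nf
      rfl
  have hx₀R : ∀ e, (x₀ e : ℝ) = D * copyWeight I.toReal e := by
    rintro ⟨i, b⟩
    have h1 := scale_ratCode (hW1 i)
    have h2 : I.toReal.weight i = (I.weight i : ℝ) := rfl
    cases b
    · simp only [x₀, copyWeight, Bool.false_eq_true, if_false]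
      rw [h1, hDR, h2]
      ring
    · simp only [x₀, copyWeight, if_true]
      push_cast
      rw [h1, hDR, h2]
      ring
  let c := copyCoding I α β hα hβ hne hT len pen hpen
  have hchoose : chooseProg (edgeList I.length) (List.ofFn fun v => ratCode (I.penalty v))
      (List.ofFn fun v => ratCode (I.y v)) (List.ofFn fun i => adjList (I.tree i))
      (List.ofFn fun i => ratCode (I.weight i)) =
      selectProg (c.cores.map c.code) c.penalties D (c.elems x₀) := by
    have hvc : (List.finRange n).map finCode = vertCodes n := rfl
    rw [chooseProg, coreProg_ofFn, positions_ofFn, positions_ofFn, hL, hW, hD, hpow]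
    congr 1
    · rw [penaltyList, List.map_map]
      refine List.map_congr_left fun v _ => ?_
      simp only [Function.comp_apply, nth_ofFn]
      rfl
    · rw [allElems, positions_ofFn, Coding.elems]
      change _ = (copyList k).map _
      rw [copyList, List.flatMap_map, List.map_flatMap]
      refine congrArg (fun f => List.flatMap f _) (funext fun i => ?_)
      rw [nth_ofFn, nth_ofFn, treeElems]
      have hT' := hI.isDecomposition.isTree i
      rw [hvc, hab, bbEdges_adjList (T := I.tree i) hT' (hU i) (hne i),
        lbEdges_adjList (T := I.tree i) hT' (hU i) (hne i)]
      rfl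
  have hC : ∀ v, v ∈ c.cores.toFinset ↔ v ∈ core I.toReal.y := fun v => by
    rw [List.mem_toFinset]
    exact mem_coreList v
  have hmem : InTreePolytope c.cores.toFinset c.a c.b D x₀ :=
    (inTreePolytope_scale hD0 hx₀R).2 (copyWeight_mem hI hU hne hC)
  obtain ⟨x, hsel, hx, hobj, h01⟩ := Coding.selectProg_elems hD0.le hmem
  have hDR0 : (0 : ℝ) < D := by exact_mod_cast hD0
  have hLR0 : (0 : ℝ) < L := by exact_mod_cast hL0
  -- The integral point with values 0 and `D` is scaled back to a 0-1 point, for which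
  -- `good_selection` applies.
  let ξ : Fin k × Bool → ℝ := fun e => x e / D
  have hξ : ∀ e, (x e : ℝ) = D * ξ e := fun e => by
    simp only [ξ]
    field_simp
  have hξ1 : ∀ e, ξ e = 1 ↔ x e = D := fun e => by
    simp only [ξ]
    rw [div_eq_one_iff_eq hDR0.ne', Int.cast_inj]
  rw [hchoose]
  refine ⟨Finset.univ.filter fun i => ξ (i, true) = 1, Finset.univ.filter fun i => ξ (i, false) = 1,
    fun i => ?_, fun i => ?_, good_selection hI hU hne hC ((inTreePolytope_scale hD0 hξ).1 hx) ?_ ?_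
      (by simp) (by simp)⟩
  · rw [Finset.mem_filter, hξ1, ← hsel]
    simp [c, copyCoding, copyCode]
  · rw [Finset.mem_filter, hξ1, ← hsel]
    simp [c, copyCoding, copyCode]
  · intro e
    refine (h01 e).imp (fun h => ?_) fun h => (hξ1 e).2 h
    simp [ξ, h]
  · have h1 : ((objective c.length c.penalty c.covers D x : ℤ) : ℝ) ≤
        (objective c.length c.penalty c.covers D x₀ : ℤ) := by exact_mod_cast hobj
    rw [objective_scale (d := c.length) (p := c.penalty) c.covers hξ hlenR hpenR,
      objective_scale (d := c.length) (p := c.penalty) c.covers hx₀R hlenR hpenR] at h1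
    exact le_of_mul_le_mul_left h1 (by positivity)

theorem coe_flatMap {α β : Type*} (l : List α) (f : α → List β) :
    ((l.flatMap f : List β) : Multiset β) = (l.map fun a => (f a : Multiset β)).sum := by
  induction l with
  | nil => rfl
  | cons a l ih => rw [List.flatMap_cons, ← Multiset.coe_add, ih, List.map_cons, List.sum_cons]

theorem isEncodedBy_result (hI : I.toReal.Valid) {full half : Finset (Fin k)} {sel : List ℤ}
    (hfull : ∀ i, 2 * finCode i ∈ sel ↔ i ∈ full)
    (hhalf : ∀ i, 2 * finCode i + 1 ∈ sel ↔ i ∈ half) :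
    (selection I.toReal full half).IsEncodedBy (enc (resultProg (List.ofFn fun v => ratCode (I.y v))
      (List.ofFn fun i => adjList (I.tree i)) sel)) := by
  classical
  obtain ⟨α, β, hU, hne, hT, hab⟩ := exists_anchors_prog hI
  have hbb := fun i => bbEdges_adjList (T := I.tree i) (hI.isDecomposition.isTree i) (hU i) (hne i)
  have hlb := fun i => lbEdges_adjList (T := I.tree i) (hI.isDecomposition.isTree i) (hU i) (hne i)
  let bb := fun i => edgePairs (I.tree i) (backbone (core I.toReal.y) (I.tree i))
  let lb := fun i => edgePairs (I.tree i) (limbs (core I.toReal.y) (I.tree i))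
  let vs := (List.finRange n).filter fun v => v ∈ selectionVerts I.toReal full half
  let es := ((List.finRange k).flatMap fun i => if i ∈ full then bb i ++ (lb i ++ lb i) else []) ++
    (List.finRange k).flatMap fun i => if i ∈ half then bb i else []
  have hv : outVerts ((coreList I.y).map finCode) (vertCodes n)
      (List.ofFn fun i => adjList (I.tree i)) sel = vs.map finCode := by
    rw [outVerts, positions_ofFn]
    conv_lhs => rw [vertCodes]
    refine filter_map_of_iff fun v _ => ?_
    change (_ ∨ ∃ i ∈ _, (_ ∧ finCode v ∈ treeVerts (vertCodes n) _) ∨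
      (_ ∧ ∃ e ∈ bbEdges (vertCodes n) _ (anchorsProg _ (vertCodes n) _), _)) ↔ _
    simp only [List.mem_map, List.mem_finRange, true_and, exists_exists_eq_and, nth_ofFn, hfull,
      hhalf, finCode_mem_treeVerts (hT _), finCode_injective.eq_iff, exists_eq_right, mem_coreList]
    rw [selectionVerts, Set.mem_ofPred_eq, ← exists_or]
    refine or_congr Iff.rfl (exists_congr fun i => or_congr Iff.rfl (and_congr_right fun _ => ?_))
    rw [hab, hbb]
    simp only [List.mem_map]
    constructor
    · rintro ⟨_, ⟨⟨a, b⟩, he, rfl⟩, h⟩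
      refine ⟨s(a, b), (mem_edgePairs.1 he).2, ?_⟩
      simpa [pairCode, finCode_injective.eq_iff] using h
    · rintro ⟨e, he, hve⟩
      have he' : e ∈ ((edgePairs (I.tree i) (backbone (core I.toReal.y) (I.tree i))).map
          fun e => s(e.1, e.2)) := by
        rw [← Multiset.mem_coe, edgePairs_val (backbone_subset _ _), Finset.mem_val, mem_edgeFinset]
        exact he
      obtain ⟨⟨a, b⟩, h, rfl⟩ := List.mem_map.1 he'
      refine ⟨_, ⟨(a, b), h, rfl⟩, ?_⟩
      simpa [pairCode, finCode_injective.eq_iff] using hve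
  have he : outEdges ((coreList I.y).map finCode) (vertCodes n)
      (List.ofFn fun i => adjList (I.tree i)) sel = es.map pairCode := by
    rw [outEdges, positions_ofFn, List.map_append, List.flatMap_map, List.flatMap_map,
      List.map_flatMap, List.map_flatMap]
    congr 1
    · refine congrArg (fun f => List.flatMap f _) (funext fun i => ?_)
      rw [nth_ofFn, hab, hbb, hlb, apply_ite (List.map pairCode)]
      simp only [hfull, List.map_append, List.map_nil, bb, lb]
    · refine congrArg (fun f => List.flatMap f _) (funext fun i => ?_)
      rw [nth_ofFn, hab, hbb, apply_ite (List.map pairCode)]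
      simp only [hhalf, List.map_nil, bb]
  refine ⟨vs, es, ?_, ?_, ?_⟩
  · refine (Multiset.Nodup.ext (Multiset.coe_nodup.2 ((List.nodup_finRange n).filter _))
      (Finset.nodup _)).2 fun v => ?_
    rw [Finset.mem_val, mem_selection_verts, Multiset.mem_coe, List.mem_filter, decide_eq_true_eq]
    simp
  · change _ = selectionEdges I.toReal full half
    rw [← Multiset.map_coe, ← Multiset.coe_add, Multiset.map_add, coe_flatMap, coe_flatMap,
      ← Fin.sum_univ_def, ← Fin.sum_univ_def, selectionEdges]
    have h1 := fun i => edgePairs_val (backbone_subset (core I.toReal.y) (I.tree i))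
    have h2 := fun i => edgePairs_val (T := I.tree i)
      (F := limbs (core I.toReal.y) (I.tree i)) Set.sdiff_subset
    simp only [← Multiset.map_coe] at h1 h2
    have hs : ∀ (s : Finset (Fin k)) (f : Fin k → Multiset (Sym2 (Fin n))),
        ∑ i ∈ s, f i = ∑ i, if i ∈ s then f i else 0 := fun s f => by
      rw [Finset.sum_ite_mem, Finset.univ_inter]
    rw [← Multiset.coe_mapAddMonoidHom, map_sum, map_sum, hs full, hs half]
    congr 1
    · refine Finset.sum_congr rfl fun i _ => ?_
      split
      · rw [← Multiset.coe_add, ← Multiset.coe_add, map_add, map_add, two_nsmul]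
        simp only [Multiset.coe_mapAddMonoidHom, bb, lb, h1, h2]
        rfl
      · rfl
    · refine Finset.sum_congr rfl fun i _ => ?_
      split
      · exact h1 i
      · rfl
  · rw [resultProg, coreProg_ofFn, positions_ofFn]
    change enc (outVerts _ (vertCodes n) _ _, outEdges _ (vertCodes n) _ _) = _
    rw [hv, he]
    simp only [enc, List.map_map]
    rfl

end Correctness

end PCTSP

theorem lemma19 :
    (∀ (V ι : Type*) [Finite V] [Finite ι] (I : PCTSP.Input V ι ℝ), I.Valid →
      ∃ H : PCTSP.Multigraph V, I.Good H) ∧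
    (∃ (p : PCTSP.Prog) (q : Polynomial ℕ), ∀ (n k : ℕ) (I : PCTSP.Input (Fin n) (Fin k) ℚ), I.toReal.Valid →
      ∃ (out : PCTSP.Val) (t : ℕ) (H : PCTSP.Multigraph (Fin n)),
        p.Eval I.encode out t ∧ t ≤ q.eval I.encode.size ∧ H.IsEncodedBy out ∧ I.toReal.Good H) := by
  refine ⟨fun V ι _ _ I hI => ?_, ?_⟩
  · classical
    cases nonempty_fintype V
    cases nonempty_fintype ι
    exact PCTSP.exists_good hI
  · obtain ⟨p, q, h⟩ := PCTSP.PT.mainProg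
    refine ⟨p, q, fun n k I hI => ?_⟩
    obtain ⟨t, ht, hq⟩ := h I.raw
    obtain ⟨full, half, hfull, hhalf, hgood⟩ := PCTSP.exists_choice hI
    rw [PCTSP.esize, I.enc_raw] at hq
    rw [I.enc_raw] at ht
    exact ⟨_, t, _, ht, hq, PCTSP.isEncodedBy_result hI hfull hhalf, hgood⟩
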